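/- Let $(M,g)$ be a connected smooth pseudo-Riemannian manifold of signature $(p,p)$ with $p\ge 5$, with Levi-Civita connection $\nabla$ and curvature operator $R(x,y)=\nabla_x\nabla_y-\nabla_y\nabla_x-\nabla_{[x,y]}$. For an oriented spacelike $2$-plane $\pi\subset T_PM$ (i.e. $g$ is positive definite on $\pi$) with oriented basis $(x,y)$, let $$R(\pi)=|g(x,x)g(y,y)-g(x,y)^2|^{-1/2}\,R(x,y),$$ which does not depend on the oriented basis. Assume that $(M,g)$ is spacelike rank $2$ nilpotent Jordan IP, i.e. at each point $P\in M$: $R(\pi)$ has rank $2$ and is nilpotent for every oriented spacelike $2$-plane $\pi\subset T_PM$, and $R(\pi)$, $R(\pi')$ are conjugate (have the same real Jordan normal form) for any two oriented spacelike $2$-planes $\pi,\pi'\subset T_PM$. For an endomorphism $\phi$ of $T_PM$ put $R_\phi(x,y)z=g(\phi y,z)\,\phi x-g(\phi x,z)\,\phi y$. Then there is a sign $\varepsilon\in\{1,-1\}$, constant on $M$, such that: 1. Every point of $M$ has an open neighbourhood $U$ on which there is a smooth field $\phi$ of endomorphisms of $TM$ such that, at every point of $U$, $R=\varepsilon R_\phi$,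 $\phi$ is self-adjoint with respect to $g$, and $\ker\phi=\operatorname{range}\phi$. 2. If for every $P\in M$ an endomorphism $\phi_P$ of $T_PM$ is chosen which is self-adjoint with $\ker\phi_P=\operatorname{range}\phi_P$ and $R=\varepsilon R_{\phi_P}$ at $P$, then $P\mapsto\operatorname{range}\phi_P$ is an integrable distribution of rank $p$ in $TM$: it is spanned near each point by $p$ smooth linearly independent vector fields, and through each point of $M$ passes a smooth immersed $p$-dimensional submanifold whose tangent space at each of its points $Q$ is $\operatorname{range}\phi_Q$. -/

import Mathlib

open Set Bundle Manifold VectorField FiberBundle Module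
open scoped ContDiff Topology

set_option linter.unusedSectionVars false

noncomputable section

/-! ### Curvature operators on an inner product space of arbitrary signature -/

section Algebra

variable {V : Type*} [AddCommGroup V] [Module ℝ V]

/-- `(x, y)` is a basis of a spacelike plane: the inner product is positive definite on the span. -/
def IsSpacelikeBasis (B : LinearMap.BilinForm ℝ V) (x y : V) : Prop :=
  LinearIndependent ℝ ![x, y] ∧ ∀ v ∈ Submodule.span ℝ {x, y}, v ≠ 0 → 0 < B v v

/-- The skew-symmetric curvature operator `R(π)` of the oriented plane `π` with oriented basis
`(x, y)`. -/
def skewCurvatureOperator (B : LinearMap.BilinForm ℝ V) (R : V → V → Module.End ℝ V) (x y : V) :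
    Module.End ℝ V :=
  (√|B x x * B y y - B x y ^ 2|)⁻¹ • R x y

/-- `R(π)` has rank `r` for every oriented spacelike plane `π`. -/
def HasSpacelikeRank (B : LinearMap.BilinForm ℝ V) (R : V → V → Module.End ℝ V) (r : ℕ) : Prop :=
  ∀ x y, IsSpacelikeBasis B x y →
    Module.finrank ℝ (LinearMap.range (skewCurvatureOperator B R x y)) = r

/-- `R(π)` and `R(π')` have the same real Jordan normal form, i.e. are conjugate, for all oriented
spacelike planes `π` and `π'`. -/
def IsSpacelikeJordanIP (B : LinearMap.BilinForm ℝ V) (R : V → V → Module.End ℝ V) : Prop :=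
  ∀ x y x' y', IsSpacelikeBasis B x y → IsSpacelikeBasis B x' y' →
    ∃ Θ : V ≃ₗ[ℝ] V,
      skewCurvatureOperator B R x y = Θ.conj (skewCurvatureOperator B R x' y')

/-- `R(π)` is nilpotent for every oriented spacelike plane `π`. -/
def IsSpacelikeNilpotent (B : LinearMap.BilinForm ℝ V) (R : V → V → Module.End ℝ V) : Prop :=
  ∀ x y, IsSpacelikeBasis B x y → IsNilpotent (skewCurvatureOperator B R x y)

/-- The curvature operator `R_φ(x, y) z = (φ y, z) φ x - (φ x, z) φ y`. -/
def curvatureOfEnd (B : LinearMap.BilinForm ℝ V) (φ : Module.End ℝ V) (x y : V) :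
    Module.End ℝ V :=
  (B (φ y)).smulRight (φ x) - (B (φ x)).smulRight (φ y)

end Algebra

/-! ### Pseudo-Riemannian metrics, the Levi-Civita connection and its curvature -/

/-- A smooth pseudo-Riemannian metric on a manifold `M` modelled on `E`. -/
structure PseudoRiemannianMetric (E : Type*) [NormedAddCommGroup E] [NormedSpace ℝ E]
    (M : Type*) [TopologicalSpace M] [ChartedSpace E M] [IsManifold 𝓘(ℝ, E) ∞ M] where
  val (x : M) : TangentSpace 𝓘(ℝ, E) x →L[ℝ] TangentSpace 𝓘(ℝ, E) x →L[ℝ] ℝ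
  symm (x : M) (v w : TangentSpace 𝓘(ℝ, E) x) : val x v w = val x w v
  nondegenerate (x : M) (v : TangentSpace 𝓘(ℝ, E) x) (hv : ∀ w, val x v w = 0) : v = 0
  contMDiff : ContMDiff 𝓘(ℝ, E) (𝓘(ℝ, E).prod 𝓘(ℝ, E →L[ℝ] E →L[ℝ] ℝ)) ∞
    (fun x ↦ TotalSpace.mk' (E →L[ℝ] E →L[ℝ] ℝ) x (val x))

namespace PseudoRiemannianMetric
variable {E : Type*} [NormedAddCommGroup E] [NormedSpace ℝ E] [FiniteDimensional ℝ E]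
  {M : Type*} [TopologicalSpace M] [ChartedSpace E M] [IsManifold 𝓘(ℝ, E) ∞ M]
  (g : PseudoRiemannianMetric E M)

/-- The function `g(X, Y)`. -/
def pairing (X Y : Π x : M, TangentSpace 𝓘(ℝ, E) x) (x : M) : ℝ := g.val x (X x) (Y x)

lemma contMDiffAt_pairing {n : ℕ∞} {X Y : Π x : M, TangentSpace 𝓘(ℝ, E) x} {x : M}
    (hX : CMDiffAt n (T% X) x) (hY : CMDiffAt n (T% Y) x) : CMDiffAt n (g.pairing X Y) x := by
  have : ContMDiffAt 𝓘(ℝ, E) (𝓘(ℝ, E).prod 𝓘(ℝ)) n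
      (fun m ↦ TotalSpace.mk' ℝ (E := Bundle.Trivial M ℝ) m (g.val m (X m) (Y m))) x := by
    apply ContMDiffAt.clm_bundle_apply₂ (F₁ := E) (F₂ := E)
    · exact (g.contMDiff.contMDiffAt).of_le (by exact_mod_cast le_top)
    · exact hX
    · exact hY
  simp only [contMDiffAt_totalSpace] at this
  exact this.2

lemma mdifferentiableAt_pairing {X Y : Π x : M, TangentSpace 𝓘(ℝ, E) x} {x : M}
    (hX : MDiffAt (T% X) x) (hY : MDiffAt (T% Y) x) : MDiffAt (g.pairing X Y) x := by
  have : MDifferentiableAt 𝓘(ℝ, E) (𝓘(ℝ, E).prod 𝓘(ℝ))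
      (fun m ↦ TotalSpace.mk' ℝ (E := Bundle.Trivial M ℝ) m (g.val m (X m) (Y m))) x := by
    apply MDifferentiableAt.clm_bundle_apply₂ (F₁ := E) (F₂ := E)
    · exact (g.contMDiff.contMDiffAt).mdifferentiableAt (by simp)
    · exact hX
    · exact hY
  simp only [mdifferentiableAt_totalSpace] at this
  exact this.2

/-- The Koszul expression
`X g(Y,Z) + Y g(Z,X) - Z g(X,Y) + g([X,Y],Z) - g([Y,Z],X) + g([Z,X],Y)`. -/
def koszul (X Y Z : Π x : M, TangentSpace 𝓘(ℝ, E) x) (x : M) : ℝ :=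
  mvfderiv 𝓘(ℝ, E) (g.pairing Y Z) x (X x) + mvfderiv 𝓘(ℝ, E) (g.pairing Z X) x (Y x)
    - mvfderiv 𝓘(ℝ, E) (g.pairing X Y) x (Z x)
    + g.val x (mlieBracket 𝓘(ℝ, E) X Y x) (Z x)
    - g.val x (mlieBracket 𝓘(ℝ, E) Y Z x) (X x)
    + g.val x (mlieBracket 𝓘(ℝ, E) Z X x) (Y x)

lemma pairing_comm (X Y : Π x : M, TangentSpace 𝓘(ℝ, E) x) : g.pairing X Y = g.pairing Y X := by
  ext x; exact g.symm _ _ _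

lemma pairing_add_left (X X' Y : Π x : M, TangentSpace 𝓘(ℝ, E) x) :
    g.pairing (X + X') Y = g.pairing X Y + g.pairing X' Y := by
  ext x; simp [pairing]
lemma pairing_add_right (X X' Y : Π x : M, TangentSpace 𝓘(ℝ, E) x) :
    g.pairing Y (X + X') = g.pairing Y X + g.pairing Y X' := by
  ext x; simp [pairing]
lemma pairing_smul_left (f : M → ℝ) (X Y : Π x : M, TangentSpace 𝓘(ℝ, E) x) :
    g.pairing (f • X) Y = f * g.pairing X Y := by
  ext x; simp [pairing]
lemma pairing_smul_right (f : M → ℝ) (X Y : Π x : M, TangentSpace 𝓘(ℝ, E) x) :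
    g.pairing Y (f • X) = f * g.pairing Y X := by
  ext x; simp [pairing]

lemma koszul_tensorial_left (Y Z : Π x : M, TangentSpace 𝓘(ℝ, E) x) (x : M)
    (hY : MDiffAt (T% Y) x) (hZ : MDiffAt (T% Z) x) :
    TensorialAt 𝓘(ℝ, E) E (fun X ↦ g.koszul X Y Z x) x where
  smul {f X} hf hX := by
    have h1 := g.mdifferentiableAt_pairing hZ hX
    have h2 := g.mdifferentiableAt_pairing hX hY
    simp only [koszul, pairing_smul_left, pairing_smul_right, mvfderiv_mul hf h1,
      mvfderiv_mul hf h2, mlieBracket_smul_left hf hX, mlieBracket_smul_right hf hX]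
    simp [pairing, g.symm x (X x) (Y x), g.symm x (X x) (Z x)]
    ring
  add {X X'} hX hX' := by
    have h1 := g.mdifferentiableAt_pairing hZ hX
    have h2 := g.mdifferentiableAt_pairing hX hY
    have h1' := g.mdifferentiableAt_pairing hZ hX'
    have h2' := g.mdifferentiableAt_pairing hX' hY
    simp only [koszul, pairing_add_left, pairing_add_right, mvfderiv_add h1 h1',
      mvfderiv_add h2 h2', mlieBracket_add_left hX hX', mlieBracket_add_right hX hX']
    simp
    ring

lemma koszul_tensorial_right (X Y : Π x : M, TangentSpace 𝓘(ℝ, E) x) (x : M)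
    (hX : MDiffAt (T% X) x) (hY : MDiffAt (T% Y) x) :
    TensorialAt 𝓘(ℝ, E) E (fun Z ↦ g.koszul X Y Z x) x where
  smul {f Z} hf hZ := by
    have h1 := g.mdifferentiableAt_pairing hZ hX
    have h2 := g.mdifferentiableAt_pairing hY hZ
    simp only [koszul, pairing_smul_left, pairing_smul_right, mvfderiv_mul hf h1,
      mvfderiv_mul hf h2, mlieBracket_smul_left hf hZ, mlieBracket_smul_right hf hZ]
    simp [pairing, g.symm x (Z x) (Y x), g.symm x (Z x) (X x)]
    ring
  add {Z Z'} hZ hZ' := by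
    have h1 := g.mdifferentiableAt_pairing hZ hX
    have h2 := g.mdifferentiableAt_pairing hY hZ
    have h1' := g.mdifferentiableAt_pairing hZ' hX
    have h2' := g.mdifferentiableAt_pairing hY hZ'
    simp only [koszul, pairing_add_left, pairing_add_right, mvfderiv_add h1 h1',
      mvfderiv_add h2 h2', mlieBracket_add_left hZ hZ', mlieBracket_add_right hZ hZ']
    simp
    ring

/-- The metric at `x` as a bilinear form on the tangent space. -/
def form (x : M) : LinearMap.BilinForm ℝ (TangentSpace 𝓘(ℝ, E) x) := (g.val x).toBilinForm

@[simp] lemma form_apply (x : M) (v w : TangentSpace 𝓘(ℝ, E) x) : g.form x v w = g.val x v w := rfl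

lemma form_nondegenerate (x : M) : (g.form x).Nondegenerate :=
  ⟨fun v hv ↦ g.nondegenerate x v hv,
   fun v hv ↦ g.nondegenerate x v fun w ↦ (g.symm x v w).trans (hv w)⟩

instance (x : M) : FiniteDimensional ℝ (TangentSpace 𝓘(ℝ, E) x) :=
  inferInstanceAs (FiniteDimensional ℝ E)

instance (x : M) : T2Space (TangentSpace 𝓘(ℝ, E) x) := inferInstanceAs (T2Space E)

/-- The isomorphism from the cotangent space to the tangent space given by the metric. -/
def sharp (x : M) : Dual ℝ (TangentSpace 𝓘(ℝ, E) x) ≃ₗ[ℝ] TangentSpace 𝓘(ℝ, E) x :=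
  ((g.form x).toDual (g.form_nondegenerate x)).symm

lemma val_sharp (x : M) (η : Dual ℝ (TangentSpace 𝓘(ℝ, E) x)) (w : TangentSpace 𝓘(ℝ, E) x) :
    g.val x (g.sharp x η) w = η w :=
  LinearMap.BilinForm.apply_toDual_symm_apply (B := g.form x) (hB := g.form_nondegenerate x) η w

lemma ext_val {x : M} {v v' : TangentSpace 𝓘(ℝ, E) x} (h : ∀ w, g.val x v w = g.val x v' w) :
    v = v' := by
  rw [← sub_eq_zero]
  exact g.nondegenerate x _ fun w ↦ by simp [h w]

open Classical in
/-- For a vector field `Y`, the endomorphism `v ↦ ∇_v Y` of the tangent space at `x`, determined by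
the Koszul formula `2 g(∇_X Y, Z) = koszul X Y Z`. It is `0` if `Y` is not differentiable at `x`. -/
def leviCivitaFun (Y : Π x : M, TangentSpace 𝓘(ℝ, E) x) (x : M) :
    TangentSpace 𝓘(ℝ, E) x →L[ℝ] TangentSpace 𝓘(ℝ, E) x :=
  if hY : MDiffAt (T% Y) x then
    LinearMap.toContinuousLinearMap
      ((1 / 2 : ℝ) • (g.sharp x).toLinearMap ∘ₗ ContinuousLinearMap.coeLM ℝ ∘ₗ
        (TensorialAt.mkHom₂ (fun X Z ↦ g.koszul X Y Z x) x
          (fun Z hZ ↦ g.koszul_tensorial_left Y Z x hY hZ)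
          (fun X hX ↦ g.koszul_tensorial_right X Y x hX hY)).toLinearMap)
  else 0

lemma val_leviCivitaFun {X Y Z : Π x : M, TangentSpace 𝓘(ℝ, E) x} {x : M}
    (hX : MDiffAt (T% X) x) (hY : MDiffAt (T% Y) x) (hZ : MDiffAt (T% Z) x) :
    g.val x (g.leviCivitaFun Y x (X x)) (Z x) = 1 / 2 * g.koszul X Y Z x := by
  have := TensorialAt.mkHom₂_apply (Φ := fun X Z ↦ g.koszul X Y Z x)
          (fun Z hZ ↦ g.koszul_tensorial_left Y Z x hY hZ)
          (fun X hX ↦ g.koszul_tensorial_right X Y x hX hY) hX hZ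
  simp only [leviCivitaFun, hY, dite_true]
  simp [val_sharp, this]

lemma koszul_add_middle {X Y Y' Z : Π x : M, TangentSpace 𝓘(ℝ, E) x} {x : M}
    (hX : MDiffAt (T% X) x) (hY : MDiffAt (T% Y) x) (hY' : MDiffAt (T% Y') x)
    (hZ : MDiffAt (T% Z) x) :
    g.koszul X (Y + Y') Z x = g.koszul X Y Z x + g.koszul X Y' Z x := by
  have h1 := g.mdifferentiableAt_pairing hX hY
  have h2 := g.mdifferentiableAt_pairing hY hZ
  have h1' := g.mdifferentiableAt_pairing hX hY'
  have h2' := g.mdifferentiableAt_pairing hY' hZ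
  simp only [koszul, pairing_add_left, pairing_add_right, mvfderiv_add h1 h1',
    mvfderiv_add h2 h2', mlieBracket_add_left hY hY', mlieBracket_add_right hY hY']
  simp
  ring

lemma koszul_smul_middle {X Y Z : Π x : M, TangentSpace 𝓘(ℝ, E) x} {f : M → ℝ} {x : M}
    (hX : MDiffAt (T% X) x) (hY : MDiffAt (T% Y) x) (hf : MDiffAt f x)
    (hZ : MDiffAt (T% Z) x) :
    g.koszul X (f • Y) Z x =
      f x * g.koszul X Y Z x + 2 * mvfderiv 𝓘(ℝ, E) f x (X x) * g.val x (Y x) (Z x) := by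
  have h1 := g.mdifferentiableAt_pairing hX hY
  have h2 := g.mdifferentiableAt_pairing hY hZ
  simp only [koszul, pairing_smul_left, pairing_smul_right, mvfderiv_mul hf h1,
    mvfderiv_mul hf h2, mlieBracket_smul_left hf hY, mlieBracket_smul_right hf hY]
  simp [pairing, g.symm x (X x) (Y x)]
  ring

/-- The Levi-Civita connection of `g`: `g.leviCivita Y x v` is `∇_v Y` at `x`. -/
def leviCivita : CovariantDerivative 𝓘(ℝ, E) E (TangentSpace 𝓘(ℝ, E) : M → Type _) where
  toFun := g.leviCivitaFun
  isCovariantDerivativeOnUniv :=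
    { add := by
        intro Y Y' x hY hY' _
        ext v
        refine g.ext_val fun w ↦ ?_
        have hv := mdifferentiableAt_extend 𝓘(ℝ, E) E v
        have hw := mdifferentiableAt_extend 𝓘(ℝ, E) E w
        have hs := mdifferentiableAt_add_section hY hY'
        have h1 := g.val_leviCivitaFun hv hs hw
        have h2 := g.val_leviCivitaFun hv hY hw
        have h3 := g.val_leviCivitaFun hv hY' hw
        simp only [extend_apply_self] at h1 h2 h3
        rw [add_apply, map_add, add_apply, h1, h2, h3,
          g.koszul_add_middle hv hY hY' hw]
        ring
      leibniz := by
        intro Y f x hY hf _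
        ext v
        refine g.ext_val fun w ↦ ?_
        have hv := mdifferentiableAt_extend 𝓘(ℝ, E) E v
        have hw := mdifferentiableAt_extend 𝓘(ℝ, E) E w
        have hs := hf.smul_section hY
        have h1 := g.val_leviCivitaFun hv hs hw
        have h2 := g.val_leviCivitaFun hv hY hw
        have h3 := g.koszul_smul_middle hv hY hf hw
        simp only [extend_apply_self] at h1 h2 h3
        rw [h1, h3]
        simp [h2]
        ring }

lemma contMDiffAt_mvfderiv_apply {f : M → ℝ} {X : Π x : M, TangentSpace 𝓘(ℝ, E) x} {x : M}
    (hf : CMDiffAt ∞ f x) (hX : CMDiffAt ∞ (T% X) x) :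
    CMDiffAt ∞ (fun y ↦ mvfderiv 𝓘(ℝ, E) f y (X y)) x := by
  have h := hf.mfderiv_const (m := ∞) (n := ∞) (by simp)
  have h2 := ContMDiffAt.clm_apply_of_inCoordinates (b₂ := f) h hX hf
  rw [contMDiffAt_totalSpace] at h2
  refine h2.2.congr_of_eventuallyEq (Filter.Eventually.of_forall fun y ↦ ?_)
  simp [mvfderiv]
  rfl

lemma contMDiffAt_koszul {X Y Z : Π x : M, TangentSpace 𝓘(ℝ, E) x} {x : M}
    (hX : CMDiffAt ∞ (T% X) x) (hY : CMDiffAt ∞ (T% Y) x) (hZ : CMDiffAt ∞ (T% Z) x) :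
    CMDiffAt ∞ (g.koszul X Y Z) x := by
  have hb {A B : Π x : M, TangentSpace 𝓘(ℝ, E) x}
      (hA : CMDiffAt ∞ (T% A) x) (hB : CMDiffAt ∞ (T% B) x) :
      CMDiffAt ∞ (T% (mlieBracket 𝓘(ℝ, E) A B)) x :=
    haveI : IsManifold 𝓘(ℝ, E) (minSmoothness ℝ 2) M := by
      rw [minSmoothness_of_isRCLikeNormedField]; infer_instance
    haveI : IsManifold 𝓘(ℝ, E) (((⊤ : ℕ∞) : WithTop ℕ∞) + 1) M := by
      simpa using (inferInstance : IsManifold 𝓘(ℝ, E) ∞ M)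
    ContMDiffAt.mlieBracket_vectorField (m := ⊤) (n := ⊤) hA hB (by
      rw [minSmoothness_of_isRCLikeNormedField]; simp)
  have hp {A B : Π x : M, TangentSpace 𝓘(ℝ, E) x}
      (hA : CMDiffAt ∞ (T% A) x) (hB : CMDiffAt ∞ (T% B) x) :
      CMDiffAt ∞ (g.pairing A B) x := g.contMDiffAt_pairing (n := ⊤) hA hB
  exact (((((contMDiffAt_mvfderiv_apply (hp hY hZ) hX).add
    (contMDiffAt_mvfderiv_apply (hp hZ hX) hY)).sub
    (contMDiffAt_mvfderiv_apply (hp hX hY) hZ)).add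
    (hp (hb hX hY) hZ)).sub (hp (hb hY hZ) hX)).add (hp (hb hZ hX) hY)

lemma contMDiffAt_det {ι : Type*} [Fintype ι] [DecidableEq ι] {A : M → Matrix ι ι ℝ} {x : M}
    (hA : ∀ i j, CMDiffAt ∞ (fun y ↦ A y i j) x) : CMDiffAt ∞ (fun y ↦ (A y).det) x := by
  simp only [Matrix.det_apply, Units.smul_def, zsmul_eq_mul]
  refine contMDiffAt_finsetSum fun σ _ ↦ contMDiffAt_const.mul ?_
  exact contMDiffAt_finsetProd fun i _ ↦ hA _ _

/-- A vector field is smooth if its pairings with all smooth fields are. -/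
lemma contMDiffAt_of_pairing {S : Π x : M, TangentSpace 𝓘(ℝ, E) x} {x : M}
    (h : ∀ Z : Π x : M, TangentSpace 𝓘(ℝ, E) x, CMDiffAt ∞ (T% Z) x →
      CMDiffAt ∞ (g.pairing S Z) x) : CMDiffAt ∞ (T% S) x := by
  classical
  set e := trivializationAt E (TangentSpace 𝓘(ℝ, E) : M → Type _) x
  have hx : x ∈ e.baseSet := FiberBundle.mem_baseSet_trivializationAt' x
  set b := Module.finBasis ℝ E
  have hs (i) : CMDiffAt ∞ (T% (e.localFrame b i)) x := contMDiffAt_localFrame_of_mem ∞ e b i hx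
  rw [contMDiffAt_iff_localFrameCoeff (I := 𝓘(ℝ, E)) (k := ∞) b hx]
  set c : Fin (finrank ℝ E) → M → ℝ :=
    fun i y ↦ e.localFrameCoeff 𝓘(ℝ, E) b i y (S y)
  set G : M → Matrix (Fin (finrank ℝ E)) (Fin (finrank ℝ E)) ℝ :=
    fun y ↦ Matrix.of fun i j ↦ g.pairing (e.localFrame b i) (e.localFrame b j) y
  have hG (i j) : CMDiffAt ∞ (fun y ↦ G y i j) x := g.contMDiffAt_pairing (n := ⊤) (hs i) (hs j)
  set η : M → Fin (finrank ℝ E) → ℝ := fun y i ↦ g.pairing S (e.localFrame b i) y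
  have hη (i) : CMDiffAt ∞ (fun y ↦ η y i) x := h _ (hs i)
  have hmul : ∀ y ∈ e.baseSet, (G y).mulVec (fun i ↦ c i y) = η y := by
    intro y hy
    ext i
    have := e.eq_sum_localFrameCoeff_smul (I := 𝓘(ℝ, E)) (b := b) (s := S) hy
    simp only [η, pairing]
    rw [this]
    simp [Matrix.mulVec, dotProduct, G, pairing, c, mul_comm,
      g.symm y (e.localFrame b i y)]
  have hdet : ∀ y ∈ e.baseSet, (G y).det ≠ 0 := by
    intro y hy h0
    obtain ⟨v, hv0, hv⟩ := Matrix.exists_mulVec_eq_zero_iff.2 h0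
    have hfr : ∀ i, e.localFrame b i y = e.basisAt b hy i := by
      intro i; rw [Trivialization.localFrame_apply_of_mem_baseSet _ _ hy]
    have hz : ∑ i, v i • e.basisAt b hy i = 0 := by
      refine g.nondegenerate y _ fun w ↦ ?_
      rw [← (e.basisAt b hy).sum_repr w]
      simp only [map_sum, map_smul]
      refine Finset.sum_eq_zero fun j _ ↦ ?_
      have := congrFun hv j
      simp only [Matrix.mulVec, dotProduct, G, pairing, Matrix.of_apply, hfr, Pi.zero_apply] at this
      simp only [sum_apply, smul_apply, smul_eq_mul]
      rw [← mul_zero ((e.basisAt b hy).repr w j), ← this]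
      congr 1
      exact Finset.sum_congr rfl fun i _ ↦ by rw [mul_comm, g.symm]
    refine hv0 (funext fun i ↦ ?_)
    exact Fintype.linearIndependent_iff.1 (e.basisAt b hy).linearIndependent v hz i
  intro i
  have key : CMDiffAt ∞ (fun y ↦ (G y).det⁻¹ * ((G y).updateCol i (η y)).det) x := by
    refine ContMDiffAt.mul (ContMDiffAt.inv₀ (contMDiffAt_det hG) (hdet x hx)) (contMDiffAt_det ?_)
    intro k l
    by_cases hl : l = i
    · subst hl; simpa using hη k
    · simpa [Matrix.updateCol_ne hl] using hG k l
  refine key.congr_of_eventuallyEq ?_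
  filter_upwards [e.open_baseSet.mem_nhds hx] with y hy
  have := hmul y hy
  rw [← this, ← Matrix.cramer_apply, Matrix.cramer_eq_adjugate_mulVec, Matrix.mulVec_mulVec,
    Matrix.adjugate_mul, Matrix.smul_mulVec, Matrix.one_mulVec, Pi.smul_apply, smul_eq_mul,
    inv_mul_cancel_left₀ (hdet y hy)]
  rfl

lemma contMDiffAt_leviCivita {X Y : Π x : M, TangentSpace 𝓘(ℝ, E) x} {x : M}
    {U : Set M} (hU : IsOpen U) (hx : x ∈ U)
    (hX : CMDiff[U] ∞ (T% X)) (hY : CMDiff[U] ∞ (T% Y)) :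
    CMDiffAt ∞ (T% (fun y ↦ g.leviCivita Y y (X y))) x := by
  refine g.contMDiffAt_of_pairing fun Z hZ ↦ ?_
  have hX' := hX.contMDiffAt (hU.mem_nhds hx)
  have hY' := hY.contMDiffAt (hU.mem_nhds hx)
  refine (contMDiffAt_const (c := (1 / 2 : ℝ)).mul
    (g.contMDiffAt_koszul hX' hY' hZ)).congr_of_eventuallyEq ?_
  have hZ1 := contMDiffAt_iff_contMDiffAt_nhds (n := 1) (by simp) |>.1 (hZ.of_le (by simp))
  filter_upwards [hU.mem_nhds hx, hZ1] with y hy hyZ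
  exact g.val_leviCivitaFun ((hX.contMDiffAt (hU.mem_nhds hy)).mdifferentiableAt (by simp))
    ((hY.contMDiffAt (hU.mem_nhds hy)).mdifferentiableAt (by simp))
    (hyZ.mdifferentiableAt (by simp))

/-- The Levi-Civita connection is torsion-free: `∇_X Y - ∇_Y X = [X, Y]`. -/
lemma leviCivita_torsion_free {X Y : Π x : M, TangentSpace 𝓘(ℝ, E) x} {x : M}
    (hX : MDiffAt (T% X) x) (hY : MDiffAt (T% Y) x) :
    g.leviCivita Y x (X x) - g.leviCivita X x (Y x) = mlieBracket 𝓘(ℝ, E) X Y x := by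
  refine g.ext_val fun w ↦ ?_
  have hw := mdifferentiableAt_extend 𝓘(ℝ, E) E w
  have h1 := g.val_leviCivitaFun hX hY hw
  have h2 := g.val_leviCivitaFun hY hX hw
  simp only [extend_apply_self] at h1 h2
  rw [map_sub, sub_apply]
  change g.val x (g.leviCivitaFun Y x (X x)) w - g.val x (g.leviCivitaFun X x (Y x)) w = _
  rw [h1, h2, koszul, koszul, g.pairing_comm Y X, g.pairing_comm (extend E w) X,
    g.pairing_comm (extend E w) Y, mlieBracket_swap_apply (V := Y) (W := X),
    mlieBracket_swap_apply (V := X) (W := extend E w),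
    mlieBracket_swap_apply (V := Y) (W := extend E w)]
  simp
  ring

/-- The Levi-Civita connection is metric: `X g(Y, Z) = g(∇_X Y, Z) + g(Y, ∇_X Z)`. -/
lemma leviCivita_metric {X Y Z : Π x : M, TangentSpace 𝓘(ℝ, E) x} {x : M}
    (hX : MDiffAt (T% X) x) (hY : MDiffAt (T% Y) x) (hZ : MDiffAt (T% Z) x) :
    mvfderiv 𝓘(ℝ, E) (g.pairing Y Z) x (X x) =
      g.val x (g.leviCivita Y x (X x)) (Z x) + g.val x (Y x) (g.leviCivita Z x (X x)) := by
  rw [g.symm x (Y x)]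
  change _ = g.val x (g.leviCivitaFun Y x (X x)) (Z x) + g.val x (g.leviCivitaFun Z x (X x)) (Y x)
  rw [g.val_leviCivitaFun hX hY hZ, g.val_leviCivitaFun hX hZ hY, koszul, koszul,
    g.pairing_comm Z Y, g.pairing_comm Z X, g.pairing_comm Y X,
    mlieBracket_swap_apply (V := Y) (W := X),
    mlieBracket_swap_apply (V := Z) (W := X), mlieBracket_swap_apply (V := Z) (W := Y)]
  simp
  ring

/-- The vector field `∇_X ∇_Y Z - ∇_Y ∇_X Z - ∇_[X, Y] Z`. -/
def curvatureField (X Y Z : Π x : M, TangentSpace 𝓘(ℝ, E) x) (x : M) : TangentSpace 𝓘(ℝ, E) x :=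
  g.leviCivita (fun y ↦ g.leviCivita Z y (Y y)) x (X x)
    - g.leviCivita (fun y ↦ g.leviCivita Z y (X y)) x (Y x)
    - g.leviCivita Z x (mlieBracket 𝓘(ℝ, E) X Y x)

/-- The vector field extending the tangent vector `v` at `x` which has constant components in the
preferred chart at `x`. -/
def coordField (x : M) (v : TangentSpace 𝓘(ℝ, E) x) (y : M) : TangentSpace 𝓘(ℝ, E) y :=
  letI t := trivializationAt E (TangentSpace 𝓘(ℝ, E) : M → Type _) x
  t.symmL ℝ y (t.continuousLinearMapAt ℝ x v)

lemma coordField_self (x : M) (v : TangentSpace 𝓘(ℝ, E) x) : coordField x v x = v :=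
  Trivialization.symmL_continuousLinearMapAt _ (FiberBundle.mem_baseSet_trivializationAt' x) v

lemma coordField_add (x : M) (v w : TangentSpace 𝓘(ℝ, E) x) :
    coordField x (v + w) = coordField x v + coordField x w := by
  funext y; simp [coordField]

lemma coordField_smul (x : M) (c : ℝ) (v : TangentSpace 𝓘(ℝ, E) x) :
    coordField x (c • v) = c • coordField x v := by
  funext y; simp [coordField]

lemma contMDiffOn_coordField (x : M) (v : TangentSpace 𝓘(ℝ, E) x) :
    CMDiff[(chartAt E x).source] ∞ (T% (coordField x v)) := by
  set t := trivializationAt E (TangentSpace 𝓘(ℝ, E) : M → Type _) x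
  have ht : t.baseSet = (chartAt E x).source := rfl
  intro y hy
  rw [t.contMDiffWithinAt_section _ (ht ▸ hy)]
  have : CMDiff[(chartAt E x).source] ∞ (fun _ : M ↦ t.continuousLinearMapAt ℝ x v) :=
    contMDiffOn_const
  refine this.congr (fun z hz ↦ ?_) y hy
  have hz' : z ∈ t.baseSet := ht ▸ hz
  have := t.continuousLinearMapAt_symmL (R := ℝ) hz' (t.continuousLinearMapAt ℝ x v)
  rwa [t.continuousLinearMapAt_apply_of_mem (R := ℝ) hz'] at this

section
variable {x : M} {U : Set M} {X Y Z Z' : Π x : M, TangentSpace 𝓘(ℝ, E) x}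

lemma curvatureField_add (hU : IsOpen U) (hx : x ∈ U) (hX : CMDiff[U] ∞ (T% X))
    (hY : CMDiff[U] ∞ (T% Y)) (hZ : CMDiff[U] ∞ (T% Z)) (hZ' : CMDiff[U] ∞ (T% Z')) :
    g.curvatureField X Y (Z + Z') x = g.curvatureField X Y Z x + g.curvatureField X Y Z' x := by
  have hm {A : Π x : M, TangentSpace 𝓘(ℝ, E) x} (hA : CMDiff[U] ∞ (T% A)) {y : M} (hy : y ∈ U) :
      MDiffAt (T% A) y := (hA.contMDiffAt (hU.mem_nhds hy)).mdifferentiableAt (by simp)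
  have hd {A B : Π x : M, TangentSpace 𝓘(ℝ, E) x} (hA : CMDiff[U] ∞ (T% A))
      (hB : CMDiff[U] ∞ (T% B)) : MDiffAt (T% (fun y ↦ g.leviCivita B y (A y))) x :=
    (g.contMDiffAt_leviCivita hU hx hA hB).mdifferentiableAt (by simp)
  have hs : CMDiff[U] ∞ (T% (Z + Z')) := hZ.add_section hZ'
  have hcov := g.leviCivita.isCovariantDerivativeOnUniv
  have hin {A : Π x : M, TangentSpace 𝓘(ℝ, E) x} (hA : CMDiff[U] ∞ (T% A)) :
      g.leviCivita (fun y ↦ g.leviCivita (Z + Z') y (A y)) x =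
        g.leviCivita (fun y ↦ g.leviCivita Z y (A y)) x +
          g.leviCivita (fun y ↦ g.leviCivita Z' y (A y)) x := by
    rw [← hcov.add (hd hA hZ) (hd hA hZ')]
    refine hcov.congr_of_eventuallyEq (hd hA hs)
      (mdifferentiableAt_add_section (hd hA hZ) (hd hA hZ')) Filter.univ_mem ?_
    filter_upwards [hU.mem_nhds hx] with y hy
    simp [hcov.add (hm hZ hy) (hm hZ' hy)]
  simp only [curvatureField, hin hX, hin hY, hcov.add (hm hZ hx) (hm hZ' hx), add_apply]
  abel

lemma curvatureField_smul (hU : IsOpen U) (hx : x ∈ U) (hX : CMDiff[U] ∞ (T% X))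
    (hY : CMDiff[U] ∞ (T% Y)) (hZ : CMDiff[U] ∞ (T% Z)) (c : ℝ) :
    g.curvatureField X Y (c • Z) x = c • g.curvatureField X Y Z x := by
  have hm {A : Π x : M, TangentSpace 𝓘(ℝ, E) x} (hA : CMDiff[U] ∞ (T% A)) {y : M} (hy : y ∈ U) :
      MDiffAt (T% A) y := (hA.contMDiffAt (hU.mem_nhds hy)).mdifferentiableAt (by simp)
  have hd {A B : Π x : M, TangentSpace 𝓘(ℝ, E) x} (hA : CMDiff[U] ∞ (T% A))
      (hB : CMDiff[U] ∞ (T% B)) : MDiffAt (T% (fun y ↦ g.leviCivita B y (A y))) x :=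
    (g.contMDiffAt_leviCivita hU hx hA hB).mdifferentiableAt (by simp)
  have hs : CMDiff[U] ∞ (T% (c • Z)) := hZ.const_smul_section
  have hcov := g.leviCivita.isCovariantDerivativeOnUniv
  have hin {A : Π x : M, TangentSpace 𝓘(ℝ, E) x} (hA : CMDiff[U] ∞ (T% A)) :
      g.leviCivita (fun y ↦ g.leviCivita (c • Z) y (A y)) x =
        c • g.leviCivita (fun y ↦ g.leviCivita Z y (A y)) x := by
    rw [← hcov.smul_const c (hd hA hZ)]
    refine hcov.congr_of_eventuallyEq (hd hA hs)
      (hd hA hZ).smul_const_section Filter.univ_mem ?_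
    filter_upwards [hU.mem_nhds hx] with y hy
    simp [hcov.smul_const c (hm hZ hy)]
  simp only [curvatureField, hin hX, hin hY, hcov.smul_const c (hm hZ hx), smul_apply, smul_sub]

/-- The Riemann curvature operator `R(v, w) = ∇_v ∇_w - ∇_w ∇_v - ∇_[v, w]` on the tangent space at
`x`. As `R` is a tensor, `R(v, w) z` may be computed with any smooth extensions of `v`, `w`, `z`;
here the extensions with constant components in the chart at `x` are used. -/
def curvature (x : M) (v w : TangentSpace 𝓘(ℝ, E) x) : Module.End ℝ (TangentSpace 𝓘(ℝ, E) x) where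
  toFun z := g.curvatureField (coordField x v) (coordField x w) (coordField x z) x
  map_add' z z' := by
    rw [coordField_add]
    exact g.curvatureField_add (chartAt E x).open_source (mem_chart_source E x)
      (contMDiffOn_coordField x v) (contMDiffOn_coordField x w) (contMDiffOn_coordField x z) (contMDiffOn_coordField x z')
  map_smul' c z := by
    rw [coordField_smul]
    exact g.curvatureField_smul (chartAt E x).open_source (mem_chart_source E x)
      (contMDiffOn_coordField x v) (contMDiffOn_coordField x w) (contMDiffOn_coordField x z) c
end

/-- `g` has signature `(p, q)`: at each point, `p` and `q` are the maximal dimensions of timelike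
(negative definite) and spacelike (positive definite) subspaces. -/
def HasSignature (p q : ℕ) : Prop :=
  ∀ x, sigNeg (g.form x).toQuadraticMap = p ∧ sigPos (g.form x).toQuadraticMap = q

/-- At each point, the curvature tensor of `g` is spacelike rank 2 Jordan IP and nilpotent. -/
def IsSpacelikeRankTwoNilpotentJordanIP : Prop :=
  ∀ x, HasSpacelikeRank (g.form x) (g.curvature x) 2 ∧
    IsSpacelikeJordanIP (g.form x) (g.curvature x) ∧
    IsSpacelikeNilpotent (g.form x) (g.curvature x)

/-- `φ` is self-adjoint on the tangent space at `x`, `ker φ = range φ`, and `R = ε R_φ` at `x`. -/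
def IsNilpotentCurvatureRoot (ε : ℝ) (x : M)
    (φ : TangentSpace 𝓘(ℝ, E) x →L[ℝ] TangentSpace 𝓘(ℝ, E) x) : Prop :=
  (∀ v w, g.val x (φ v) w = g.val x v (φ w)) ∧
    LinearMap.ker φ.toLinearMap = LinearMap.range φ.toLinearMap ∧
    ∀ v w, g.curvature x v w = ε • curvatureOfEnd (g.form x) φ.toLinearMap v w

end PseudoRiemannianMetric

/-! ### Distributions -/

section Distribution

variable {E : Type*} [NormedAddCommGroup E] [NormedSpace ℝ E]
  {M : Type*} [TopologicalSpace M] [ChartedSpace E M] [IsManifold 𝓘(ℝ, E) ∞ M]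

/-- A smooth distribution of rank `k`: near each point, `K` has a smooth frame. -/
def IsSmoothDistribution (k : ℕ) (K : Π x : M, Submodule ℝ (TangentSpace 𝓘(ℝ, E) x)) : Prop :=
  ∀ x₀ : M, ∃ U : Set M, IsOpen U ∧ x₀ ∈ U ∧
    ∃ X : Fin k → Π x : M, TangentSpace 𝓘(ℝ, E) x,
      (∀ i, ContMDiffOn 𝓘(ℝ, E) 𝓘(ℝ, E).tangent ∞ (fun x ↦ TotalSpace.mk' E x (X i x)) U) ∧
      ∀ x ∈ U, LinearIndependent ℝ (fun i ↦ X i x) ∧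
        Submodule.span ℝ (Set.range fun i ↦ X i x) = K x

/-- An integrable distribution of rank `k`: it is smooth, and through each point `x₀` passes an
integral manifold, i.e. an immersion `f` of an open neighbourhood `W` of `0 ∈ ℝᵏ` with `f 0 = x₀`
which is tangent to `K` in the sense that the range of `df` at `u` is `K (f u)`. -/
def IsIntegrableDistribution (k : ℕ) (K : Π x : M, Submodule ℝ (TangentSpace 𝓘(ℝ, E) x)) : Prop :=
  IsSmoothDistribution k K ∧
    ∀ x₀ : M, ∃ (W : Set (EuclideanSpace ℝ (Fin k))) (f : EuclideanSpace ℝ (Fin k) → M),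
      IsOpen W ∧ 0 ∈ W ∧ f 0 = x₀ ∧
      ContMDiffOn 𝓘(ℝ, EuclideanSpace ℝ (Fin k)) 𝓘(ℝ, E) ∞ f W ∧
      ∀ u ∈ W, Function.Injective (mfderiv 𝓘(ℝ, EuclideanSpace ℝ (Fin k)) 𝓘(ℝ, E) f u) ∧
        LinearMap.range (mfderiv 𝓘(ℝ, EuclideanSpace ℝ (Fin k)) 𝓘(ℝ, E) f u).toLinearMap = K (f u)

end Distribution

end

/-! ### Integration of commuting frames -/

section TotalDifferentialEquation

open Metric
open scoped NNReal

variable {E G : Type*} [NormedAddCommGroup E] [NormedSpace ℝ E] [NormedAddCommGroup G]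
  [NormedSpace ℝ G]

/-! At one point, rank 2 says that the `2`-forms `g(R(x,y)·,·)` of spacelike planes are
decomposable. The Plücker relations are polynomial, so they extend to all planes. For a fixed
spacelike `e` the forms `g(R(e,y)·,·)` are then a linear family of decomposable forms, injective on
a space of dimension at least `p - 1 ≥ 4`. Hence they share a linear factor
(`exists_common_factor`). Together with the first Bianchi identity this forces `g(R(x,y)z,w) = c
(h(x,z) h(y,w) - h(x,w) h(y,z))` for a symmetric form `h` (`IsAlgebraicCurvature.exists_bilinForm`),
and rescaling the endomorphism dual to `h` gives `R = ±R_φ`. Nilpotency makes the Gram determinants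
of `φ x, φ y` vanish, so `g(φ·,φ·)` has rank at most one on a maximal spacelike space and some
spacelike plane has `R(π)² = 0`. The Jordan condition carries this to every spacelike plane, hence
`φ² = 0`. As `φ` is injective on a spacelike space of half the dimension, `ker φ = range φ`
(`exists_nilpotent_curvature_root`).

On the manifold, curvature values on pairs out of three vector fields form `-ε` times the adjugate
of the `3 × 3` matrix `H` of `g(φ·,·)`. Its determinant shows that `ε` is locally constant
(`eventually_sign_eq`). Once the sign of `φ` is fixed by `det H ≥ 0`, the matrix `H`, and from it
`φ`, is recovered smoothly from the curvature (`exists_smooth_root`). The range of any root is the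
nullity space `{v | R(v,·) = 0}`, so it does not depend on the root. Nullity fields are closed under
brackets: `∇_ξ` and `∇_η` commute with every `∇_X` up to `∇` of a bracket, so by the Jacobi identity
`∇_[ξ,η]` does too (`curvature_mlieBracket_eq_zero`). Integrability is then the Frobenius theorem,
proved by normalizing a frame so that its fields commute and integrating it by time-one maps. -/

/-- Mean value inequality with reference derivative at `y`: on the segment the derivative deviates
by at most `K * ‖z - y‖`. The sharp constant `K / 2` is not needed. -/
lemma norm_sub_sub_le_of_lipschitz_fderiv {F' : Type*} [NormedAddCommGroup F'] [NormedSpace ℝ F']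
    {F : E → F'} {s : Set E} {K : ℝ≥0} (hs : Convex ℝ s) (hF : ∀ y ∈ s, DifferentiableAt ℝ F y)
    (hK : LipschitzOnWith K (fderiv ℝ F) s) {y z : E} (hy : y ∈ s) (hz : z ∈ s) :
    ‖F z - F y - fderiv ℝ F y (z - y)‖ ≤ K * ‖z - y‖ ^ 2 := by
  have hsub : segment ℝ y z ⊆ s := hs.segment_subset hy hz
  have := (convex_segment y z).norm_image_sub_le_of_norm_hasFDerivWithin_le' (f := F)
    (f' := fderiv ℝ F) (φ := fderiv ℝ F y) (C := K * ‖z - y‖)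
    (fun x hx ↦ (hF x (hsub hx)).hasFDerivAt.hasFDerivWithinAt)
    (fun x hx ↦ by
      refine (hK.norm_sub_le (hsub hx) hy).trans ?_
      gcongr
      rw [← dist_eq_norm, ← dist_eq_norm]
      obtain ⟨a, b, ha, hb, hab, rfl⟩ := hx
      have : a • y + b • z - y = b • (z - y) := by
        rw [← eq_sub_iff_add_eq] at hab; subst hab; module
      rw [dist_eq_norm, this, norm_smul, dist_eq_norm, Real.norm_of_nonneg hb]
      exact mul_le_of_le_one_left (norm_nonneg _) (by linarith))
    (left_mem_segment ℝ y z) (right_mem_segment ℝ y z)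
  calc _ ≤ _ := this
    _ = _ := by ring

/-- Solutions on `[0, 1]` of an autonomous equation with a small right-hand side. -/
lemma exists_trajectory_unitInterval [CompleteSpace E] {X : E → E} {y₀ : E} {a L K : ℝ≥0}
    (hb : ∀ y ∈ closedBall y₀ a, ‖X y‖ ≤ L) (hl : LipschitzOnWith K X (closedBall y₀ a))
    (hL : L ≤ a) :
    ∃ α : ℝ → E, α 0 = y₀ ∧ (∀ t, α t ∈ closedBall y₀ a) ∧
      ∀ t ∈ Icc (0 : ℝ) 1, HasDerivWithinAt α (X (α t)) (Icc 0 1) t := by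
  have hf : IsPicardLindelof (fun _ ↦ X) (tmin := 0) (tmax := 1) ⟨0, by simp⟩ y₀ a 0 L K :=
    .of_time_independent hb hl (by simpa using hL)
  -- Working with the Picard fixed point itself keeps the information that the trajectory stays in
  -- the ball. `compProj` clamps time to `[0, 1]`, so this holds for every real `t`.
  obtain ⟨α, hα⟩ := ODE.FunSpace.exists_isFixedPt_next hf (mem_closedBall_self le_rfl)
  refine ⟨α.compProj, ?_, fun t ↦ α.compProj_mem_closedBall hf.mul_max_le, fun t ht ↦ ?_⟩
  · rw [ODE.FunSpace.compProj_of_mem (by simp : (0 : ℝ) ∈ Icc 0 1), ← hα]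
    exact ODE.FunSpace.next_apply₀ hf _ α
  · apply ODE.hasDerivWithinAt_picard_Icc (t₀ := 0) (by simp) hf.continuousOn_uncurry
      α.continuous_compProj.continuousOn (fun _ ht' ↦ α.compProj_mem_closedBall hf.mul_max_le)
      y₀ ht |>.congr_of_mem _ ht
    intro t' ht'
    nth_rw 1 [← hα]
    rw [ODE.FunSpace.compProj_of_mem ht', ODE.FunSpace.next_apply]

/-- If `α` is a trajectory of `F(·) u` then `α + t F(α) δ` is an approximate trajectory of
`F(·) (u + δ)` up to second order in `δ`, provided the fields `F(·) v` commute. -/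
lemma norm_trajectory_sub_le {F : E → G →L[ℝ] E} {y₀ : E} {ρ : ℝ} {C K : ℝ≥0}
    (hF : ∀ y ∈ ball y₀ ρ, DifferentiableAt ℝ F y) (hC : ∀ y ∈ ball y₀ ρ, ‖F y‖ ≤ C)
    (hK : LipschitzOnWith K F (ball y₀ ρ)) (hK' : LipschitzOnWith K (fderiv ℝ F) (ball y₀ ρ))
    (hsymm : ∀ y ∈ ball y₀ ρ, ∀ u v, fderiv ℝ F y (F y u) v = fderiv ℝ F y (F y v) u)
    {u δ : G} (huδ : ‖u + δ‖ ≤ 1) (hδ : C * ‖δ‖ < ρ / 2) {α β : ℝ → E}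
    (hα0 : α 0 = y₀) (hβ0 : β 0 = y₀) (hα : ∀ t, α t ∈ closedBall y₀ (ρ / 2))
    (hβ : ∀ t, β t ∈ closedBall y₀ (ρ / 2))
    (hα' : ∀ t ∈ Icc (0 : ℝ) 1, HasDerivWithinAt α (F (α t) u) (Icc 0 1) t)
    (hβ' : ∀ t ∈ Icc (0 : ℝ) 1, HasDerivWithinAt β (F (β t) (u + δ)) (Icc 0 1) t) :
    ‖β 1 - (α 1 + F (α 1) δ)‖ ≤
      gronwallBound 0 K ((K * C + K * C ^ 2) * ‖δ‖ ^ 2) 1 := by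
  have hρ : 0 < ρ := by
    have : (0 : ℝ) ≤ C * ‖δ‖ := by positivity
    linarith
  have hsub : closedBall y₀ (ρ / 2) ⊆ ball y₀ ρ := closedBall_subset_ball (by linarith)
  have hnhds {t : ℝ} (ht : t ∈ Ico (0 : ℝ) 1) : Icc (0 : ℝ) 1 ∈ 𝓝[≥] t :=
    Filter.mem_of_superset (Icc_mem_nhdsGE ht.2) (Icc_subset_Icc_left ht.1)
  -- The first-order variation of the trajectory in direction `δ`. It starts at `y₀` and ends at `α
  -- 1 + F (α 1) δ`, so Grönwall comparison with `β` gives the claim.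
  set w : ℝ → E := fun t ↦ α t + F (α t) (t • δ) with hw
  have hw' : ∀ t ∈ Icc (0 : ℝ) 1, HasDerivWithinAt w
      (F (α t) u + (fderiv ℝ F (α t) (F (α t) u) (t • δ) + F (α t) δ)) (Icc 0 1) t := by
    intro t ht
    refine (hα' t ht).add ?_
    have h1 : HasDerivWithinAt (fun t ↦ F (α t)) (fderiv ℝ F (α t) (F (α t) u)) (Icc 0 1) t :=
      (hF _ (hsub (hα t))).hasFDerivAt.comp_hasDerivWithinAt t (hα' t ht)
    have h2 : HasDerivWithinAt (fun t : ℝ ↦ t • δ) ((1 : ℝ) • δ) (Icc 0 1) t :=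
      (hasDerivWithinAt_id t _).smul_const δ
    simpa using h1.clm_apply h2
  have hwk {t : ℝ} (ht : t ∈ Icc (0 : ℝ) 1) : ‖F (α t) (t • δ)‖ ≤ C * ‖δ‖ := by
    refine ((F (α t)).le_opNorm _).trans ?_
    rw [norm_smul, Real.norm_of_nonneg ht.1]
    exact mul_le_mul (hC _ (hsub (hα t))) (mul_le_of_le_one_left (norm_nonneg _) ht.2)
      (mul_nonneg ht.1 (norm_nonneg _)) C.2
  have hws {t : ℝ} (ht : t ∈ Icc (0 : ℝ) 1) : w t ∈ ball y₀ ρ := by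
    rw [mem_ball, dist_eq_norm]
    have h1 := hα t
    rw [mem_closedBall, dist_eq_norm] at h1
    calc ‖w t - y₀‖ = ‖(α t - y₀) + F (α t) (t • δ)‖ := by simp only [hw]; congr 1; abel
      _ ≤ _ := norm_add_le _ _
      _ < ρ := by linarith [hwk ht]
  have key := dist_le_of_approx_trajectories_ODE_of_mem (v := fun _ y ↦ F y (u + δ))
    (s := fun _ ↦ ball y₀ ρ) (K := K) (a := 0) (b := 1) (δ := 0) (εf := 0)
    (εg := (K * C + K * C ^ 2) * ‖δ‖ ^ 2)
    (f := β) (g := w) (f' := fun t ↦ F (β t) (u + δ))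
    (g' := fun t ↦ F (α t) u + (fderiv ℝ F (α t) (F (α t) u) (t • δ) + F (α t) δ))
    (fun t _ ↦ LipschitzOnWith.of_dist_le_mul fun y hy z hz ↦ by
      rw [dist_eq_norm, ← sub_apply, dist_eq_norm]
      refine ((F y - F z).le_opNorm _).trans ?_
      refine (mul_le_of_le_one_right (norm_nonneg _) huδ).trans (hK.norm_sub_le hy hz))
    (fun t ht ↦ (hβ' t ht).continuousWithinAt)
    (fun t ht ↦ (hβ' t (Ico_subset_Icc_self ht)).mono_of_mem_nhdsWithin (hnhds ht))
    (fun t _ ↦ by simp) (fun t _ ↦ hsub (hβ t))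
    (fun t ht ↦ (hw' t ht).continuousWithinAt)
    (fun t ht ↦ (hw' t (Ico_subset_Icc_self ht)).mono_of_mem_nhdsWithin (hnhds ht))
    (fun t ht ↦ by
      have ht' := Ico_subset_Icc_self ht
      have hT := norm_sub_sub_le_of_lipschitz_fderiv (convex_ball y₀ ρ) hF hK' (hsub (hα t))
        (hws ht')
      have hwα : w t - α t = F (α t) (t • δ) := by simp [hw]
      rw [hwα] at hT
      have hD : ‖fderiv ℝ F (α t)‖ ≤ K :=
        norm_fderiv_le_of_lipschitzOn ℝ (isOpen_ball.mem_nhds (hsub (hα t))) hK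
      have hk := hwk ht'
      set k := F (α t) (t • δ)
      -- Here the fields commute: the derivative of `w` becomes the first-order expansion at `α t`
      -- of `F (w t) (u + δ)`. What remains is the Taylor remainder and one term bilinear in `k` and
      -- `δ`.
      have hs : fderiv ℝ F (α t) (F (α t) u) (t • δ) = fderiv ℝ F (α t) k u :=
        hsymm _ (hsub (hα t)) u (t • δ)
      rw [dist_eq_norm, hs]
      calc ‖F (α t) u + (fderiv ℝ F (α t) k u + F (α t) δ) - F (w t) (u + δ)‖
          = ‖-((F (w t) - F (α t) - fderiv ℝ F (α t) k) (u + δ)) - fderiv ℝ F (α t) k δ‖ := by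
            congr 1
            simp only [sub_apply, map_add]
            abel
        _ ≤ ‖(F (w t) - F (α t) - fderiv ℝ F (α t) k) (u + δ)‖ + ‖fderiv ℝ F (α t) k δ‖ := by
            rw [← norm_neg ((F (w t) - F (α t) - fderiv ℝ F (α t) k) (u + δ))]
            exact norm_sub_le _ _
        _ ≤ K * (C * ‖δ‖) ^ 2 * 1 + K * (C * ‖δ‖) * ‖δ‖ := by
            gcongr
            · refine (ContinuousLinearMap.le_opNorm _ _).trans ?_
              gcongr
              exact hT.trans (by gcongr)
            · refine (ContinuousLinearMap.le_opNorm _ _).trans ?_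
              gcongr
              refine (ContinuousLinearMap.le_opNorm _ _).trans ?_
              gcongr
        _ = (K * C + K * C ^ 2) * ‖δ‖ ^ 2 := by ring)
    (fun t ht ↦ hws (Ico_subset_Icc_self ht)) (by simp [hw, hα0, hβ0])
    1 (by simp)
  simpa [hw, dist_eq_norm] using key

/-- With no initial gap the bound is linear in the forcing term, so the factor `‖δ‖ ^ 2` can be
pulled out. -/
lemma gronwallBound_zero_mul (K ε c x : ℝ) :
    gronwallBound 0 K (ε * c) x = gronwallBound 0 K ε x * c := by
  by_cases hK : K = 0
  · simp [gronwallBound, hK]; ring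
  · simp [gronwallBound, hK]; ring

/-- Bootstrapping: `f' = F ∘ f` is as smooth as `f`, so `f` gains one derivative at each step. -/
lemma contDiffOn_of_hasFDerivAt_comp {F : E → G →L[ℝ] E} {Ω : Set E} (hF : ContDiffOn ℝ ∞ F Ω)
    {f : G → E} {W : Set G} (hW : IsOpen W) (hfΩ : ∀ u ∈ W, f u ∈ Ω)
    (hf : ∀ u ∈ W, HasFDerivAt f (F (f u)) u) : ContDiffOn ℝ ∞ f W := by
  rw [contDiffOn_infty]
  intro n
  induction n with
  | zero =>
    exact contDiffOn_zero.2 fun u hu ↦ (hf u hu).continuousAt.continuousWithinAt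
  | succ n ih =>
    rw [show ((n + 1 : ℕ) : WithTop ℕ∞) = (n : WithTop ℕ∞) + 1 by push_cast; rfl,
      contDiffOn_succ_iff_fderiv_of_isOpen hW]
    refine ⟨fun u hu ↦ (hf u hu).differentiableAt.differentiableWithinAt, by simp, ?_⟩
    have hF' : ContDiffOn ℝ n F Ω := hF.of_le (by exact_mod_cast le_top)
    exact (hF'.comp ih hfΩ).congr fun u hu ↦ (hf u hu).fderiv

/-- A frame `F(·) v` of pairwise commuting vector fields is tangent to an integral manifold through
each point. -/
theorem exists_contDiffOn_hasFDerivAt_comp [CompleteSpace E] {F : E → G →L[ℝ] E} {Ω : Set E}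
    (hΩ : IsOpen Ω) {y₀ : E} (hy₀ : y₀ ∈ Ω) (hF : ContDiffOn ℝ ∞ F Ω)
    (hsymm : ∀ y ∈ Ω, ∀ u v, fderiv ℝ F y (F y u) v = fderiv ℝ F y (F y v) u) :
    ∃ r > 0, ∃ f : G → E, f 0 = y₀ ∧ (∀ u ∈ ball (0 : G) r, f u ∈ Ω) ∧
      (∀ u ∈ ball (0 : G) r, HasFDerivAt f (F (f u)) u) ∧ ContDiffOn ℝ ∞ f (ball 0 r) := by
  have hFy : ContDiffAt ℝ ∞ F y₀ := hF.contDiffAt (hΩ.mem_nhds hy₀)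
  obtain ⟨K₁, s₁, hs₁, hK₁⟩ := (hFy.of_le (m := 1) (by simp)).exists_lipschitzOnWith
  obtain ⟨K₂, s₂, hs₂, hK₂⟩ :=
    (hFy.fderiv_right (m := 1) (by norm_cast)).exists_lipschitzOnWith
  have hs₃ : {y | ‖F y‖ < ‖F y₀‖ + 1} ∈ 𝓝 y₀ :=
    hFy.continuousAt.norm.eventually_lt continuousAt_const (by linarith)
  obtain ⟨ρ, hρ, hsub⟩ := Metric.mem_nhds_iff.1
    (Filter.inter_mem (Filter.inter_mem hs₁ hs₂) (Filter.inter_mem hs₃ (hΩ.mem_nhds hy₀)))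
  set K := max K₁ K₂
  have hK : LipschitzOnWith K F (ball y₀ ρ) :=
    (hK₁.mono fun y hy ↦ (hsub hy).1.1).weaken (le_max_left _ _)
  have hK' : LipschitzOnWith K (fderiv ℝ F) (ball y₀ ρ) :=
    (hK₂.mono fun y hy ↦ (hsub hy).1.2).weaken (le_max_right _ _)
  set C : ℝ≥0 := ‖F y₀‖₊ + 1
  have hC : ∀ y ∈ ball y₀ ρ, ‖F y‖ ≤ C := fun y hy ↦ (le_of_lt (hsub hy).2.1 : _)
  have hsΩ : ball y₀ ρ ⊆ Ω := fun y hy ↦ (hsub hy).2.2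
  have hd : ∀ y ∈ ball y₀ ρ, DifferentiableAt ℝ F y := fun y hy ↦
    (hF.contDiffAt (hΩ.mem_nhds (hsΩ hy))).differentiableAt (by simp)
  have hsub' : closedBall y₀ (ρ / 2) ⊆ ball y₀ ρ := closedBall_subset_ball (by linarith)
  have hCpos : (0 : ℝ) < C := by positivity
  -- `r ≤ 1` makes `‖u + δ‖ ≤ 1`. `C * r ≤ ρ / 4` confines trajectories to the half ball and, as
  -- `‖δ‖ < 2 * r`, gives `C * ‖δ‖ < ρ / 2`.
  set r : ℝ := min 1 (ρ / 4 / C)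
  have hr : 0 < r := by positivity
  have hrC : C * r ≤ ρ / 4 := by
    calc C * r ≤ C * (ρ / 4 / C) := by gcongr; exact min_le_right _ _
      _ = ρ / 4 := by field_simp
  have hex : ∀ u ∈ ball (0 : G) r, ∃ α : ℝ → E, α 0 = y₀ ∧ (∀ t, α t ∈ closedBall y₀ (ρ / 2)) ∧
      ∀ t ∈ Icc (0 : ℝ) 1, HasDerivWithinAt α (F (α t) u) (Icc 0 1) t := by
    intro u hu
    rw [mem_ball_zero_iff] at hu
    refine exists_trajectory_unitInterval (X := fun y ↦ F y u) (a := .mk (ρ / 2) (by positivity))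
      (L := C * ‖u‖₊) (K := K * ‖u‖₊) ?_ ?_ ?_
    · intro y hy
      refine ((F y).le_opNorm u).trans ?_
      push_cast
      gcongr
      exact hC y (hsub' hy)
    · refine LipschitzOnWith.of_dist_le_mul fun y hy z hz ↦ ?_
      rw [dist_eq_norm, ← sub_apply, dist_eq_norm]
      refine ((F y - F z).le_opNorm _).trans ?_
      push_cast
      calc _ ≤ (K * ‖y - z‖) * ‖u‖ := by
            gcongr; exact hK.norm_sub_le (hsub' hy) (hsub' hz)
        _ = _ := by ring
    · rw [← NNReal.coe_le_coe, NNReal.coe_mul, coe_nnnorm, NNReal.coe_mk]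
      have : C * ‖u‖ ≤ C * r := by gcongr
      linarith
  choose! α hα0 hαm hα' using hex
  -- The integral manifold is the time-one map `u ↦ α u 1`. The quadratic error estimate for nearby
  -- trajectories is exactly its differentiability.
  have hfd : ∀ u ∈ ball (0 : G) r, HasFDerivAt (fun u ↦ α u 1) (F (α u 1)) u := by
    intro u hu
    rw [hasFDerivAt_iff_isLittleO_nhds_zero]
    set B := gronwallBound 0 K (K * C + K * C ^ 2) 1
    have hO : (fun δ : G ↦ α (u + δ) 1 - α u 1 - F (α u 1) δ) =O[𝓝 0] fun δ ↦ ‖δ‖ ^ 2 := by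
      refine Asymptotics.IsBigO.of_bound B ?_
      have h1 : ∀ᶠ δ : G in 𝓝 0, u + δ ∈ ball (0 : G) r := by
        have : Filter.Tendsto (fun δ : G ↦ u + δ) (𝓝 0) (𝓝 (u + 0)) :=
          (continuous_const.add continuous_id).tendsto 0
        rw [add_zero] at this
        exact this (isOpen_ball.mem_nhds hu)
      filter_upwards [h1] with δ hδ
      have hδn : ‖δ‖ < 2 * r := by
        rw [mem_ball_zero_iff] at hu hδ
        calc ‖δ‖ = ‖(u + δ) - u‖ := by congr 1; abel
          _ ≤ ‖u + δ‖ + ‖u‖ := norm_sub_le _ _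
          _ < 2 * r := by linarith
      have := norm_trajectory_sub_le hd hC hK hK' (fun y hy ↦ hsymm y (hsΩ hy))
        (u := u) (δ := δ) ((mem_ball_zero_iff.1 hδ).le.trans (min_le_left _ _))
        (by
          have : C * ‖δ‖ < C * (2 * r) := by gcongr
          linarith)
        (hα0 u hu) (hα0 _ hδ) (hαm u hu) (hαm _ hδ) (hα' u hu) (hα' _ hδ)
      rw [gronwallBound_zero_mul] at this
      simpa [sub_sub, B] using this
    refine hO.trans_isLittleO ?_
    have := Asymptotics.isLittleO_norm_pow_id (E' := G) (n := 2) (by norm_num)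
    simpa using this
  have hmem : ∀ u ∈ ball (0 : G) r, α u 1 ∈ Ω := fun u hu ↦ hsΩ (hsub' (hαm u hu 1))
  refine ⟨r, hr, fun u ↦ α u 1, ?_, hmem, hfd, ?_⟩
  · have h0 : (0 : G) ∈ ball (0 : G) r := mem_ball_self hr
    have := (convex_Icc (0 : ℝ) 1).norm_image_sub_le_of_norm_hasDerivWithin_le (f := α 0)
      (f' := fun t ↦ F (α 0 t) 0) (C := 0) (fun t ht ↦ hα' 0 h0 t ht) (by simp)
      (x := 0) (y := 1) (by simp) (by simp)
    simp [sub_eq_zero] at this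
    simp only [this, hα0 0 h0]
  · exact contDiffOn_of_hasFDerivAt_comp hF isOpen_ball hmem hfd

end TotalDifferentialEquation

/-! ### Linear families of decomposable alternating forms -/

section CommonFactor

/-- A family of `2 × n` matrices all of whose linear combinations have rank at most one either has
a common linear relation between the rows or is determined by a single column. -/
lemma exists_relation_or_column {U Z : Type*} (α β : U → Z → ℝ)
    (h : ∀ u u' z z', α u z * β u' z' + α u' z * β u z' = α u z' * β u' z + α u' z' * β u z) :
    (∃ s t : ℝ, (s ≠ 0 ∨ t ≠ 0) ∧ ∀ u z, s * α u z + t * β u z = 0) ∨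
      ∃ z₀, ∀ u, α u z₀ = 0 → β u z₀ = 0 → ∀ z, α u z = 0 ∧ β u z = 0 := by
  by_cases h0 : ∀ u z, α u z = 0 ∧ β u z = 0
  · exact .inl ⟨1, 0, by simp, fun u z ↦ by simp [h0 u z]⟩
  push Not at h0
  obtain ⟨u₀, z₀, h0⟩ := h0
  by_cases h1 : ∀ u z, β u₀ z₀ * α u z + -α u₀ z₀ * β u z = 0
  · refine .inl ⟨β u₀ z₀, -α u₀ z₀, ?_, h1⟩
    by_cases ha : α u₀ z₀ = 0
    · exact .inl (h0 ha)
    · exact .inr (neg_ne_zero.2 ha)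
  push Not at h1
  obtain ⟨u₁, z₁, h1⟩ := h1
  right
  -- The column of `u₁` at `z₁` is not a multiple of the nonzero column of `u₀` at `z₀`. If the
  -- columns of `u₀` and `u₁` at `z₀` were dependent, the polarized minors would contradict this.
  have h2 : β u₀ z₀ * α u₁ z₀ - α u₀ z₀ * β u₁ z₀ ≠ 0 := by
    intro h2
    have e1 := h u₁ u₀ z₁ z₀
    have e2 := h u₀ u₀ z₁ z₀
    have e3 : α u₀ z₀ * (β u₀ z₀ * α u₁ z₁ + -α u₀ z₀ * β u₁ z₁) = 0 := by
      linear_combination α u₀ z₀ * e1 + α u₀ z₁ * h2 - α u₁ z₀ / 2 * e2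
    have e4 : β u₀ z₀ * (β u₀ z₀ * α u₁ z₁ + -α u₀ z₀ * β u₁ z₁) = 0 := by
      linear_combination β u₀ z₀ * e1 + β u₀ z₁ * h2 - β u₁ z₀ / 2 * e2
    have := (mul_eq_zero.1 e3).resolve_right h1
    exact h0 this ((mul_eq_zero.1 e4).resolve_right h1)
  refine ⟨z₀, fun u ha hb z ↦ ?_⟩
  -- With the `z₀` column of `u` zero, the polarized minors against `u₀` and `u₁` are a linear
  -- system for `(α u z, β u z)` with nonzero determinant.
  have e1 := h u u₀ z z₀
  have e2 := h u u₁ z z₀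
  rw [ha, hb] at e1 e2
  constructor
  · refine (mul_eq_zero.1 (?_ : _ * α u z = 0)).resolve_left h2
    linear_combination α u₁ z₀ * e1 - α u₀ z₀ * e2
  · refine (mul_eq_zero.1 (?_ : _ * β u z = 0)).resolve_left h2
    linear_combination β u₁ z₀ * e1 - β u₀ z₀ * e2

variable {U V : Type*} [AddCommGroup U] [Module ℝ U] [AddCommGroup V] [Module ℝ V]

lemma finrank_le_finrank_inf_ker_add [FiniteDimensional ℝ U] [FiniteDimensional ℝ V]
    (S : Submodule ℝ U) (L : U →ₗ[ℝ] V) :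
    finrank ℝ S ≤ finrank ℝ (S ⊓ LinearMap.ker L : Submodule ℝ U) + finrank ℝ V := by
  have h1 := LinearMap.finrank_range_add_finrank_ker (L.domRestrict S)
  have h2 : finrank ℝ (LinearMap.ker (L.domRestrict S)) =
      finrank ℝ (S ⊓ LinearMap.ker L : Submodule ℝ U) := by
    rw [LinearMap.ker_domRestrict, ← Submodule.finrank_map_subtype_eq,
      Submodule.map_comap_subtype]
  have h3 := Submodule.finrank_le (LinearMap.range (L.domRestrict S))
  omega

lemma exists_ne_zero_of_lt_finrank [FiniteDimensional ℝ U] [FiniteDimensional ℝ V]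
    {S : Submodule ℝ U} (L : U →ₗ[ℝ] V) (h : finrank ℝ V < finrank ℝ S) :
    ∃ u ∈ S, u ≠ 0 ∧ L u = 0 := by
  have h1 := finrank_le_finrank_inf_ker_add S L
  have h2 : (S ⊓ LinearMap.ker L : Submodule ℝ U) ≠ ⊥ := by
    rw [← Submodule.one_le_finrank_iff]; omega
  obtain ⟨u, hu, h0⟩ := Submodule.exists_mem_ne_zero_of_ne_bot h2
  exact ⟨u, hu.1, h0, hu.2⟩

/-- A linear family of decomposable alternating `2`-forms of rank at least four has a common
factor. -/
theorem exists_common_factor [FiniteDimensional ℝ U] (Θ : U →ₗ[ℝ] V →ₗ[ℝ] V →ₗ[ℝ] ℝ)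
    (halt : ∀ u a b, Θ u a b = -Θ u b a)
    (hP : ∀ u a b c d, Θ u a b * Θ u c d - Θ u a c * Θ u b d + Θ u a d * Θ u b c = 0)
    {S : Submodule ℝ U} (hS : 4 ≤ finrank ℝ S) (hinj : ∀ u ∈ S, Θ u = 0 → u = 0) :
    ∃ l : V →ₗ[ℝ] ℝ, l ≠ 0 ∧
      ∀ u a b c, l a * Θ u b c - l b * Θ u a c + l c * Θ u a b = 0 := by
  have hself (u a) : Θ u a a = 0 := by have := halt u a a; linarith
  have hpol (u u' a b c d) : Θ u a b * Θ u' c d + Θ u' a b * Θ u c d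
      - Θ u a c * Θ u' b d - Θ u' a c * Θ u b d
      + Θ u a d * Θ u' b c + Θ u' a d * Θ u b c = 0 := by
    have := hP (u + u') a b c d
    simp only [map_add, LinearMap.add_apply] at this
    linear_combination this - hP u a b c d - hP u' a b c d
  obtain ⟨u₁, hu₁S, hu₁, -⟩ := exists_ne_zero_of_lt_finrank (S := S) (0 : U →ₗ[ℝ] ℝ) (by
    simp; omega)
  obtain ⟨v, w, hvw⟩ : ∃ v w, Θ u₁ v w = 1 := by
    by_contra! hne
    refine hu₁ (hinj _ hu₁S ?_)
    ext v w
    by_contra h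
    exact hne v ((Θ u₁ v w)⁻¹ • w) (by simpa using inv_mul_cancel₀ h)
  -- `Θ u₁ = a ∧ b`, with `v`, `w` dual to `a`, `b`; the map `q` below projects onto `ker a ∩ ker
  -- b`.
  set a : V →ₗ[ℝ] ℝ := -Θ u₁ w with ha
  set b : V →ₗ[ℝ] ℝ := Θ u₁ v with hb
  have hvw : Θ u₁ v w = 1 := hvw
  have hav : a v = 1 := by simp [ha, halt u₁ w v, hvw]
  have haw : a w = 0 := by simp [ha, hself]
  have hbv : b v = 0 := hself _ _
  have hbw : b w = 1 := hvw
  set q : V → V := fun z ↦ z - a z • v - b z • w with hq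
  have haq (z) : a (q z) = 0 := by simp [hq, hav, haw]
  have hbq (z) : b (q z) = 0 := by simp [hq, hbv, hbw]
  -- Plücker relation polarized between `u₁` and `u`. It follows that `Θ u = c · a ∧ b + a ∧ α + b ∧
  -- β`, with `α = Θ u v ∘ q`, `β = Θ u w ∘ q`.
  have hQ (u z z') : Θ u (q z) (q z') = 0 := by
    have e1 := hP u₁ v w (q z) (q z')
    have e2 := hpol u₁ u v w (q z) (q z')
    have h1 (z) : Θ u₁ v (q z) = 0 := hbq z
    have h2 (z) : Θ u₁ w (q z) = 0 := neg_eq_zero.1 (haq z)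
    simp only [h1, h2, hvw] at e1 e2
    have e3 : Θ u₁ (q z) (q z') = 0 := by linarith
    rw [e3] at e2
    linarith
  have hdec (z) : z = a z • v + b z • w + q z := by simp [hq]
  have hform (u x y) : Θ u x y = Θ u v w * (a x * b y - b x * a y) + a x * Θ u v (q y)
      - a y * Θ u v (q x) + b x * Θ u w (q y) - b y * Θ u w (q x) := by
    conv_lhs => rw [hdec x, hdec y]
    simp only [map_add, map_smul, LinearMap.add_apply, LinearMap.smul_apply, smul_eq_mul, hQ,
      hself, halt u (q x) v, halt u (q x) w, halt u w v]
    ring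
  -- The Plücker relation at `v, w, q z, q z'` says that `α` and `β` are proportional for each `u`.
  -- If `s α + t β = 0` uniformly in `u`, then `t a - s b` divides every `Θ u`.
  rcases exists_relation_or_column (fun u z ↦ Θ u v (q z)) (fun u z ↦ Θ u w (q z)) (by
    intro u u' z z'
    have := hpol u u' v w (q z) (q z')
    simp only [hQ] at this
    linarith) with ⟨s, t, hst, h⟩ | ⟨z₀, h⟩
  · refine ⟨t • a - s • b, ?_, fun u x y z ↦ ?_⟩
    · intro h0
      have h1 := LinearMap.congr_fun h0 v
      have h2 := LinearMap.congr_fun h0 w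
      simp [hav, haw, hbv, hbw] at h1 h2
      simp [h1, h2] at hst
    · have hx := h u x
      have hy := h u y
      have hz := h u z
      simp only [LinearMap.sub_apply, LinearMap.smul_apply, smul_eq_mul, hform u y z, hform u x z,
        hform u x y]
      linear_combination (a y * b z - b y * a z) * hx - (a x * b z - b x * a z) * hy +
        (a x * b y - b x * a y) * hz
  · exfalso
    -- If one column determines `α` and `β`, three scalar equations force `Θ u = 0`. A space of
    -- dimension four contains a nonzero solution.
    obtain ⟨u, huS, hu, hL⟩ := exists_ne_zero_of_lt_finrank (S := S)
      (LinearMap.pi ![(Θ.flip v).flip w, (Θ.flip v).flip (q z₀), (Θ.flip w).flip (q z₀)] :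
        U →ₗ[ℝ] Fin 3 → ℝ) (by simp; omega)
    have h0 := congrFun hL 0
    have h1 := congrFun hL 1
    have h2 := congrFun hL 2
    simp at h0 h1 h2
    refine hu (hinj u huS ?_)
    ext x y
    have hz := h u h1 h2
    simp only [hform u x y, hz, h0]
    simp

/-- A symmetric bilinear form whose `2 × 2` Gram determinants vanish has a radical of codimension
at most one. -/
lemma exists_linear_form_of_gram_eq_zero (J : V →ₗ[ℝ] V →ₗ[ℝ] ℝ) {W : Submodule ℝ V}
    (h : ∀ x ∈ W, ∀ y ∈ W, J x x * J y y - J x y ^ 2 = 0) :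
    ∃ l : V →ₗ[ℝ] ℝ, ∀ x ∈ W, l x = 0 → ∀ y ∈ W, J x y = 0 := by
  by_cases h0 : ∃ v ∈ W, J v v ≠ 0
  · obtain ⟨v, hv, h0⟩ := h0
    refine ⟨J v, fun x hx hl y hy ↦ ?_⟩
    have e1 := h v hv x hx
    have e2 := h x hx y hy
    rw [hl] at e1
    have : J x x = 0 := by simpa [h0] using e1
    rw [this] at e2
    simpa using e2
  · push Not at h0
    refine ⟨0, fun x hx _ y hy ↦ ?_⟩
    have e2 := h x hx y hy
    rw [h0 x hx] at e2
    simpa using e2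

end CommonFactor

/-! ### Spacelike planes -/

section Spacelike

variable {V : Type*} [AddCommGroup V] [Module ℝ V] {B : LinearMap.BilinForm ℝ V}

lemma isSpacelikeBasis_of_mem {S : Submodule ℝ V} (hS : ∀ v ∈ S, v ≠ 0 → 0 < B v v) {x y : V}
    (hx : x ∈ S) (hy : y ∈ S) (hxy : LinearIndependent ℝ ![x, y]) : IsSpacelikeBasis B x y :=
  ⟨hxy, fun v hv ↦ hS v ((Submodule.span_le.2 (by
    rintro z (rfl | rfl) <;> assumption)) hv)⟩

/-- Sylvester's criterion for the Gram matrix, by completing the square. It exhibits spacelikeness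
as an open condition. -/
lemma isSpacelikeBasis_iff (hB : ∀ v w, B v w = B w v) {x y : V} :
    IsSpacelikeBasis B x y ↔ 0 < B x x ∧ 0 < B x x * B y y - B x y ^ 2 := by
  constructor
  · rintro ⟨hli, hpos⟩
    rw [LinearIndependent.pair_iff] at hli
    have hx : 0 < B x x := hpos x (Submodule.subset_span (by simp)) (by
      rintro rfl
      simpa using hli 1 0 (by simp))
    refine ⟨hx, ?_⟩
    have := hpos (B x x • y - B x y • x)
      (Submodule.sub_mem _ (Submodule.smul_mem _ _ (Submodule.subset_span (by simp)))
        (Submodule.smul_mem _ _ (Submodule.subset_span (by simp)))) (by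
      intro h
      have := (hli (-B x y) (B x x) (by rw [← h]; module)).2
      exact hx.ne' this)
    simp only [map_sub, map_smul, LinearMap.sub_apply, LinearMap.smul_apply, smul_eq_mul,
      hB y x] at this
    refine pos_of_mul_pos_right (a := B x x) ?_ hx.le
    calc _ < _ := this
      _ = _ := by ring
  · rintro ⟨hx, hd⟩
    have key (s t : ℝ) : B x x * B (s • x + t • y) (s • x + t • y) =
        (s * B x x + t * B x y) ^ 2 + t ^ 2 * (B x x * B y y - B x y ^ 2) := by
      simp only [map_add, map_smul, LinearMap.add_apply, LinearMap.smul_apply, smul_eq_mul,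
        hB y x]
      ring
    have key' (s t : ℝ) (h : B (s • x + t • y) (s • x + t • y) ≤ 0) : s = 0 ∧ t = 0 := by
      have h1 : (s * B x x + t * B x y) ^ 2 + t ^ 2 * (B x x * B y y - B x y ^ 2) ≤ 0 := by
        rw [← key]; exact mul_nonpos_of_nonneg_of_nonpos hx.le h
      have h2 : t ^ 2 * (B x x * B y y - B x y ^ 2) ≤ 0 := by nlinarith
      have ht : t = 0 := by
        by_contra ht
        have : 0 < t ^ 2 * (B x x * B y y - B x y ^ 2) := by positivity
        linarith
      subst ht
      have : s * B x x = 0 := by nlinarith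
      exact ⟨by simpa [hx.ne'] using this, rfl⟩
    refine ⟨LinearIndependent.pair_iff.2 fun s t h ↦ key' s t (by simp [h]), fun v hv h0 ↦ ?_⟩
    obtain ⟨s, t, rfl⟩ := Submodule.mem_span_pair.1 hv
    by_contra hle
    obtain ⟨rfl, rfl⟩ := key' s t (not_lt.1 hle)
    simp at h0

/-- A function which is analytic on the line and vanishes near `1` vanishes at `0`. -/
lemma eq_zero_of_eventually_eq_zero {f : ℝ → ℝ} (hf : AnalyticOnNhd ℝ f univ)
    (h : ∀ᶠ t in 𝓝 (1 : ℝ), f t = 0) : f 0 = 0 :=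
  congrFun (AnalyticOnNhd.eq_of_eventuallyEq (g := fun _ ↦ (0 : ℝ)) hf
    analyticOnNhd_const h) 0

/-- The segment reaches `(x, y)` at `t = 1` and starts at the arbitrary pair `(x', y')`. Polynomial
identities known near `t = 1` thus propagate to `t = 0`. -/
lemma eventually_isSpacelikeBasis (hB : ∀ v w, B v w = B w v) {x y : V}
    (h : IsSpacelikeBasis B x y) (x' y' : V) :
    ∀ᶠ t in 𝓝 (1 : ℝ), IsSpacelikeBasis B (x' + t • (x - x')) (y' + t • (y - y')) := by
  rw [isSpacelikeBasis_iff hB] at h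
  simp only [isSpacelikeBasis_iff hB]
  refine Filter.Eventually.and ?_ ?_
  · refine continuousAt_const.eventually_lt ?_ (by simpa using h.1)
    simp only [map_add, map_smul, LinearMap.add_apply, LinearMap.smul_apply, smul_eq_mul]
    fun_prop
  · refine continuousAt_const.eventually_lt ?_ (by simpa using h.2)
    simp only [map_add, map_smul, LinearMap.add_apply, LinearMap.smul_apply, smul_eq_mul]
    fun_prop

/-- Every spacelike vector lies in a spacelike subspace of maximal dimension; here is the orthogonal
complement of the vector in that subspace. -/
lemma exists_spacelike_orthogonal [FiniteDimensional ℝ V] (hB : ∀ v w, B v w = B w v)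
    {S : Submodule ℝ V} (hS : ∀ v ∈ S, v ≠ 0 → 0 < B v v) {e : V} (he : 0 < B e e) :
    ∃ S' : Submodule ℝ V, finrank ℝ S ≤ finrank ℝ S' + 1 ∧
      ∀ y ∈ S', y ≠ 0 → IsSpacelikeBasis B e y := by
  -- `e` need not lie in `S`; the only cost is one linear condition on `S`.
  refine ⟨S ⊓ LinearMap.ker (B e), ?_, fun y hy h0 ↦ ?_⟩
  · simpa using finrank_le_finrank_inf_ker_add S (B e)
  · rw [isSpacelikeBasis_iff hB]
    have h1 : B e y = 0 := hy.2
    have h2 := hS y hy.1 h0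
    exact ⟨he, by rw [h1]; nlinarith [mul_pos he h2]⟩

lemma exists_isSpacelikeBasis_mem [FiniteDimensional ℝ V] {S : Submodule ℝ V}
    (hS : ∀ v ∈ S, v ≠ 0 → 0 < B v v) (h : 2 ≤ finrank ℝ S) :
    ∃ x ∈ S, ∃ y ∈ S, IsSpacelikeBasis B x y := by
  obtain ⟨x, hx, hx0, -⟩ := exists_ne_zero_of_lt_finrank (S := S) (0 : V →ₗ[ℝ] ℝ) (by simp; omega)
  obtain ⟨y, hy⟩ := exists_linearIndependent_pair_of_one_lt_finrank (R := ℝ) (M := S) (by omega)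
    (x := ⟨x, hx⟩) (by simpa using hx0)
  have := hy.map' S.subtype (Submodule.ker_subtype S)
  refine ⟨x, hx, y, y.2, isSpacelikeBasis_of_mem hS hx y.2 ?_⟩
  have h2 : ![x, (y : V)] = S.subtype ∘ ![⟨x, hx⟩, y] := by ext i; fin_cases i <;> rfl
  rwa [h2]

end Spacelike

/-! ### Algebraic curvature tensors with decomposable curvature operators -/

section AlgebraicCurvature

variable {V : Type*} [AddCommGroup V] [Module ℝ V]

/-- The symmetries of a curvature tensor. -/
structure IsAlgebraicCurvature (T : V →ₗ[ℝ] V →ₗ[ℝ] V →ₗ[ℝ] V →ₗ[ℝ] ℝ) : Prop where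
  swap_left (x y z w : V) : T x y z w = -T y x z w
  swap_right (x y z w : V) : T x y z w = -T x y w z
  bianchi (x y z w : V) : T x y z w + T y z x w + T z x y w = 0

namespace IsAlgebraicCurvature

variable {T : V →ₗ[ℝ] V →ₗ[ℝ] V →ₗ[ℝ] V →ₗ[ℝ] ℝ}

lemma self_left (hT : IsAlgebraicCurvature T) (x z w : V) : T x x z w = 0 := by
  have := hT.swap_left x x z w; linarith

lemma self_right (hT : IsAlgebraicCurvature T) (x y z : V) : T x y z z = 0 := by
  have := hT.swap_right x y z z; linarith

/-- The classical octahedron argument: combine the four cyclic Bianchi identities with the two skew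
symmetries. -/
lemma pair_symm (hT : IsAlgebraicCurvature T) (x y z w : V) : T x y z w = T z w x y := by
  have e1 := hT.bianchi x y z w
  have e2 := hT.bianchi y z w x
  have e3 := hT.bianchi z w x y
  have e4 := hT.bianchi w x y z
  have a1 := hT.swap_right y z x w
  have a2 := hT.swap_right z x y w
  have a3 := hT.swap_right x y z w
  have a4 := hT.swap_right z w y x
  have a5 := hT.swap_right w y z x
  have a6 := hT.swap_right w x z y
  have a7 := hT.swap_left w y x z
  have a8 := hT.swap_left w y z x
  have a9 := hT.swap_left x z w y
  have a10 := hT.swap_left x z y w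
  have a11 := hT.swap_left w x y z
  have a12 := hT.swap_left x w z y
  have a13 := hT.swap_left y w x z
  have a14 := hT.swap_right y w x z
  have a15 := hT.swap_right x z w y
  have a16 := hT.swap_right x w y z
  have a17 := hT.swap_right z w x y
  linarith

lemma bianchi_right (hT : IsAlgebraicCurvature T) (x y z w : V) :
    T x y z w + T x z w y + T x w y z = 0 := by
  have := hT.bianchi y z w x
  rw [hT.pair_symm y z, hT.pair_symm z w, hT.pair_symm w y, hT.swap_left w x y z,
    hT.swap_left z x w y] at *
  have e1 := hT.pair_symm x y z w
  have e2 := hT.pair_symm x z w y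
  have e3 := hT.pair_symm x w y z
  have b1 := hT.swap_right w x y z
  have b2 := hT.swap_left w x y z
  have b3 := hT.swap_left y x z w
  have b4 := hT.swap_left z x w y
  linarith

variable {B : LinearMap.BilinForm ℝ V}

/-- Decomposability of the curvature operators of spacelike planes extends to all planes. -/
lemma decomposable_of_spacelike (hB : ∀ v w, B v w = B w v) {x₀ y₀ : V}
    (h₀ : IsSpacelikeBasis B x₀ y₀)
    (h : ∀ x y, IsSpacelikeBasis B x y → ∀ a b c d,
      T x y a b * T x y c d - T x y a c * T x y b d + T x y a d * T x y b c = 0)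
    (x y a b c d : V) : T x y a b * T x y c d - T x y a c * T x y b d + T x y a d * T x y b c = 0 := by
  have := eq_zero_of_eventually_eq_zero
    (f := fun t ↦ T (x + t • (x₀ - x)) (y + t • (y₀ - y)) a b *
      T (x + t • (x₀ - x)) (y + t • (y₀ - y)) c d -
      T (x + t • (x₀ - x)) (y + t • (y₀ - y)) a c * T (x + t • (x₀ - x)) (y + t • (y₀ - y)) b d +
      T (x + t • (x₀ - x)) (y + t • (y₀ - y)) a d * T (x + t • (x₀ - x)) (y + t • (y₀ - y)) b c)
    (by
      simp only [map_add, map_smul, LinearMap.add_apply, LinearMap.smul_apply, smul_eq_mul]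
      exact fun _ _ ↦ by fun_prop)
    (by
      filter_upwards [eventually_isSpacelikeBasis hB h₀ x y] with t ht
      exact h _ _ ht a b c d)
  simpa using this

variable [FiniteDimensional ℝ V]

/-- The common factor theorem applies to `y ↦ T e y`, which is injective on the part of `S`
orthogonal to `e`. That part has dimension at least `5 - 1 = 4`. -/
lemma exists_factor (hT : IsAlgebraicCurvature T) (hB : ∀ v w, B v w = B w v)
    (hP : ∀ x y a b c d,
      T x y a b * T x y c d - T x y a c * T x y b d + T x y a d * T x y b c = 0)
    (hne : ∀ x y, IsSpacelikeBasis B x y → T x y ≠ 0) {S : Submodule ℝ V}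
    (hS : ∀ v ∈ S, v ≠ 0 → 0 < B v v) (hS5 : 5 ≤ finrank ℝ S) {e : V} (he : 0 < B e e) :
    ∃ l : V →ₗ[ℝ] ℝ, l ≠ 0 ∧
      ∀ y a b c, l a * T e y b c - l b * T e y a c + l c * T e y a b = 0 := by
  obtain ⟨S', hS', hsp⟩ := exists_spacelike_orthogonal hB hS he
  refine exists_common_factor (T e) (fun y ↦ hT.swap_right e y) (fun y ↦ hP e y) (S := S')
    (by omega) fun y hy h0 ↦ ?_
  by_contra hy0
  exact hne e y (hsp y hy hy0) h0

/-- The common factor can be chosen not to vanish on the given vector, for a suitable spacelike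
vector. -/
lemma exists_factor_apply_eq_one (hT : IsAlgebraicCurvature T) (hB : ∀ v w, B v w = B w v)
    (hP : ∀ x y a b c d,
      T x y a b * T x y c d - T x y a c * T x y b d + T x y a d * T x y b c = 0)
    (hne : ∀ x y, IsSpacelikeBasis B x y → T x y ≠ 0) {S : Submodule ℝ V}
    (hS : ∀ v ∈ S, v ≠ 0 → 0 < B v v) (hS5 : 5 ≤ finrank ℝ S) :
    ∃ e : V, 0 < B e e ∧ ∃ l : V →ₗ[ℝ] ℝ, l e = 1 ∧
      ∀ y a b c, l a * T e y b c - l b * T e y a c + l c * T e y a b = 0 := by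
  by_contra! hcon
  have hzero {e : V} (he : 0 < B e e) {l : V →ₗ[ℝ] ℝ}
      (h : ∀ y a b c, l a * T e y b c - l b * T e y a c + l c * T e y a b = 0) : l e = 0 := by
    by_contra hle
    obtain ⟨y, a, b, c, h1⟩ := hcon e he ((l e)⁻¹ • l) (by simpa using inv_mul_cancel₀ hle)
    apply h1
    simp only [LinearMap.smul_apply, smul_eq_mul]
    linear_combination (l e)⁻¹ * h y a b c
  -- If every factor kills its own `e`, then `T e y e w` is a function of `y` times `l w`, so each
  -- Jacobi form has rank at most one.
  have hgram {e : V} (he : 0 < B e e) (y w : V) :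
      T e y e y * T e w e w - T e y e w * T e w e y = 0 := by
    obtain ⟨l, hl, h⟩ := hT.exists_factor hB hP hne hS hS5 he
    obtain ⟨f, hf⟩ : ∃ f, l f ≠ 0 := by
      by_contra! h0
      exact hl (LinearMap.ext h0)
    have hle := hzero he h
    have key (y w) : l f * T e y e w = -l w * T e y f e := by
      have := h y f e w
      rw [hle] at this
      linarith
    refine (mul_eq_zero.1 (?_ : l f ^ 2 * _ = 0)).resolve_left (pow_ne_zero 2 hf)
    linear_combination l f * T e w e w * key y y - l y * T e y f e * key w w
      - l f * T e w e y * key y w + l w * T e y f e * key w y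
  obtain ⟨e, heS, he0, -⟩ := exists_ne_zero_of_lt_finrank (S := S) (0 : V →ₗ[ℝ] ℝ)
    (by simp; omega)
  have he := hS e heS he0
  obtain ⟨l, hl, h⟩ := hT.exists_factor hB hP hne hS hS5 he
  have hle := hzero he h
  obtain ⟨f, hf⟩ : ∃ f, l f = 1 := by
    obtain ⟨f, hf⟩ : ∃ f, l f ≠ 0 := by
      by_contra! h0
      exact hl (LinearMap.ext h0)
    exact ⟨(l f)⁻¹ • f, by simpa using inv_mul_cancel₀ hf⟩
  have hform (y b c) : T e y b c = l b * T e y f c - l c * T e y f b := by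
    have := h y f b c
    rw [hf] at this
    linarith
  have hH (y b c) (hb : l b = 0) (hc : l c = 0) : T e y b c = 0 := by rw [hform, hb, hc]; ring
  have hsymm (y z) (hy : l y = 0) (hz : l z = 0) : T e y f z = T e z f y := by
    have e1 := hT.bianchi_right e y z f
    rw [hH f y z hy hz, hT.swap_right e y z f] at e1
    linarith
  -- Perturb `e` to `e + t • f`, still spacelike for small `t`. On `ker l` its Jacobi form is `t`
  -- times `2 T e y f w + t T f y f w`. Dividing the vanishing Gram determinant by `t ^ 2` and
  -- letting `t → 0` gives the claim.
  have hA (y w) (hy : l y = 0) (hw : l w = 0) :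
      T e y f y * T e w f w - T e y f w ^ 2 = 0 := by
    set g : ℝ → ℝ := fun t ↦ (2 * T e y f y + t * T f y f y) * (2 * T e w f w + t * T f w f w)
      - (2 * T e y f w + t * T f y f w) * (2 * T e w f y + t * T f w f y) with hg
    have hJ (t : ℝ) (y w) (hy : l y = 0) (hw : l w = 0) :
        T (e + t • f) y (e + t • f) w = t * (2 * T e y f w + t * T f y f w) := by
      have e1 := hH y e w hle hw
      have e2 : T f y e w = T e y f w := by rw [hT.pair_symm, hsymm w y hw hy]
      simp only [map_add, map_smul, LinearMap.add_apply, LinearMap.smul_apply, smul_eq_mul, e1, e2]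
      ring
    have hev : ∀ᶠ t in 𝓝[≠] (0 : ℝ), g t = 0 := by
      have hsp : ∀ᶠ t in 𝓝 (0 : ℝ), 0 < B (e + t • f) (e + t • f) := by
        refine continuousAt_const.eventually_lt ?_ (by simpa using he)
        simp only [map_add, map_smul, LinearMap.add_apply, LinearMap.smul_apply, smul_eq_mul]
        fun_prop
      filter_upwards [hsp.filter_mono nhdsWithin_le_nhds, self_mem_nhdsWithin] with t ht ht0
      have := hgram ht y w
      rw [hJ t y y hy hy, hJ t y w hy hw, hJ t w y hw hy, hJ t w w hw hw] at this
      refine (mul_eq_zero.1 (?_ : t ^ 2 * g t = 0)).resolve_left (pow_ne_zero 2 ht0)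
      rw [← this, hg]
      ring
    have hc : Filter.Tendsto g (𝓝[≠] 0) (𝓝 (g 0)) :=
      (by fun_prop : Continuous g).continuousAt.tendsto.mono_left nhdsWithin_le_nhds
    have h0 : g 0 = 0 := tendsto_nhds_unique hc
      (tendsto_const_nhds.congr' (hev.mono fun t ht ↦ ht.symm))
    simp only [hg, hsymm w y hw hy] at h0
    linarith
  obtain ⟨m, hm⟩ := exists_linear_form_of_gram_eq_zero ((T e).flip f) (W := LinearMap.ker l)
    (fun y hy w hw ↦ hA y w hy hw)
  obtain ⟨S', hS', hsp⟩ := exists_spacelike_orthogonal hB hS he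
  -- The symmetric form `T e y f w` on `ker l` has rank at most one, so two linear conditions
  -- produce a spacelike plane with `T e y = 0`.
  obtain ⟨y, hyS, hy0, hL⟩ := exists_ne_zero_of_lt_finrank (S := S')
    (LinearMap.pi ![l, m] : V →ₗ[ℝ] Fin 2 → ℝ) (by simp; omega)
  have hly : l y = 0 := congrFun hL 0
  have hmy : m y = 0 := congrFun hL 1
  have hAy (c) : T e y f c = 0 := by
    have h1 : T e y f (c - l c • f) = 0 := hm y hly hmy _ (by simp [hf])
    simpa [hT.self_right] using h1
  refine hne e y (hsp y hyS hy0) ?_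
  ext b c
  rw [hform, hAy, hAy]
  simp

/-- An algebraic curvature tensor whose curvature operators are decomposable, and do not vanish on
spacelike planes, is a multiple of the curvature tensor of a symmetric bilinear form. -/
theorem exists_bilinForm (hT : IsAlgebraicCurvature T) (hB : ∀ v w, B v w = B w v)
    (hP : ∀ x y a b c d,
      T x y a b * T x y c d - T x y a c * T x y b d + T x y a d * T x y b c = 0)
    (hne : ∀ x y, IsSpacelikeBasis B x y → T x y ≠ 0) {S : Submodule ℝ V}
    (hS : ∀ v ∈ S, v ≠ 0 → 0 < B v v) (hS5 : 5 ≤ finrank ℝ S) :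
    ∃ (h : V →ₗ[ℝ] V →ₗ[ℝ] ℝ) (c : ℝ), c ≠ 0 ∧ (∀ x y, h x y = h y x) ∧
      ∀ x y z w, T x y z w = c * (h x z * h y w - h x w * h y z) := by
  obtain ⟨e, he, l, hle, hl⟩ := hT.exists_factor_apply_eq_one hB hP hne hS hS5
  set J : V →ₗ[ℝ] V →ₗ[ℝ] ℝ := (T e).flip e with hJ
  have hJT (y w) : J y w = T e y e w := rfl
  have hJsymm (y w) : J y w = J w y := by rw [hJT, hJT, hT.pair_symm]
  have hJe (y) : J y e = 0 := hT.self_right _ _ _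
  have hform (y b c) : T e y b c = l b * J y c - l c * J y b := by
    have := hl y e b c
    rw [hle] at this
    simp only [hJT]
    linarith
  have hH (y b c) (hb : l b = 0) (hc : l c = 0) : T e y b c = 0 := by rw [hform, hb, hc]; ring
  have hH' (b c y) (hb : l b = 0) (hc : l c = 0) : T b c e y = 0 := by
    rw [hT.pair_symm, hH y b c hb hc]
  have hproj (x) : ∃ x', l x' = 0 ∧ x = l x • e + x' := ⟨x - l x • e, by simp [hle], by abel⟩
  -- The Plücker relation of `(e + z, y)` at `e, a, b, c`, polarized in `e` and `z`: on `ker l`, `J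
  -- y` divides `T z y`. So does `J z`, and `T y z` is proportional to `J y ∧ J z`.
  have hwedge (y z a b c) (ha : l a = 0) (hb : l b = 0) (hc : l c = 0) :
      J y a * T z y b c - J y b * T z y a c + J y c * T z y a b = 0 := by
    have h1 := hP (e + z) y e a b c
    simp only [map_add, LinearMap.add_apply] at h1
    have h2 := hP e y e a b c
    have h3 := hP z y e a b c
    simp only [hH y a b ha hb, hH y b c hb hc, hH y a c ha hc, ← hJT] at h1 h2
    linear_combination h1 - h2 - h3
  have hprop (y z a b c d) (ha : l a = 0) (hb : l b = 0) (hc : l c = 0) (hd : l d = 0) :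
      T y z c d * (J y a * J z b - J y b * J z a) =
        T y z a b * (J y c * J z d - J y d * J z c) := by
    have r1 := hwedge y z a c d ha hc hd
    have r2 := hwedge y z b c d hb hc hd
    have r3 := hwedge z y a b c ha hb hc
    have r4 := hwedge z y a b d ha hb hd
    simp only [hT.swap_left z y] at r1 r2
    linear_combination (-J z b) * r1 + J z a * r2 - J y c * r4 + J y d * r3
  -- Otherwise `J` has rank at most one on `ker l`, and some spacelike `(e, y)` would have `T e y =
  -- 0`.
  obtain ⟨y₀, z₀, hy₀, hz₀, hD⟩ : ∃ y z, l y = 0 ∧ l z = 0 ∧ J y y * J z z - J y z ^ 2 ≠ 0 := by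
    by_contra! h0
    obtain ⟨m, hm⟩ := exists_linear_form_of_gram_eq_zero J (W := LinearMap.ker l)
      (fun y hy z hz ↦ h0 y z hy hz)
    obtain ⟨S', hS', hsp⟩ := exists_spacelike_orthogonal hB hS he
    obtain ⟨y, hyS, hy0, hL⟩ := exists_ne_zero_of_lt_finrank (S := S')
      (LinearMap.pi ![l, m] : V →ₗ[ℝ] Fin 2 → ℝ) (by simp; omega)
    have hly : l y = 0 := congrFun hL 0
    have hmy : m y = 0 := congrFun hL 1
    have hJy (c) : J y c = 0 := by
      have h1 : J y (c - l c • e) = 0 := hm y hly hmy _ (by simp [hle])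
      simpa [hJe] using h1
    refine hne e y (hsp y hyS hy0) ?_
    ext b c
    rw [hform, hJy, hJy]
    simp
  set c₀ : ℝ := T y₀ z₀ y₀ z₀ / (J y₀ y₀ * J z₀ z₀ - J y₀ z₀ ^ 2) with hc₀
  have h₀ (c d) (hc : l c = 0) (hd : l d = 0) :
      T y₀ z₀ c d = c₀ * (J y₀ c * J z₀ d - J y₀ d * J z₀ c) := by
    have := hprop y₀ z₀ y₀ z₀ c d hy₀ hz₀ hc hd
    rw [hJsymm z₀ y₀] at this
    rw [hc₀]
    field_simp
    linear_combination this
  have hHH (y z c d) (hy : l y = 0) (hz : l z = 0) (hc : l c = 0) (hd : l d = 0) :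
      T y z c d = c₀ * (J y c * J z d - J y d * J z c) := by
    -- Pair symmetry transfers the constant `c₀` from `(y₀, z₀)` to `(y, z)` wherever the second
    -- factor does not vanish. Analyticity along a line removes that restriction.
    have hprod (y z) (hy : l y = 0) (hz : l z = 0) :
        (T y z c d - c₀ * (J y c * J z d - J y d * J z c)) *
          (J y y₀ * J z z₀ - J y z₀ * J z y₀) = 0 := by
      have e1 := hprop y z y₀ z₀ c d hy₀ hz₀ hc hd
      have e2 := h₀ y z hy hz
      rw [hT.pair_symm, hJsymm y₀ y, hJsymm z₀ z, hJsymm y₀ z, hJsymm z₀ y] at e2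
      rw [e2] at e1
      linear_combination e1
    have := eq_zero_of_eventually_eq_zero
      (f := fun t ↦ T (y + t • (y₀ - y)) (z + t • (z₀ - z)) c d - c₀ *
        (J (y + t • (y₀ - y)) c * J (z + t • (z₀ - z)) d -
          J (y + t • (y₀ - y)) d * J (z + t • (z₀ - z)) c))
      (by
        simp only [map_add, map_smul, LinearMap.add_apply, LinearMap.smul_apply, smul_eq_mul]
        exact fun _ _ ↦ by fun_prop)
      (by
        have hev : ∀ᶠ t in 𝓝 (1 : ℝ), J (y + t • (y₀ - y)) y₀ * J (z + t • (z₀ - z)) z₀ -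
            J (y + t • (y₀ - y)) z₀ * J (z + t • (z₀ - z)) y₀ ≠ 0 := by
          refine ContinuousAt.eventually_ne ?_ (by
            simpa [hJsymm z₀ y₀, sq] using hD)
          simp only [map_add, map_smul, LinearMap.add_apply, LinearMap.smul_apply, smul_eq_mul]
          fun_prop
        filter_upwards [hev] with t ht
        exact (mul_eq_zero.1 (hprod _ _ (by simp [hy, hy₀]) (by simp [hz, hz₀]))).resolve_right ht)
    simpa [sub_eq_zero] using this
  have hc₀0 : c₀ ≠ 0 := by
    intro h0
    have hf := finrank_le_finrank_inf_ker_add S l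
    rw [finrank_self] at hf
    obtain ⟨x, hx, y, hy, hxy⟩ := exists_isSpacelikeBasis_mem (B := B)
      (S := S ⊓ LinearMap.ker l) (fun v hv ↦ hS v hv.1) (by omega)
    refine hne x y hxy ?_
    ext c d
    obtain ⟨c', hc', hc⟩ := hproj c
    obtain ⟨d', hd', hd⟩ := hproj d
    have h1 := hHH x y c' d' hx.2 hy.2 hc' hd'
    rw [h0] at h1
    have h2 := hH' x y d' hx.2 hy.2
    have h3 : T x y c' e = 0 := by rw [hT.swap_right, hH' x y c' hx.2 hy.2, neg_zero]
    rw [hc, hd]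
    simp [h1, h2, h3, hT.self_right]
  -- `J` has `e` in its radical and gives the components on `ker l`. The term `c₀⁻¹ • l ⊗ l` makes
  -- the mixed components, those involving `e`, equal to `J` after multiplication by `c₀`.
  refine ⟨J + c₀⁻¹ • (LinearMap.smulRightₗ l l), c₀, hc₀0, fun x y ↦ ?_, fun x y z w ↦ ?_⟩
  · simp [hJsymm x y, mul_comm (l x)]
  · obtain ⟨x', hx', hx⟩ := hproj x
    obtain ⟨y', hy', hy⟩ := hproj y
    obtain ⟨z', hz', hz⟩ := hproj z
    obtain ⟨w', hw', hw⟩ := hproj w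
    have hJe' (y) : J e y = 0 := by rw [hJsymm, hJe]
    have hJ1 (u v u' v') (hu : u = l u • e + u') (hv : v = l v • e + v') : J u v = J u' v' := by
      rw [hu, hv]; simp [hJe, hJe']
    have t1 := hHH x' y' z' w' hx' hy' hz' hw'
    have t2 (u v a) (hu : l u = 0) (hv : l v = 0) : T u v a e = 0 := by
      rw [hT.swap_right, hH' u v a hu hv, neg_zero]
    have t3 (u a b) (ha : l a = 0) (hb : l b = 0) : T u e a b = 0 := by
      rw [hT.swap_left, hH u a b ha hb, neg_zero]
    have t4 (u v) : T e u v e = -J u v := hT.swap_right _ _ _ _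
    have t5 (u v) : T u e e v = -J u v := hT.swap_left _ _ _ _
    have t6 (u v) : T u e v e = J u v := by rw [hT.swap_left, t4, neg_neg]
    simp only [LinearMap.add_apply, LinearMap.smul_apply, smul_eq_mul,
      LinearMap.smulRightₗ_apply, LinearMap.smulRight_apply, hJ1 x z x' z' hx hz, hJ1 y w y' w' hy hw,
      hJ1 x w x' w' hx hw, hJ1 y z y' z' hy hz]
    have hexp : T x y z w = T x' y' z' w' + l x * l z * J y' w' - l x * l w * J y' z'
        - l y * l z * J x' w' + l y * l w * J x' z' := by
      conv_lhs => rw [hx, hy, hz, hw]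
      simp only [map_add, map_smul, LinearMap.add_apply, LinearMap.smul_apply, smul_eq_mul,
        hT.self_left, hT.self_right, hH y' z' w' hz' hw', hH' x' y' w' hx' hy',
        t2 x' y' z' hx' hy', t3 x' z' w' hz' hw', t4, t5, t6, ← hJT]
      ring
    rw [hexp, t1]
    field_simp
    ring

end IsAlgebraicCurvature

end AlgebraicCurvature

/-! ### Nilpotent Jordan IP tensors: from a symmetric form to an endomorphism with `ker φ = range φ`
-/

section NilpotentRoot

variable {V : Type*} [AddCommGroup V] [Module ℝ V]
  {B : LinearMap.BilinForm ℝ V}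

/-- The alternating form of a skew-adjoint operator of rank at most two is decomposable. -/
lemma decomposable_of_finrank_range_le_two [FiniteDimensional ℝ V] {N : Module.End ℝ V}
    (hN : ∀ z w, B (N z) w = -B (N w) z) (h : finrank ℝ (LinearMap.range N) ≤ 2) (a b c d : V) :
    B (N a) b * B (N c) d - B (N a) c * B (N b) d + B (N a) d * B (N b) c = 0 := by
  -- Rank at most two yields a linear relation among `N a`, `N b`, `N c`. Each of its coefficients
  -- annihilates the Pfaffian expression.
  obtain ⟨u, -, hu, hL⟩ := exists_ne_zero_of_lt_finrank (S := (⊤ : Submodule ℝ (Fin 3 → ℝ)))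
    (N.rangeRestrict ∘ₗ Fintype.linearCombination ℝ ![a, b, c]) (by simp; omega)
  have hL' : u 0 • N a + u 1 • N b + u 2 • N c = 0 := by
    have := congrArg Subtype.val hL
    simpa [Fintype.linearCombination_apply, Fin.sum_univ_three] using this
  have hx (x) : u 0 * B (N a) x + u 1 * B (N b) x + u 2 * B (N c) x = 0 := by
    have := congrArg (fun v ↦ B v x) hL'
    simpa using this
  have hself (x) : B (N x) x = 0 := by have := hN x x; linarith
  have ha := hx a
  have hb := hx b
  have hc := hx c
  have hd := hx d
  rw [hself, hN b a, hN c a] at ha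
  rw [hself, hN c b] at hb
  rw [hself] at hc
  have h0 : u 0 * (B (N a) b * B (N c) d - B (N a) c * B (N b) d + B (N a) d * B (N b) c) = 0 := by
    linear_combination B (N c) d * hb + B (N b) c * hd - B (N b) d * hc
  have h1 : u 1 * (B (N a) b * B (N c) d - B (N a) c * B (N b) d + B (N a) d * B (N b) c) = 0 := by
    linear_combination -B (N c) d * ha - B (N a) c * hd + B (N a) d * hc
  have h2 : u 2 * (B (N a) b * B (N c) d - B (N a) c * B (N b) d + B (N a) d * B (N b) c) = 0 := by
    linear_combination B (N b) d * ha + B (N a) b * hd - B (N a) d * hb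
  by_contra hne
  refine hu (funext fun i ↦ ?_)
  fin_cases i
  · exact (mul_eq_zero.1 h0).resolve_right hne
  · exact (mul_eq_zero.1 h1).resolve_right hne
  · exact (mul_eq_zero.1 h2).resolve_right hne

/-- Spacelike vectors form a nonempty open cone, so a quadratic polynomial vanishing on them
vanishes identically; then polarize. -/
lemma eq_zero_of_bilin_self_eq_zero_of_spacelike {e : V}
    (he : 0 < B e e) (q : V →ₗ[ℝ] V →ₗ[ℝ] ℝ) (hq : ∀ v w, q v w = q w v)
    (h : ∀ v, 0 < B v v → q v v = 0) : q = 0 := by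
  have hself (v) : q v v = 0 := by
    have := eq_zero_of_eventually_eq_zero (f := fun t ↦ q (v + t • (e - v)) (v + t • (e - v)))
      (by
        simp only [map_add, map_smul, LinearMap.add_apply, LinearMap.smul_apply, smul_eq_mul]
        exact fun _ _ ↦ by fun_prop)
      (by
        have : ∀ᶠ t in 𝓝 (1 : ℝ), 0 < B (v + t • (e - v)) (v + t • (e - v)) := by
          refine continuousAt_const.eventually_lt ?_ (by simpa using he)
          simp only [map_add, map_smul, LinearMap.add_apply, LinearMap.smul_apply, smul_eq_mul]
          fun_prop
        filter_upwards [this] with t ht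
        exact h _ ht)
    simpa using this
  ext v w
  have := hself (v + w)
  simp only [map_add, LinearMap.add_apply, hself, hq w v] at this
  simpa using by linarith

lemma curvatureOfEnd_apply (φ : Module.End ℝ V) (x y z : V) :
    curvatureOfEnd B φ x y z = B (φ y) z • φ x - B (φ x) z • φ y := rfl

/-- A nilpotent operator of the form `z ↦ (b, z) a - (a, z) b` has an isotropic image. -/
lemma gram_eq_zero_of_isNilpotent (hB : ∀ v w, B v w = B w v) {φ : Module.End ℝ V} {x y : V}
    (h : IsNilpotent (curvatureOfEnd B φ x y)) :
    B (φ x) (φ x) * B (φ y) (φ y) - B (φ x) (φ y) ^ 2 = 0 := by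
  set N := curvatureOfEnd B φ x y
  set d := B (φ x) (φ x) * B (φ y) (φ y) - B (φ x) (φ y) ^ 2 with hd
  by_contra hd0
  have hx : φ x ≠ 0 := by
    intro h0
    simp [hd, h0] at hd0
  -- `φ x` is an eigenvector of `N ^ 2` with eigenvalue minus the Gram determinant, which nilpotency
  -- forces to be zero.
  have hN : (N ^ 2) (φ x) = (-d) • φ x := by
    rw [pow_two, Module.End.mul_apply]
    simp only [N, curvatureOfEnd_apply, map_sub, map_smul, hB (φ y) (φ x), hd]
    module
  have hpow (n : ℕ) : ((N ^ 2) ^ n) (φ x) = (-d) ^ n • φ x := by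
    induction n with
    | zero => simp
    | succ n ih => rw [pow_succ', Module.End.mul_apply, ih, map_smul, hN, smul_smul, pow_succ]
  obtain ⟨n, hn⟩ := h
  have := hpow n
  rw [← pow_mul, mul_comm, pow_mul, hn, zero_pow two_ne_zero] at this
  have h1 : (-d) ^ n • φ x = 0 := by simpa using this.symm
  exact hx ((smul_eq_zero.1 h1).resolve_left (pow_ne_zero _ (neg_ne_zero.2 hd0)))

/-- The curvature operator `R_φ(x, y)` has square zero if and only if `φ x`, `φ y` span an isotropic
subspace. -/
lemma curvatureOfEnd_sq_eq_zero_iff (hB : ∀ v w, B v w = B w v) (hnd : B.Nondegenerate)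
    {φ : Module.End ℝ V} {x y : V} (hli : LinearIndependent ℝ ![φ x, φ y]) :
    curvatureOfEnd B φ x y ^ 2 = 0 ↔
      B (φ x) (φ x) = 0 ∧ B (φ x) (φ y) = 0 ∧ B (φ y) (φ y) = 0 := by
  constructor
  · intro h
    rw [LinearIndependent.pair_iff] at hli
    have hz (z) : (B (φ y) z * B (φ x) (φ y) - B (φ x) z * B (φ y) (φ y)) = 0 ∧
        (-B (φ y) z * B (φ x) (φ x) + B (φ x) z * B (φ x) (φ y)) = 0 := by
      refine hli _ _ ?_
      have := LinearMap.congr_fun h z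
      rw [pow_two, Module.End.mul_apply] at this
      simp only [curvatureOfEnd_apply, map_sub, map_smul, hB (φ y) (φ x),
        LinearMap.zero_apply] at this
      rw [← this]
      module
    have key {s t : ℝ} (h : ∀ z, s * B (φ x) z + t * B (φ y) z = 0) : s = 0 ∧ t = 0 :=
      hli s t (hnd.1 _ fun z ↦ by simpa using h z)
    have h1 := key (s := -B (φ y) (φ y)) (t := B (φ x) (φ y)) fun z ↦ by linarith [(hz z).1]
    have h2 := key (s := B (φ x) (φ y)) (t := -B (φ x) (φ x)) fun z ↦ by linarith [(hz z).2]
    exact ⟨neg_eq_zero.1 h2.2, h2.1, neg_eq_zero.1 h1.1⟩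
  · rintro ⟨h1, h2, h3⟩
    ext z
    rw [pow_two, Module.End.mul_apply]
    simp [curvatureOfEnd_apply, h1, h2, h3, hB (φ y) (φ x)]

/-- The classification of spacelike rank two nilpotent Jordan IP curvature tensors in balanced
signature. -/
theorem exists_nilpotent_curvature_root [FiniteDimensional ℝ V] (hB : ∀ v w, B v w = B w v) (hnd : B.Nondegenerate)
    (R : V →ₗ[ℝ] V →ₗ[ℝ] Module.End ℝ V) (hswap : ∀ x y, R x y = -R y x)
    (hskew : ∀ x y z w, B (R x y z) w = -B (R x y w) z)
    (hbianchi : ∀ x y z, R x y z + R y z x + R z x y = 0)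
    {S : Submodule ℝ V} (hS : ∀ v ∈ S, v ≠ 0 → 0 < B v v) (hS5 : 5 ≤ finrank ℝ S)
    (hdim : finrank ℝ V = 2 * finrank ℝ S)
    (hrank : HasSpacelikeRank B (fun x y ↦ R x y) 2)
    (hjordan : IsSpacelikeJordanIP B (fun x y ↦ R x y))
    (hnil : IsSpacelikeNilpotent B (fun x y ↦ R x y)) :
    ∃ ε : ℝ, (ε = 1 ∨ ε = -1) ∧ ∃ φ : Module.End ℝ V, (∀ v w, B (φ v) w = B v (φ w)) ∧
      LinearMap.ker φ = LinearMap.range φ ∧ ∀ v w, R v w = ε • curvatureOfEnd B φ v w := by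
  have hscale {x y} (h : IsSpacelikeBasis B x y) :
      (√|B x x * B y y - B x y ^ 2|)⁻¹ ≠ 0 := by
    have := ((isSpacelikeBasis_iff hB).1 h).2
    rw [abs_of_pos this]
    positivity
  have hrank' {x y} (h : IsSpacelikeBasis B x y) : finrank ℝ (LinearMap.range (R x y)) = 2 := by
    have := hrank x y h
    rwa [skewCurvatureOperator, LinearMap.range_smul _ _ (hscale h)] at this
  set T : V →ₗ[ℝ] V →ₗ[ℝ] V →ₗ[ℝ] V →ₗ[ℝ] ℝ :=
    R.compr₂ (LinearMap.llcomp ℝ V V (V →ₗ[ℝ] ℝ) B) with hTdef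
  have hTapp (x y z w) : T x y z w = B (R x y z) w := rfl
  have hT : IsAlgebraicCurvature T := by
    refine ⟨fun x y z w ↦ ?_, fun x y z w ↦ ?_, fun x y z w ↦ ?_⟩
    · rw [hTapp, hTapp, hswap x y]; simp
    · rw [hTapp, hTapp, hskew]
    · simp only [hTapp]
      rw [← LinearMap.add_apply, ← LinearMap.add_apply, ← map_add, ← map_add, hbianchi]
      simp
  have hne (x y) (h : IsSpacelikeBasis B x y) : T x y ≠ 0 := by
    intro h0
    have hR : R x y = 0 := by
      ext z
      refine hnd.1 _ fun w ↦ ?_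
      rw [← hTapp, h0]
      simp
    have := hrank' h
    rw [hR, LinearMap.range_zero, finrank_bot] at this
    omega
  obtain ⟨x₀, hx₀, y₀, hy₀, hxy₀⟩ := exists_isSpacelikeBasis_mem hS (by omega)
  have hP := IsAlgebraicCurvature.decomposable_of_spacelike (T := T) hB hxy₀
    fun x y h a b c d ↦ decomposable_of_finrank_range_le_two (hskew x y) (hrank' h).le a b c d
  obtain ⟨h, c, hc, hsymm, hTh⟩ := hT.exists_bilinForm hB hP hne hS hS5
  -- The scaling absorbs `|c|`, leaving a sign. `curvatureOfEnd` takes the two products in the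
  -- opposite order to `hTh`, hence `ε * |c| = -c`.
  set φ : Module.End ℝ V := √|c| • ((B.toDual hnd).symm.toLinearMap ∘ₗ h) with hφ
  have hφB (x y) : B (φ x) y = √|c| * h x y := by
    simp only [hφ, LinearMap.smul_apply, map_smul, smul_eq_mul]
    congr 1
    exact LinearMap.BilinForm.apply_toDual_symm_apply (B := B) (hB := hnd) (h x) y
  have hself (v w) : B (φ v) w = B v (φ w) := by rw [hB v, hφB, hφB, hsymm]
  have hsq : √|c| * √|c| = |c| := Real.mul_self_sqrt (abs_nonneg c)
  obtain ⟨ε, hε, hεc⟩ : ∃ ε : ℝ, (ε = 1 ∨ ε = -1) ∧ ε * |c| = -c := by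
    rcases lt_or_gt_of_ne hc with h | h
    · exact ⟨1, .inl rfl, by rw [abs_of_neg h]; ring⟩
    · exact ⟨-1, .inr rfl, by rw [abs_of_pos h]; ring⟩
  have hε0 : ε ≠ 0 := by rcases hε with rfl | rfl <;> norm_num
  have hR (v w) : R v w = ε • curvatureOfEnd B φ v w := by
    ext z
    rw [← sub_eq_zero]
    refine hnd.1 _ fun u ↦ ?_
    have h1 := hTh v w z u
    rw [hTapp] at h1
    simp only [LinearMap.smul_apply, curvatureOfEnd_apply, map_sub, map_smul, LinearMap.sub_apply,
      smul_eq_mul, h1, hφB]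
    linear_combination (h v z * h w u - h v u * h w z) * (ε * hsq + hεc)
  have hli {x y} (hxy : IsSpacelikeBasis B x y) : LinearIndependent ℝ ![φ x, φ y] := by
    rw [LinearIndependent.pair_iff]
    intro s t hst
    by_contra hcon
    refine hne x y hxy ?_
    have hker (a b : V) (k : ℝ) (hab : φ a = k • φ b ∨ φ b = k • φ a) : R a b = 0 := by
      rw [hR]
      ext z
      rcases hab with hab | hab <;> simp [curvatureOfEnd_apply, hab, smul_smul, mul_comm]
    have : R x y = 0 := by
      by_cases hs : s = 0
      · subst hs
        have ht : t ≠ 0 := by tauto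
        refine hker x y 0 (.inr ?_)
        simpa [ht] using hst
      · refine hker x y (-(s⁻¹ * t)) (.inl ?_)
        have : φ x = s⁻¹ • (s • φ x) := by rw [smul_smul, inv_mul_cancel₀ hs, one_smul]
        rw [this, eq_neg_of_add_eq_zero_left hst]
        module
    ext z w
    rw [hTapp, this]
    simp
  have hnil' {x y} (hxy : IsSpacelikeBasis B x y) : IsNilpotent (curvatureOfEnd B φ x y) := by
    have h1 := hnil x y hxy
    rw [skewCurvatureOperator] at h1
    simp only [hR, smul_smul] at h1
    obtain ⟨n, hn⟩ := h1
    rw [smul_pow] at hn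
    exact ⟨n, (smul_eq_zero.1 hn).resolve_left (pow_ne_zero _ (mul_ne_zero (hscale hxy) hε0))⟩
  -- Conjugacy carries `R(π)² = 0` from one spacelike plane to all of them; this is the use of the
  -- Jordan condition.
  have hsqne {x y x' y'} (hxy : IsSpacelikeBasis B x y) (hxy' : IsSpacelikeBasis B x' y')
      (h0 : curvatureOfEnd B φ x' y' ^ 2 = 0) : curvatureOfEnd B φ x y ^ 2 = 0 := by
    obtain ⟨Θ, hΘ⟩ := hjordan x y x' y' hxy hxy'
    have h1 : skewCurvatureOperator B (fun x y ↦ R x y) x' y' ^ 2 = 0 := by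
      simp only [skewCurvatureOperator, hR, smul_smul, smul_pow, h0, smul_zero]
    have h2 : skewCurvatureOperator B (fun x y ↦ R x y) x y ^ 2 = 0 := by
      rw [hΘ, pow_two, Module.End.mul_eq_comp, ← LinearEquiv.conj_comp, ← Module.End.mul_eq_comp,
        ← pow_two, h1, map_zero]
    simp only [skewCurvatureOperator, hR, smul_smul, smul_pow] at h2
    exact (smul_eq_zero.1 h2).resolve_left (pow_ne_zero _ (mul_ne_zero (hscale hxy) hε0))
  set q : V →ₗ[ℝ] V →ₗ[ℝ] ℝ := B.compl₁₂ φ φ with hq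
  have hqapp (v w) : q v w = B (φ v) (φ w) := rfl
  -- On `S` the form `q` has vanishing Gram determinants, hence rank at most one. A spacelike plane
  -- in its radical has `R(π)² = 0`.
  have hqiso {x y} (hxy : IsSpacelikeBasis B x y) : q x x = 0 := by
    obtain ⟨m, hm⟩ := exists_linear_form_of_gram_eq_zero q (W := S) (fun x hx y hy ↦ by
      by_cases hind : LinearIndependent ℝ ![x, y]
      · exact gram_eq_zero_of_isNilpotent hB (hnil' (isSpacelikeBasis_of_mem hS hx hy hind))
      · rw [LinearIndependent.pair_iff] at hind
        push Not at hind
        obtain ⟨s, t, hst, hne⟩ := hind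
        have e1 (z) : s * q x z + t * q y z = 0 := by
          have := congrArg (fun v ↦ q v z) hst
          simpa using this
        have hqs : q y x = q x y := hB _ _
        have e2 := e1 x
        have e3 := e1 y
        rw [hqs] at e2
        by_cases hs : s = 0
        · have ht := hne hs
          refine (mul_eq_zero.1 (?_ : t * _ = 0)).resolve_left ht
          linear_combination q x x * e3 - q x y * e2
        · refine (mul_eq_zero.1 (?_ : s * _ = 0)).resolve_left hs
          linear_combination q y y * e2 - q x y * e3)
    have hf := finrank_le_finrank_inf_ker_add S m
    rw [finrank_self] at hf
    obtain ⟨x', hx', y', hy', hxy'⟩ := exists_isSpacelikeBasis_mem (B := B)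
      (S := S ⊓ LinearMap.ker m) (fun v hv ↦ hS v hv.1) (by omega)
    have h0 := (curvatureOfEnd_sq_eq_zero_iff hB hnd (hli hxy')).2
      ⟨hm x' hx'.1 hx'.2 x' hx'.1, hm x' hx'.1 hx'.2 y' hy'.1, hm y' hy'.1 hy'.2 y' hy'.1⟩
    exact ((curvatureOfEnd_sq_eq_zero_iff hB hnd (hli hxy)).1 (hsqne hxy hxy' h0)).1
  have hspx {x : V} (hx : 0 < B x x) : ∃ y, IsSpacelikeBasis B x y := by
    obtain ⟨S', hS', hsp⟩ := exists_spacelike_orthogonal hB hS hx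
    obtain ⟨y, hy, hy0, -⟩ := exists_ne_zero_of_lt_finrank (S := S') (0 : V →ₗ[ℝ] ℝ)
      (by simp; omega)
    exact ⟨y, hsp y hy hy0⟩
  have hx₀pos := ((isSpacelikeBasis_iff hB).1 hxy₀).1
  have hq0 : q = 0 := eq_zero_of_bilin_self_eq_zero_of_spacelike hx₀pos q
    (fun v w ↦ hB _ _) fun v hv ↦ (hspx hv).elim fun y hy ↦ hqiso hy
  have hφφ (v) : φ (φ v) = 0 := hnd.1 _ fun w ↦ by
    rw [hself, ← hqapp, hq0]
    simp
  refine ⟨ε, hε, φ, hself, ?_, hR⟩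
  symm
  refine Submodule.eq_of_le_of_finrank_le ?_ ?_
  · rintro _ ⟨v, rfl⟩
    exact hφφ v
  -- `φ` is injective on spacelike vectors, so `ker φ` has at most half the dimension. Since it
  -- contains `range φ`, rank-nullity gives equality.
  · have hdisj : S ⊓ LinearMap.ker φ = ⊥ := by
      rw [Submodule.eq_bot_iff]
      rintro x ⟨hxS, hxk⟩
      by_contra hx0
      obtain ⟨y, hxy⟩ := hspx (hS x hxS hx0)
      have := (hli hxy).ne_zero 0
      exact this hxk
    have h1 := Submodule.finrank_sup_add_finrank_inf_eq S (LinearMap.ker φ)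
    rw [hdisj, finrank_bot] at h1
    have h2 := Submodule.finrank_le (S ⊔ LinearMap.ker φ)
    have h3 := LinearMap.finrank_range_add_finrank_ker φ
    omega

end NilpotentRoot

/-! ### Vector fields in a chart -/

noncomputable section ChartRep

variable {E : Type*} [NormedAddCommGroup E] [NormedSpace ℝ E]
  {M : Type*} [TopologicalSpace M] [ChartedSpace E M] [IsManifold 𝓘(ℝ, E) ∞ M]

/-- The coordinate isomorphism from the tangent space at `y` to the model space given by the chart
at `x₀`. -/
def tangentCoord (E : Type*) [NormedAddCommGroup E] [NormedSpace ℝ E] {M : Type*}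
    [TopologicalSpace M] [ChartedSpace E M] [IsManifold 𝓘(ℝ, E) ∞ M] (x₀ y : M) : TangentSpace 𝓘(ℝ, E) y →L[ℝ] E :=
  (trivializationAt E (TangentSpace 𝓘(ℝ, E) : M → Type _) x₀).continuousLinearMapAt ℝ y

/-- The inverse of `tangentCoord`. -/
def tangentCoordSymm (E : Type*) [NormedAddCommGroup E] [NormedSpace ℝ E] {M : Type*}
    [TopologicalSpace M] [ChartedSpace E M] [IsManifold 𝓘(ℝ, E) ∞ M] (x₀ y : M) : E →L[ℝ] TangentSpace 𝓘(ℝ, E) y :=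
  (trivializationAt E (TangentSpace 𝓘(ℝ, E) : M → Type _) x₀).symmL ℝ y

/-- The expression of a vector field in the chart at `x₀`. -/
def chartRep (E : Type*) [NormedAddCommGroup E] [NormedSpace ℝ E] {M : Type*}
    [TopologicalSpace M] [ChartedSpace E M] [IsManifold 𝓘(ℝ, E) ∞ M] (x₀ : M) (V : Π x : M, TangentSpace 𝓘(ℝ, E) x) (z : E) : E :=
  tangentCoord E x₀ ((extChartAt 𝓘(ℝ, E) x₀).symm z) (V ((extChartAt 𝓘(ℝ, E) x₀).symm z))

variable {x₀ y : M}

lemma tangentCoordSymm_tangentCoord (hy : y ∈ (chartAt E x₀).source)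
    (v : TangentSpace 𝓘(ℝ, E) y) : tangentCoordSymm E x₀ y (tangentCoord E x₀ y v) = v :=
  Trivialization.symmL_continuousLinearMapAt _ hy v

lemma tangentCoord_tangentCoordSymm (hy : y ∈ (chartAt E x₀).source) (v : E) :
    tangentCoord E x₀ y (tangentCoordSymm E x₀ y v) = v :=
  Trivialization.continuousLinearMapAt_symmL _ hy v

lemma tangentCoord_eq_mfderiv (hy : y ∈ (chartAt E x₀).source) :
    tangentCoord E x₀ y = mfderiv 𝓘(ℝ, E) 𝓘(ℝ, E) (extChartAt 𝓘(ℝ, E) x₀) y := by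
  have : IsManifold 𝓘(ℝ, E) 1 M := .of_le (n := ∞) (by simp)
  exact TangentBundle.continuousLinearMapAt_trivializationAt hy

lemma hasMFDerivAt_extChartAt_symm {z : E} (hz : z ∈ (extChartAt 𝓘(ℝ, E) x₀).target) :
    HasMFDerivAt 𝓘(ℝ, E) 𝓘(ℝ, E) (extChartAt 𝓘(ℝ, E) x₀).symm z
      (tangentCoordSymm E x₀ ((extChartAt 𝓘(ℝ, E) x₀).symm z)) := by
  have : IsManifold 𝓘(ℝ, E) 1 M := .of_le (n := ∞) (by simp)
  have hy : (extChartAt 𝓘(ℝ, E) x₀).symm z ∈ (chartAt E x₀).source := by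
    rw [← extChartAt_source 𝓘(ℝ, E)]; exact (extChartAt 𝓘(ℝ, E) x₀).map_target hz
  have h1 := TangentBundle.symmL_trivializationAt (I := 𝓘(ℝ, E)) hy
  rw [modelWithCornersSelf_coe, Set.range_id, mfderivWithin_univ] at h1
  have h2 : MDifferentiableAt 𝓘(ℝ, E) 𝓘(ℝ, E) (extChartAt 𝓘(ℝ, E) x₀).symm z :=
    ((contMDiffOn_extChartAt_symm (n := ∞) x₀).contMDiffAt
      ((isOpen_extChartAt_target x₀).mem_nhds hz)).mdifferentiableAt (by simp)
  have h3 := h2.hasMFDerivAt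
  rw [(extChartAt 𝓘(ℝ, E) x₀).right_inv hz] at h1
  rw [← h1] at h3
  exact h3

lemma contMDiffAt_iff_tangentCoord {n : WithTop ℕ∞} (hn : n ≤ ∞)
    {V : Π x : M, TangentSpace 𝓘(ℝ, E) x} (hy : y ∈ (chartAt E x₀).source) :
    CMDiffAt n (T% V) y ↔ CMDiffAt n (fun z ↦ tangentCoord E x₀ z (V z)) y := by
  have : IsManifold 𝓘(ℝ, E) (n + 1) M := .of_le (n := ∞) (by
    calc n + 1 ≤ ∞ + 1 := by gcongr
      _ = ∞ := rfl)
  set t := trivializationAt E (TangentSpace 𝓘(ℝ, E) : M → Type _) x₀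
  have hyt : y ∈ t.baseSet := hy
  have : ContMDiffVectorBundle n E (TangentSpace 𝓘(ℝ, E) : M → Type _) 𝓘(ℝ, E) :=
    TangentBundle.contMDiffVectorBundle
  rw [t.contMDiffAt_section_iff hyt]
  refine Filter.EventuallyEq.contMDiffAt_iff ?_
  filter_upwards [t.open_baseSet.mem_nhds hyt] with z hz
  exact (t.continuousLinearMapAt_apply_of_mem (R := ℝ) hz (V z)).symm

lemma contDiffAt_comp_extChartAt_symm {F : Type*} [NormedAddCommGroup F] [NormedSpace ℝ F]
    {n : WithTop ℕ∞} (hn : n ≤ ∞) {f : M → F} (hy : y ∈ (chartAt E x₀).source)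
    (hf : CMDiffAt n f y) :
    ContDiffAt ℝ n (fun z ↦ f ((extChartAt 𝓘(ℝ, E) x₀).symm z)) (extChartAt 𝓘(ℝ, E) x₀ y) := by
  have hy' : y ∈ (extChartAt 𝓘(ℝ, E) x₀).source := by rwa [extChartAt_source]
  rw [← contMDiffAt_iff_contDiffAt]
  have h1 : CMDiffAt n (extChartAt 𝓘(ℝ, E) x₀).symm (extChartAt 𝓘(ℝ, E) x₀ y) :=
    ((contMDiffOn_extChartAt_symm (n := ∞) x₀).contMDiffAt
      ((isOpen_extChartAt_target x₀).mem_nhds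
        ((extChartAt 𝓘(ℝ, E) x₀).map_source hy'))).of_le hn
  refine ContMDiffAt.comp _ ?_ h1
  rwa [(extChartAt 𝓘(ℝ, E) x₀).left_inv hy']

lemma contDiffAt_chartRep {n : WithTop ℕ∞} (hn : n ≤ ∞) {V : Π x : M, TangentSpace 𝓘(ℝ, E) x}
    (hy : y ∈ (chartAt E x₀).source) (hV : CMDiffAt n (T% V) y) :
    ContDiffAt ℝ n (chartRep E x₀ V) (extChartAt 𝓘(ℝ, E) x₀ y) :=
  contDiffAt_comp_extChartAt_symm (f := fun z ↦ tangentCoord E x₀ z (V z)) hn hy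
    ((contMDiffAt_iff_tangentCoord hn hy).1 hV)

lemma chartRep_extChartAt (V : Π x : M, TangentSpace 𝓘(ℝ, E) x)
    (hy : y ∈ (chartAt E x₀).source) :
    chartRep E x₀ V (extChartAt 𝓘(ℝ, E) x₀ y) = tangentCoord E x₀ y (V y) := by
  have hy' : y ∈ (extChartAt 𝓘(ℝ, E) x₀).source := by rwa [extChartAt_source]
  rw [chartRep, (extChartAt 𝓘(ℝ, E) x₀).left_inv hy']

lemma eventually_mem_chart_source (hy : y ∈ (chartAt E x₀).source) :
    ∀ᶠ z in 𝓝 y, z ∈ (chartAt E x₀).source :=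
  (chartAt E x₀).open_source.mem_nhds hy

lemma mpullback_extChartAt_apply (W : Π z : E, TangentSpace 𝓘(ℝ, E) z)
    (hy : y ∈ (chartAt E x₀).source) :
    mpullback 𝓘(ℝ, E) 𝓘(ℝ, E) (extChartAt 𝓘(ℝ, E) x₀) W y =
      tangentCoordSymm E x₀ y (W (extChartAt 𝓘(ℝ, E) x₀ y)) := by
  have : IsManifold 𝓘(ℝ, E) 1 M := .of_le (n := ∞) (by simp)
  rw [mpullback_apply]
  have hinv : (mfderiv 𝓘(ℝ, E) 𝓘(ℝ, E) (extChartAt 𝓘(ℝ, E) x₀) y).inverse =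
      tangentCoordSymm E x₀ y := by
    rw [← tangentCoord_eq_mfderiv hy]
    have h1 : (tangentCoord E x₀ y).comp (tangentCoordSymm E x₀ y) = .id ℝ E :=
      ContinuousLinearMap.ext (tangentCoord_tangentCoordSymm hy)
    have h2 : (tangentCoordSymm E x₀ y).comp (tangentCoord E x₀ y) = .id ℝ _ :=
      ContinuousLinearMap.ext (tangentCoordSymm_tangentCoord hy)
    exact ContinuousLinearMap.inverse_eq h1 h2
  rw [hinv]
  rfl

/-- The Lie bracket of vector fields is computed in any chart. -/
lemma tangentCoord_mlieBracket [CompleteSpace E] {V W : Π x : M, TangentSpace 𝓘(ℝ, E) x}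
    (hy : y ∈ (chartAt E x₀).source) (hV : CMDiffAt 1 (T% V) y) (hW : CMDiffAt 1 (T% W) y) :
    tangentCoord E x₀ y (mlieBracket 𝓘(ℝ, E) V W y) =
      lieBracket ℝ (chartRep E x₀ V) (chartRep E x₀ W) (extChartAt 𝓘(ℝ, E) x₀ y) := by
  have : IsManifold 𝓘(ℝ, E) (minSmoothness ℝ 3) M := by
    rw [minSmoothness_of_isRCLikeNormedField]; exact .of_le (n := ∞) (by exact ENat.LEInfty.out)
  -- Near `y` each field is the pullback of its chart expression, so naturality of the bracket under
  -- pullback applies.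
  have hrep (V : Π x : M, TangentSpace 𝓘(ℝ, E) x) :
      V =ᶠ[𝓝 y] (mpullback 𝓘(ℝ, E) 𝓘(ℝ, E) (extChartAt 𝓘(ℝ, E) x₀)
        (fun z : E ↦ (chartRep E x₀ V z : TangentSpace 𝓘(ℝ, E) z)) :
          Π x : M, TangentSpace 𝓘(ℝ, E) x) := by
    filter_upwards [eventually_mem_chart_source hy] with z hz
    refine Eq.trans ?_ (mpullback_extChartAt_apply (chartRep E x₀ V) hz).symm
    rw [chartRep_extChartAt _ hz, tangentCoordSymm_tangentCoord hz]
  have hd {V : Π x : M, TangentSpace 𝓘(ℝ, E) x} (hV : CMDiffAt 1 (T% V) y) :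
      MDifferentiableAt 𝓘(ℝ, E) 𝓘(ℝ, E).tangent
        (fun z : E ↦ (TotalSpace.mk' E z (chartRep E x₀ V z) : TangentBundle 𝓘(ℝ, E) E))
        (extChartAt 𝓘(ℝ, E) x₀ y) := by
    refine ContMDiffAt.mdifferentiableAt (n := 1) ?_ (by simp)
    exact contMDiffAt_vectorSpace_iff_contDiffAt.2 (contDiffAt_chartRep (by simp) hy hV)
  have hE (V W : Π z : E, TangentSpace 𝓘(ℝ, E) z) :
      mlieBracket 𝓘(ℝ, E) V W = lieBracket ℝ V W := by
    rw [← mlieBracketWithin_univ]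
    exact mlieBracketWithin_eq_lieBracketWithin.trans lieBracketWithin_univ
  have h1 := mpullback_mlieBracket (I := 𝓘(ℝ, E)) (I' := 𝓘(ℝ, E)) (n := ∞) (hd hV) (hd hW)
    (contMDiffAt_extChartAt' hy) (by
      rw [minSmoothness_of_isRCLikeNormedField]; exact ENat.LEInfty.out)
  rw [(hrep V).mlieBracket_vectorField_eq (hrep W), ← h1]
  refine (congrArg (tangentCoord E x₀ y) (mpullback_extChartAt_apply _ hy)).trans ?_
  exact (tangentCoord_tangentCoordSymm hy _).trans (congrFun (hE _ _) _)

lemma mvfderiv_eq_fderiv {f : M → ℝ} (hy : y ∈ (chartAt E x₀).source) (hf : MDiffAt f y)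
    (v : TangentSpace 𝓘(ℝ, E) y) :
    mvfderiv 𝓘(ℝ, E) f y v = fderiv ℝ (fun z ↦ f ((extChartAt 𝓘(ℝ, E) x₀).symm z))
      (extChartAt 𝓘(ℝ, E) x₀ y) (tangentCoord E x₀ y v) := by
  have hy' : y ∈ (extChartAt 𝓘(ℝ, E) x₀).source := by rwa [extChartAt_source]
  have hsym := hasMFDerivAt_extChartAt_symm ((extChartAt 𝓘(ℝ, E) x₀).map_source hy')
  set y' := (extChartAt 𝓘(ℝ, E) x₀).symm (extChartAt 𝓘(ℝ, E) x₀ y) with hy''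
  have hyy : y' = y := (extChartAt 𝓘(ℝ, E) x₀).left_inv hy'
  have hf' : HasMFDerivAt 𝓘(ℝ, E) 𝓘(ℝ, ℝ) f y' (mfderiv 𝓘(ℝ, E) 𝓘(ℝ, ℝ) f y') := by
    rw [hyy]
    exact hf.hasMFDerivAt
  obtain ⟨L, hL, h⟩ : ∃ L : E →L[ℝ] ℝ,
      (∀ w, L w = mfderiv 𝓘(ℝ, E) 𝓘(ℝ, ℝ) f y' (tangentCoordSymm E x₀ y' w)) ∧
      HasFDerivAt (fun z ↦ f ((extChartAt 𝓘(ℝ, E) x₀).symm z)) L (extChartAt 𝓘(ℝ, E) x₀ y) :=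
    ⟨_, fun _ ↦ rfl, HasMFDerivAt.hasFDerivAt (hf'.comp _ hsym)⟩
  rw [h.fderiv, hL]
  -- `y'` equals `y` only propositionally and the tangent spaces depend on the point. The identity
  -- is generalized over the point before substitution.
  have key : ∀ w, w = y → mfderiv 𝓘(ℝ, E) 𝓘(ℝ, ℝ) f w (tangentCoordSymm E x₀ w (tangentCoord E x₀ y v))
      = mvfderiv 𝓘(ℝ, E) f y v := by
    rintro _ rfl
    rw [tangentCoordSymm_tangentCoord hy]
    rfl
  exact (key _ hyy).symm

/-- Differentiation along `[X, Y]` is the commutator of differentiations along `X` and `Y`. -/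
lemma mvfderiv_mlieBracket [CompleteSpace E] {f : M → ℝ} {X Y : Π x : M, TangentSpace 𝓘(ℝ, E) x}
    (hf : ∀ᶠ z in 𝓝 y, CMDiffAt ∞ f z) (hX : CMDiffAt ∞ (T% X) y) (hY : CMDiffAt ∞ (T% Y) y)
    (hXf : MDiffAt (fun z ↦ mvfderiv 𝓘(ℝ, E) f z (X z)) y)
    (hYf : MDiffAt (fun z ↦ mvfderiv 𝓘(ℝ, E) f z (Y z)) y) :
    mvfderiv 𝓘(ℝ, E) f y (mlieBracket 𝓘(ℝ, E) X Y y) =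
      mvfderiv 𝓘(ℝ, E) (fun z ↦ mvfderiv 𝓘(ℝ, E) f z (Y z)) y (X y) -
        mvfderiv 𝓘(ℝ, E) (fun z ↦ mvfderiv 𝓘(ℝ, E) f z (X z)) y (Y y) := by
  have hy := mem_chart_source E y
  have hy' := mem_extChartAt_source (I := 𝓘(ℝ, E)) y
  have hfy := hf.self_of_nhds
  have hin {Z : Π x : M, TangentSpace 𝓘(ℝ, E) x} :
      (fun z ↦ (fun z ↦ mvfderiv 𝓘(ℝ, E) f z (Z z)) ((extChartAt 𝓘(ℝ, E) y).symm z))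
        =ᶠ[𝓝 (extChartAt 𝓘(ℝ, E) y y)]
      fun z ↦ fderiv ℝ (fun z ↦ f ((extChartAt 𝓘(ℝ, E) y).symm z)) z (chartRep E y Z z) := by
    have hc := (continuousAt_extChartAt_symm (I := 𝓘(ℝ, E)) y).tendsto
    rw [extChartAt_to_inv] at hc
    filter_upwards [hc.eventually (hf.and (eventually_mem_chart_source hy)),
      (isOpen_extChartAt_target y).mem_nhds ((extChartAt 𝓘(ℝ, E) y).map_source hy')] with z hz hzt
    rw [mvfderiv_eq_fderiv hz.2 (hz.1.mdifferentiableAt (by simp)),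
      (extChartAt 𝓘(ℝ, E) y).right_inv hzt]
    rfl
  rw [mvfderiv_eq_fderiv hy (hfy.mdifferentiableAt (by simp)), mvfderiv_eq_fderiv hy hXf,
    mvfderiv_eq_fderiv hy hYf, hin.fderiv_eq, hin.fderiv_eq,
    tangentCoord_mlieBracket hy (hX.of_le (by simp)) (hY.of_le (by simp)),
    ← chartRep_extChartAt X hy, ← chartRep_extChartAt Y hy]
  exact fderiv_apply_lieBracket (n := ∞) (contDiffAt_comp_extChartAt_symm le_rfl hy hfy)
    (by
      rw [minSmoothness_of_isRCLikeNormedField]; exact ENat.LEInfty.out)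
    ((contDiffAt_chartRep le_rfl hy hY).differentiableAt (by simp))
    ((contDiffAt_chartRep le_rfl hy hX).differentiableAt (by simp))

end ChartRep

/-! ### Vector fields which are smooth near a point -/

noncomputable section SmoothNear

variable {E : Type*} [NormedAddCommGroup E] [NormedSpace ℝ E]
  {M : Type*} [TopologicalSpace M] [ChartedSpace E M] [IsManifold 𝓘(ℝ, E) ∞ M]

/-- The vector field `X` is smooth at all points near `y`. -/
def IsSmoothNear (X : Π x : M, TangentSpace 𝓘(ℝ, E) x) (y : M) : Prop :=
  ∀ᶠ z in 𝓝 y, CMDiffAt ∞ (T% X) z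

namespace IsSmoothNear

variable {X Y : Π x : M, TangentSpace 𝓘(ℝ, E) x} {y : M}

lemma contMDiffAt (h : IsSmoothNear X y) : CMDiffAt ∞ (T% X) y := h.self_of_nhds

lemma mdifferentiableAt (h : IsSmoothNear X y) : MDiffAt (T% X) y :=
  h.contMDiffAt.mdifferentiableAt (by simp)

lemma eventually (h : IsSmoothNear X y) : ∀ᶠ z in 𝓝 y, IsSmoothNear X z :=
  eventually_eventually_nhds.2 h

lemma congr (h : IsSmoothNear X y) (hXY : X =ᶠ[𝓝 y] Y) : IsSmoothNear Y y := by
  filter_upwards [h, eventually_eventually_nhds.2 hXY] with z hz hz'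
  exact hz.congr_of_eventuallyEq (hz'.mono fun w hw ↦ by simp [hw])

lemma add (hX : IsSmoothNear X y) (hY : IsSmoothNear Y y) : IsSmoothNear (X + Y) y := by
  filter_upwards [hX, hY] with z hz hz'
  exact hz.add_section hz'

lemma smul {f : M → ℝ} (hf : ∀ᶠ z in 𝓝 y, CMDiffAt ∞ f z) (hX : IsSmoothNear X y) :
    IsSmoothNear (f • X) y := by
  filter_upwards [hX, hf] with z hz hz'
  exact hz'.smul_section hz

lemma sum {ι : Type*} {s : Finset ι} {X : ι → Π x : M, TangentSpace 𝓘(ℝ, E) x}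
    (hX : ∀ i ∈ s, IsSmoothNear (X i) y) : IsSmoothNear (∑ i ∈ s, X i) y := by
  classical
  induction s using Finset.induction_on with
  | empty =>
    refine Filter.Eventually.of_forall fun z ↦ ?_
    exact contMDiffAt_zeroSection ℝ (TangentSpace 𝓘(ℝ, E) : M → Type _)
  | insert a s ha ih =>
    rw [Finset.sum_insert ha]
    exact (hX a (by simp)).add (ih fun i hi ↦ hX i (by simp [hi]))

lemma mlieBracket [CompleteSpace E] (hX : IsSmoothNear X y) (hY : IsSmoothNear Y y) :
    IsSmoothNear (mlieBracket 𝓘(ℝ, E) X Y) y := by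
  have : IsManifold 𝓘(ℝ, E) (minSmoothness ℝ 2) M := by
    rw [minSmoothness_of_isRCLikeNormedField]; infer_instance
  have : IsManifold 𝓘(ℝ, E) (((⊤ : ℕ∞) : WithTop ℕ∞) + 1) M := by
    simpa using (inferInstance : IsManifold 𝓘(ℝ, E) ∞ M)
  filter_upwards [hX, hY] with z hz hz'
  exact ContMDiffAt.mlieBracket_vectorField (m := ⊤) (n := ⊤) hz hz' (by
      rw [minSmoothness_of_isRCLikeNormedField]; simp)

end IsSmoothNear

variable {x₀ y : M}

lemma isSmoothNear_iff_tangentCoord {X : Π x : M, TangentSpace 𝓘(ℝ, E) x}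
    (hy : y ∈ (chartAt E x₀).source) :
    IsSmoothNear X y ↔ ∀ᶠ z in 𝓝 y, CMDiffAt ∞ (fun z ↦ tangentCoord E x₀ z (X z)) z := by
  refine Filter.eventually_congr ?_
  filter_upwards [eventually_mem_chart_source hy] with z hz
  exact contMDiffAt_iff_tangentCoord le_rfl hz

lemma isSmoothNear_tangentCoordSymm {f : M → E} (hy : y ∈ (chartAt E x₀).source)
    (hf : ∀ᶠ z in 𝓝 y, CMDiffAt ∞ f z) :
    IsSmoothNear (fun z ↦ tangentCoordSymm E x₀ z (f z)) y := by
  rw [isSmoothNear_iff_tangentCoord hy]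
  filter_upwards [hf, eventually_eventually_nhds.2 (eventually_mem_chart_source hy)] with z hz hz'
  exact hz.congr_of_eventuallyEq (hz'.mono fun w hw ↦ tangentCoord_tangentCoordSymm hw _)

lemma isSmoothNear_coordField (hy : y ∈ (chartAt E x₀).source) (v : TangentSpace 𝓘(ℝ, E) x₀) :
    IsSmoothNear (PseudoRiemannianMetric.coordField x₀ v) y :=
  isSmoothNear_tangentCoordSymm hy (Filter.Eventually.of_forall fun _ ↦ contMDiffAt_const)

lemma mvfderiv_congr {f f' : M → ℝ} (h : f =ᶠ[𝓝 y] f') :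
    mvfderiv 𝓘(ℝ, E) f y = mvfderiv 𝓘(ℝ, E) f' y := by
  have := h.mfderiv_eq (I := 𝓘(ℝ, E)) (I' := 𝓘(ℝ, ℝ))
  ext v
  exact DFunLike.congr_fun this v

/-- An operation on vector fields which is additive, linear over smooth functions and local depends
only on the values of the vector fields. -/
lemma eq_of_tensorial [FiniteDimensional ℝ E] {W : Type*} [AddCommGroup W] [Module ℝ W]
    {Φ : (Π x : M, TangentSpace 𝓘(ℝ, E) x) → W}
    (hadd : ∀ X Y, IsSmoothNear X y → IsSmoothNear Y y → Φ (X + Y) = Φ X + Φ Y)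
    (hsmul : ∀ (f : M → ℝ) X, (∀ᶠ z in 𝓝 y, CMDiffAt ∞ f z) → IsSmoothNear X y →
      Φ (f • X) = f y • Φ X)
    (hloc : ∀ X Y : Π x : M, TangentSpace 𝓘(ℝ, E) x, IsSmoothNear X y → X =ᶠ[𝓝 y] Y → Φ X = Φ Y)
    {X Y : Π x : M, TangentSpace 𝓘(ℝ, E) x} (hX : IsSmoothNear X y) (hY : IsSmoothNear Y y)
    (hXY : X y = Y y) : Φ X = Φ Y := by
  classical
  set b := Module.finBasis ℝ E
  have hy := mem_chart_source E y
  let s (i) : Π x : M, TangentSpace 𝓘(ℝ, E) x := fun z ↦ tangentCoordSymm E y z (b i)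
  have hs (i) : IsSmoothNear (s i) y :=
    isSmoothNear_tangentCoordSymm hy (Filter.Eventually.of_forall fun _ ↦ contMDiffAt_const)
  -- Expanding `X` in a local frame, `Φ X` involves only the coefficients at `y`.
  have key (X : Π x : M, TangentSpace 𝓘(ℝ, E) x) (hX : IsSmoothNear X y) :
      Φ X = ∑ i, b.repr (tangentCoord E y y (X y)) i • Φ (s i) := by
    let c (i) : M → ℝ := fun z ↦ b.repr (tangentCoord E y z (X z)) i
    have hc (i) : ∀ᶠ z in 𝓝 y, CMDiffAt ∞ (c i) z := by
      filter_upwards [(isSmoothNear_iff_tangentCoord hy).1 hX] with z hz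
      exact (LinearMap.toContinuousLinearMap (b.coord i)).contDiff.contMDiff.contMDiffAt.comp z hz
    have hsum (t : Finset (Fin (finrank ℝ E))) :
        Φ (∑ i ∈ t, c i • s i) = ∑ i ∈ t, c i y • Φ (s i) := by
      induction t using Finset.induction_on with
      | empty =>
        have := hsmul (fun _ ↦ 0) X (Filter.Eventually.of_forall fun _ ↦ contMDiffAt_const) hX
        have h0 : (fun _ ↦ 0 : M → ℝ) • X = 0 := by ext z; simp
        rw [h0, zero_smul] at this
        simpa using this
      | insert a t ha ih =>
        rw [Finset.sum_insert ha, Finset.sum_insert ha,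
          hadd _ _ ((hs a).smul (hc a)) (.sum fun i _ ↦ (hs i).smul (hc i)),
          hsmul _ _ (hc a) (hs a), ih]
    rw [← hsum]
    refine hloc _ _ hX ?_
    filter_upwards [eventually_mem_chart_source hy] with z hz
    have h1 := congrArg (tangentCoordSymm E y z) (b.sum_repr (tangentCoord E y z (X z)))
    rw [tangentCoordSymm_tangentCoord hz] at h1
    refine h1.symm.trans ?_
    simp only [map_sum, map_smul, Finset.sum_apply, Pi.smul_apply', c, s]
  rw [key X hX, key Y hY, hXY]

end SmoothNear

/-! ### Symmetries of the curvature of a pseudo-Riemannian metric -/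

noncomputable section Curvature

namespace PseudoRiemannianMetric

variable {E : Type*} [NormedAddCommGroup E] [NormedSpace ℝ E] [FiniteDimensional ℝ E]
  {M : Type*} [TopologicalSpace M] [ChartedSpace E M] [IsManifold 𝓘(ℝ, E) ∞ M]
  (g : PseudoRiemannianMetric E M)

/-- The vector field `∇_X Y`. -/
def nabla (X Y : Π x : M, TangentSpace 𝓘(ℝ, E) x) (x : M) : TangentSpace 𝓘(ℝ, E) x :=
  g.leviCivita Y x (X x)

variable {X X' Y Z W : Π x : M, TangentSpace 𝓘(ℝ, E) x} {y : M}

lemma curvatureField_eq (X Y Z : Π x : M, TangentSpace 𝓘(ℝ, E) x) (y : M) :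
    g.curvatureField X Y Z y = g.nabla X (g.nabla Y Z) y - g.nabla Y (g.nabla X Z) y -
      g.nabla (mlieBracket 𝓘(ℝ, E) X Y) Z y := rfl

lemma isSmoothNear_nabla (hX : IsSmoothNear X y) (hY : IsSmoothNear Y y) :
    IsSmoothNear (g.nabla X Y) y := by
  obtain ⟨U, h, hU, hyU⟩ := mem_nhds_iff.1 (Filter.Eventually.and hX hY)
  filter_upwards [hU.mem_nhds hyU] with z hz
  exact g.contMDiffAt_leviCivita hU hz (fun w hw ↦ (h hw).1.contMDiffWithinAt)
    (fun w hw ↦ (h hw).2.contMDiffWithinAt)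

lemma nabla_add_left : g.nabla (X + X') Y = g.nabla X Y + g.nabla X' Y := by
  ext z; simp [nabla]

lemma nabla_smul_left (f : M → ℝ) : g.nabla (f • X) Y = f • g.nabla X Y := by
  ext z; simp [nabla]

lemma nabla_add_right (hY : MDiffAt (T% Y) y) (hZ : MDiffAt (T% Z) y) :
    g.nabla X (Y + Z) y = g.nabla X Y y + g.nabla X Z y := by
  simp [nabla, g.leviCivita.isCovariantDerivativeOnUniv.add hY hZ]

lemma nabla_smul_right {f : M → ℝ} (hf : MDiffAt f y) (hY : MDiffAt (T% Y) y) :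
    g.nabla X (f • Y) y = f y • g.nabla X Y y + mvfderiv 𝓘(ℝ, E) f y (X y) • Y y := by
  simp [nabla, g.leviCivita.isCovariantDerivativeOnUniv.leibniz hY hf]

lemma nabla_congr_right (hY : MDiffAt (T% Y) y) (hZ : MDiffAt (T% Z) y) (h : Y =ᶠ[𝓝 y] Z) :
    g.nabla X Y y = g.nabla X Z y := by
  rw [nabla, g.leviCivita.isCovariantDerivativeOnUniv.congr_of_eventuallyEq hY hZ
    Filter.univ_mem h]
  rfl

lemma nabla_sub_right (hY : MDiffAt (T% Y) y) (hZ : MDiffAt (T% Z) y) :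
    g.nabla X (Y - Z) y = g.nabla X Y y - g.nabla X Z y := by
  have h : Y = (Y - Z) + Z := by simp
  have hs : MDiffAt (T% (Y - Z)) y := mdifferentiableAt_sub_section hY hZ
  conv_rhs => rw [h]
  rw [g.nabla_add_right hs hZ, add_sub_cancel_right]

lemma nabla_sub_nabla (hX : MDiffAt (T% X) y) (hY : MDiffAt (T% Y) y) :
    g.nabla X Y y - g.nabla Y X y = mlieBracket 𝓘(ℝ, E) X Y y :=
  g.leviCivita_torsion_free hX hY

lemma mvfderiv_pairing (hX : MDiffAt (T% X) y) (hY : MDiffAt (T% Y) y) (hZ : MDiffAt (T% Z) y) :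
    mvfderiv 𝓘(ℝ, E) (g.pairing Y Z) y (X y) =
      g.pairing (g.nabla X Y) Z y + g.pairing Y (g.nabla X Z) y :=
  g.leviCivita_metric hX hY hZ

lemma curvatureField_swap (X Y Z : Π x : M, TangentSpace 𝓘(ℝ, E) x) (y : M) :
    g.curvatureField X Y Z y = -g.curvatureField Y X Z y := by
  have h : g.nabla (mlieBracket 𝓘(ℝ, E) X Y) Z y = -g.nabla (mlieBracket 𝓘(ℝ, E) Y X) Z y := by
    rw [mlieBracket_swap]; simp [nabla]
  rw [curvatureField_eq, curvatureField_eq, h]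
  abel

/-- Expand `[X,Y] g(Z,W) = X Y g(Z,W) - Y X g(Z,W)` by metric compatibility; the mixed terms `g(∇_X
Z, ∇_Y W)` cancel. -/
lemma pairing_curvatureField_skew (hX : IsSmoothNear X y) (hY : IsSmoothNear Y y)
    (hZ : IsSmoothNear Z y) (hW : IsSmoothNear W y) :
    g.pairing (g.curvatureField X Y Z) W y = -g.pairing (g.curvatureField X Y W) Z y := by
  have hD {X Y : Π x : M, TangentSpace 𝓘(ℝ, E) x} (hX : IsSmoothNear X y)
      (hY : IsSmoothNear Y y) :
      (fun z ↦ mvfderiv 𝓘(ℝ, E) (g.pairing Z W) z (X z)) =ᶠ[𝓝 y]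
        g.pairing (g.nabla X Z) W + g.pairing Z (g.nabla X W) := by
    filter_upwards [hX.eventually, hZ.eventually, hW.eventually] with z h1 h2 h3
    exact g.mvfderiv_pairing h1.mdifferentiableAt h2.mdifferentiableAt h3.mdifferentiableAt
  have hDD {X Y : Π x : M, TangentSpace 𝓘(ℝ, E) x} (hX : IsSmoothNear X y)
      (hY : IsSmoothNear Y y) :
      mvfderiv 𝓘(ℝ, E) (fun z ↦ mvfderiv 𝓘(ℝ, E) (g.pairing Z W) z (Y z)) y (X y) =
        g.pairing (g.nabla X (g.nabla Y Z)) W y + g.pairing (g.nabla Y Z) (g.nabla X W) y +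
        (g.pairing (g.nabla X Z) (g.nabla Y W) y + g.pairing Z (g.nabla X (g.nabla Y W)) y) := by
    have hYZ := (g.isSmoothNear_nabla hY hZ).mdifferentiableAt
    have hYW := (g.isSmoothNear_nabla hY hW).mdifferentiableAt
    rw [mvfderiv_congr (hD hY hX), mvfderiv_add (g.mdifferentiableAt_pairing hYZ hW.mdifferentiableAt)
      (g.mdifferentiableAt_pairing hZ.mdifferentiableAt hYW), add_apply,
      g.mvfderiv_pairing hX.mdifferentiableAt hYZ hW.mdifferentiableAt,
      g.mvfderiv_pairing hX.mdifferentiableAt hZ.mdifferentiableAt hYW]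
  have hd {X : Π x : M, TangentSpace 𝓘(ℝ, E) x} (hX : IsSmoothNear X y) :
      MDiffAt (fun z ↦ mvfderiv 𝓘(ℝ, E) (g.pairing Z W) z (X z)) y :=
    (contMDiffAt_mvfderiv_apply (g.contMDiffAt_pairing (n := ⊤) hZ.contMDiffAt hW.contMDiffAt)
      hX.contMDiffAt).mdifferentiableAt (by simp)
  have hZW : ∀ᶠ z in 𝓝 y, CMDiffAt ∞ (g.pairing Z W) z := by
    filter_upwards [hZ, hW] with z h1 h2 using g.contMDiffAt_pairing (n := ⊤) h1 h2
  have h1 := mvfderiv_mlieBracket hZW hX.contMDiffAt hY.contMDiffAt (hd hX) (hd hY)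
  rw [hDD hX hY, hDD hY hX, g.mvfderiv_pairing (hX.mlieBracket hY).mdifferentiableAt
    hZ.mdifferentiableAt hW.mdifferentiableAt] at h1
  simp only [pairing, curvatureField_eq, map_sub, sub_apply] at h1 ⊢
  simp only [g.symm y _ (Z y), g.symm y (g.nabla Y Z y)] at h1 ⊢
  linarith

/-- Vanishing torsion turns the cyclic sum into the Jacobi sum of iterated brackets. -/
lemma curvatureField_bianchi (hX : IsSmoothNear X y) (hY : IsSmoothNear Y y)
    (hZ : IsSmoothNear Z y) :
    g.curvatureField X Y Z y + g.curvatureField Y Z X y + g.curvatureField Z X Y y = 0 := by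
  have key {X Y Z : Π x : M, TangentSpace 𝓘(ℝ, E) x} (hX : IsSmoothNear X y)
      (hY : IsSmoothNear Y y) (hZ : IsSmoothNear Z y) :
      g.nabla X (g.nabla Y Z) y - g.nabla X (g.nabla Z Y) y -
        g.nabla (mlieBracket 𝓘(ℝ, E) Y Z) X y =
        mlieBracket 𝓘(ℝ, E) X (mlieBracket 𝓘(ℝ, E) Y Z) y := by
    have hYZ := (g.isSmoothNear_nabla hY hZ).mdifferentiableAt
    have hZY := (g.isSmoothNear_nabla hZ hY).mdifferentiableAt
    have hb := (hY.mlieBracket hZ).mdifferentiableAt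
    have h : g.nabla Y Z - g.nabla Z Y =ᶠ[𝓝 y] mlieBracket 𝓘(ℝ, E) Y Z := by
      filter_upwards [hY.eventually, hZ.eventually] with z h1 h2
      exact g.nabla_sub_nabla h1.mdifferentiableAt h2.mdifferentiableAt
    rw [← g.nabla_sub_right hYZ hZY,
      g.nabla_congr_right (mdifferentiableAt_sub_section hYZ hZY) hb h,
      g.nabla_sub_nabla hX.mdifferentiableAt hb]
  have : IsManifold 𝓘(ℝ, E) (minSmoothness ℝ 3) M := by
    rw [minSmoothness_of_isRCLikeNormedField]; exact .of_le (n := ∞) ENat.LEInfty.out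
  have hj {X : Π x : M, TangentSpace 𝓘(ℝ, E) x} (hX : IsSmoothNear X y) :
      CMDiffAt (minSmoothness ℝ 2) (T% X) y := hX.contMDiffAt.of_le (by
    rw [minSmoothness_of_isRCLikeNormedField]; exact ENat.LEInfty.out)
  have h1 := key hX hY hZ
  have h2 := key hY hZ hX
  have h3 := key hZ hX hY
  have h4 := leibniz_identity_mlieBracket_apply (hj hX) (hj hY) (hj hZ)
  rw [mlieBracket_swap_apply (V := mlieBracket 𝓘(ℝ, E) X Y),
    mlieBracket_swap (V := X) (W := Z)] at h4
  have h5 : mlieBracket 𝓘(ℝ, E) Y (-mlieBracket 𝓘(ℝ, E) Z X) y =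
      -mlieBracket 𝓘(ℝ, E) Y (mlieBracket 𝓘(ℝ, E) Z X) y := by
    have := mlieBracket_const_smul_right (I := 𝓘(ℝ, E)) (V := Y) (c := (-1 : ℝ))
      (hZ.mlieBracket hX).mdifferentiableAt
    simpa using this
  rw [h5, ← h1, ← h2, ← h3] at h4
  simp only [curvatureField_eq]
  rw [← sub_eq_zero] at h4
  rw [← h4]
  abel

/-- Skew-adjointness moves `Z` out of the derivatives into the metric, where only its value at `y`
enters. -/
lemma curvatureField_congr_third {Z' : Π x : M, TangentSpace 𝓘(ℝ, E) x} (hX : IsSmoothNear X y)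
    (hY : IsSmoothNear Y y) (hZ : IsSmoothNear Z y) (hZ' : IsSmoothNear Z' y) (h : Z y = Z' y) :
    g.curvatureField X Y Z y = g.curvatureField X Y Z' y := by
  refine g.ext_val fun w ↦ ?_
  have hw := isSmoothNear_coordField (mem_chart_source E y) w
  have h1 := g.pairing_curvatureField_skew hX hY hZ hw
  have h2 := g.pairing_curvatureField_skew hX hY hZ' hw
  simp only [pairing, coordField_self] at h1 h2
  rw [h1, h2, h]

lemma curvatureField_add_first (hX : IsSmoothNear X y) (hX' : IsSmoothNear X' y)
    (hZ : IsSmoothNear Z y) :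
    g.curvatureField (X + X') Y Z y = g.curvatureField X Y Z y + g.curvatureField X' Y Z y := by
  have hb : mlieBracket 𝓘(ℝ, E) (X + X') Y y =
      mlieBracket 𝓘(ℝ, E) X Y y + mlieBracket 𝓘(ℝ, E) X' Y y :=
    mlieBracket_add_left hX.mdifferentiableAt hX'.mdifferentiableAt
  simp only [curvatureField_eq]
  rw [nabla_add_left, nabla_add_left, g.nabla_add_right
    (g.isSmoothNear_nabla hX hZ).mdifferentiableAt
    (g.isSmoothNear_nabla hX' hZ).mdifferentiableAt]
  simp only [nabla, hb, map_add, Pi.add_apply]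
  abel

/-- The derivative of `f` in `∇_Y (f ∇_X Z)` cancels against the one in `[f X, Y]`. -/
lemma curvatureField_smul_first {f : M → ℝ} (hf : MDiffAt f y) (hX : IsSmoothNear X y)
    (hZ : IsSmoothNear Z y) :
    g.curvatureField (f • X) Y Z y = f y • g.curvatureField X Y Z y := by
  have hb : mlieBracket 𝓘(ℝ, E) (f • X) Y y = _ :=
    mlieBracket_smul_left hf hX.mdifferentiableAt
  simp only [curvatureField_eq]
  rw [nabla_smul_left, nabla_smul_left, g.nabla_smul_right hf
    (g.isSmoothNear_nabla hX hZ).mdifferentiableAt]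
  simp only [nabla, hb, map_add, Pi.smul_apply', map_smul, smul_sub, map_neg, neg_smul]
  abel

lemma curvatureField_congr_first (hX : IsSmoothNear X y) (hX' : IsSmoothNear X' y)
    (hZ : IsSmoothNear Z y) (h : X y = X' y) :
    g.curvatureField X Y Z y = g.curvatureField X' Y Z y := by
  refine eq_of_tensorial (Φ := fun X ↦ g.curvatureField X Y Z y)
    (fun X X' hX hX' ↦ g.curvatureField_add_first hX hX' hZ)
    (fun f X hf hX ↦ g.curvatureField_smul_first
      (hf.self_of_nhds.mdifferentiableAt (by simp)) hX hZ) (fun X X' hX h ↦ ?_) hX hX' h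
  have hX' := hX.congr h
  have hb : mlieBracket 𝓘(ℝ, E) X Y y = mlieBracket 𝓘(ℝ, E) X' Y y :=
    h.mlieBracket_vectorField_eq (Filter.EventuallyEq.refl _ _)
  simp only [curvatureField_eq]
  rw [g.nabla_congr_right (g.isSmoothNear_nabla hX hZ).mdifferentiableAt
    (g.isSmoothNear_nabla hX' hZ).mdifferentiableAt (h.mono fun z hz ↦ by
      change g.leviCivita Z z (X z) = g.leviCivita Z z (X' z); rw [hz])]
  simp only [nabla, hb, h.self_of_nhds]

/-- The curvature tensor is computed by any smooth extensions of the tangent vectors. -/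
lemma curvature_apply (hX : IsSmoothNear X y) (hY : IsSmoothNear Y y) (hZ : IsSmoothNear Z y) :
    g.curvature y (X y) (Y y) (Z y) = g.curvatureField X Y Z y := by
  have hc (v : TangentSpace 𝓘(ℝ, E) y) := isSmoothNear_coordField (mem_chart_source E y) v
  change g.curvatureField (coordField y (X y)) (coordField y (Y y)) (coordField y (Z y)) y = _
  rw [g.curvatureField_congr_first (hc _) hX (hc _) (coordField_self _ _),
    g.curvatureField_swap, g.curvatureField_congr_first (hc _) hY (hc _) (coordField_self _ _),
    ← g.curvatureField_swap, g.curvatureField_congr_third hX hY (hc _) hZ (coordField_self _ _)]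

lemma curvature_swap (y : M) (u v : TangentSpace 𝓘(ℝ, E) y) :
    g.curvature y u v = -g.curvature y v u := by
  ext w
  exact g.curvatureField_swap _ _ _ _

lemma curvature_skew (y : M) (u v w z : TangentSpace 𝓘(ℝ, E) y) :
    g.form y (g.curvature y u v w) z = -g.form y (g.curvature y u v z) w := by
  have hc (v : TangentSpace 𝓘(ℝ, E) y) := isSmoothNear_coordField (mem_chart_source E y) v
  have := g.pairing_curvatureField_skew (hc u) (hc v) (hc w) (hc z)
  simp only [pairing, coordField_self] at this
  exact this

lemma curvature_bianchi (y : M) (u v w : TangentSpace 𝓘(ℝ, E) y) :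
    g.curvature y u v w + g.curvature y v w u + g.curvature y w u v = 0 :=
  have hc (v : TangentSpace 𝓘(ℝ, E) y) := isSmoothNear_coordField (mem_chart_source E y) v
  g.curvatureField_bianchi (hc u) (hc v) (hc w)

lemma curvature_add_left (y : M) (u u' v : TangentSpace 𝓘(ℝ, E) y) :
    g.curvature y (u + u') v = g.curvature y u v + g.curvature y u' v := by
  have hc (v : TangentSpace 𝓘(ℝ, E) y) := isSmoothNear_coordField (mem_chart_source E y) v
  ext w
  have := g.curvatureField_add_first (Y := coordField y v) (hc u) (hc u') (hc w)
  rw [← coordField_add] at this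
  exact this

lemma curvature_smul_left (y : M) (c : ℝ) (u v : TangentSpace 𝓘(ℝ, E) y) :
    g.curvature y (c • u) v = c • g.curvature y u v := by
  have hc (v : TangentSpace 𝓘(ℝ, E) y) := isSmoothNear_coordField (mem_chart_source E y) v
  ext w
  have := g.curvatureField_smul_first (f := fun _ ↦ c) (Y := coordField y v)
    mdifferentiableAt_const (hc u) (hc w)
  change g.curvatureField (c • coordField y u) _ _ _ = _ at this
  rw [← coordField_smul] at this
  exact this

/-- The curvature tensor as a bilinear map. -/
def curvatureHom (y : M) : TangentSpace 𝓘(ℝ, E) y →ₗ[ℝ] TangentSpace 𝓘(ℝ, E) y →ₗ[ℝ]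
    Module.End ℝ (TangentSpace 𝓘(ℝ, E) y) :=
  LinearMap.mk₂ ℝ (g.curvature y) (g.curvature_add_left y) (g.curvature_smul_left y)
    (fun u v w ↦ by
      rw [curvature_swap, curvature_add_left, g.curvature_swap y v, g.curvature_swap y w]; abel)
    (fun c u v ↦ by rw [curvature_swap, curvature_smul_left, g.curvature_swap y v, smul_neg,
      neg_neg])

/-- The curvature tensor applied to smooth vector fields is a smooth function. -/
lemma contMDiffAt_curvature (hX : IsSmoothNear X y) (hY : IsSmoothNear Y y)
    (hZ : IsSmoothNear Z y) (hW : CMDiffAt ∞ (T% W) y) :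
    CMDiffAt ∞ (fun z ↦ g.val z (g.curvature z (X z) (Y z) (Z z)) (W z)) y := by
  have h : IsSmoothNear (fun z ↦ g.curvature z (X z) (Y z) (Z z)) y := by
    have h1 := g.isSmoothNear_nabla hX (g.isSmoothNear_nabla hY hZ)
    have h2 := g.isSmoothNear_nabla hY (g.isSmoothNear_nabla hX hZ)
    have h3 := g.isSmoothNear_nabla (hX.mlieBracket hY) hZ
    have h4 : IsSmoothNear (g.curvatureField X Y Z) y := by
      filter_upwards [h1, h2, h3] with z h1 h2 h3
      exact (h1.sub_section h2).sub_section h3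
    -- `curvature z` is defined through extensions in the chart at `z`, which vary with `z`.
    -- Tensoriality replaces them by the fixed fields `X`, `Y`, `Z`.
    refine h4.congr ?_
    filter_upwards [hX.eventually, hY.eventually, hZ.eventually] with z h1 h2 h3
    exact (g.curvature_apply h1 h2 h3).symm
  exact g.contMDiffAt_pairing (n := ⊤) h.contMDiffAt hW

end PseudoRiemannianMetric

end Curvature

/-! ### Pointwise properties of nilpotent roots of the curvature tensor -/

section PointwiseRoot

variable {V : Type*} [AddCommGroup V] [Module ℝ V] [FiniteDimensional ℝ V]
  {B : LinearMap.BilinForm ℝ V} {φ : Module.End ℝ V}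

/-- Diagonalize the symmetric form `B (φ v) w`. The basis vectors with nonzero diagonal entry have
images spanning `range φ`, so there are at least three. -/
lemma exists_orthogonal_triple (hB : ∀ v w, B v w = B w v) (hnd : B.Nondegenerate)
    (hφ : ∀ v w, B (φ v) w = B v (φ w)) (hrank : 3 ≤ finrank ℝ (LinearMap.range φ)) :
    ∃ e : Fin 3 → V, (∀ i, B (φ (e i)) (e i) ≠ 0) ∧ ∀ i j, i ≠ j → B (φ (e i)) (e j) = 0 := by
  classical
  have : Invertible (2 : ℝ) := invertibleOfNonzero two_ne_zero
  obtain ⟨v, hv⟩ := LinearMap.BilinForm.exists_orthogonal_basis (B := B ∘ₗ φ)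
    ⟨fun x y ↦ by simp [hφ x y, hB x]⟩
  have hv' : ∀ i j, i ≠ j → B (φ (v i)) (v j) = 0 := fun i j hij ↦ hv hij
  set s := Finset.univ.filter fun i ↦ B (φ (v i)) (v i) ≠ 0
  have hzero : ∀ i ∉ s, φ (v i) = 0 := fun i hi ↦ by
    refine hnd.1 _ fun w ↦ ?_
    have h0 : B (φ (v i)) = 0 := v.ext fun j ↦ by
      by_cases hij : i = j
      · subst hij; simpa [s] using hi
      · exact hv' i j hij
    simp [h0]
  have hle : LinearMap.range φ ≤ Submodule.span ℝ ((s.image fun i ↦ φ (v i) : Finset V) : Set V) := by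
    rw [LinearMap.range_eq_map, ← v.span_eq, Submodule.map_span, Submodule.span_le]
    rintro _ ⟨_, ⟨i, rfl⟩, rfl⟩
    by_cases hi : i ∈ s
    · exact Submodule.subset_span (by simpa using ⟨i, hi, rfl⟩)
    · rw [hzero i hi]; exact zero_mem _
  have hcard : 3 ≤ s.card :=
    (hrank.trans (Submodule.finrank_mono hle)).trans
      ((finrank_span_finset_le_card _).trans Finset.card_image_le)
  obtain ⟨t, hts, ht⟩ := Finset.exists_subset_card_eq hcard
  refine ⟨fun i ↦ v (t.equivFinOfCardEq ht |>.symm i), fun i ↦ ?_, fun i j hij ↦ hv' _ _ ?_⟩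
  · exact (Finset.mem_filter.1 (hts (t.equivFinOfCardEq ht |>.symm i).2)).2
  · simpa [Subtype.ext_iff] using hij

/-- If `φ v ≠ 0`, the vanishing of `R_φ(v, w)` makes every `φ w` a multiple of `φ v`, contradicting
the rank. -/
lemma mem_ker_of_curvatureOfEnd_eq_zero (hnd : B.Nondegenerate)
    (hrank : 2 ≤ finrank ℝ (LinearMap.range φ))
    {v : V} (hv : ∀ w, curvatureOfEnd B φ v w = 0) :
    φ v = 0 := by
  by_contra hne
  obtain ⟨z, hz⟩ : ∃ z, B (φ v) z ≠ 0 := by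
    by_contra! h
    exact hne (hnd.1 _ h)
  have hle : LinearMap.range φ ≤ Submodule.span ℝ {φ v} := by
    rintro _ ⟨w, rfl⟩
    have h : B (φ w) z • φ v - B (φ v) z • φ w = 0 := DFunLike.congr_fun (hv w) z
    refine Submodule.mem_span_singleton.2 ⟨(B (φ v) z)⁻¹ * B (φ w) z, ?_⟩
    rw [mul_smul, sub_eq_zero.1 h, smul_smul, inv_mul_cancel₀ hz, one_smul]
  have := Submodule.finrank_mono hle
  rw [finrank_span_singleton hne] at this
  omega

end PointwiseRoot

namespace PseudoRiemannianMetric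

variable {E : Type*} [NormedAddCommGroup E] [NormedSpace ℝ E] [FiniteDimensional ℝ E]
  {M : Type*} [TopologicalSpace M] [ChartedSpace E M] [IsManifold 𝓘(ℝ, E) ∞ M]
  {g : PseudoRiemannianMetric E M} {p : ℕ} {ε : ℝ} {y : M}
  {φ : TangentSpace 𝓘(ℝ, E) y →L[ℝ] TangentSpace 𝓘(ℝ, E) y}

lemma form_comm (g : PseudoRiemannianMetric E M) (y : M) (v w : TangentSpace 𝓘(ℝ, E) y) :
    g.form y v w = g.form y w v := g.symm y v w

lemma HasSignature.finrank_eq (hsig : g.HasSignature p p) (y : M) :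
    finrank ℝ (TangentSpace 𝓘(ℝ, E) y) = 2 * p := by
  have h := QuadraticForm.sigPos_add_sigNeg_add_radical (Q := (g.form y).toQuadraticMap)
  have hrad : (g.form y).toQuadraticMap.radical = ⊥ := by
    rw [Submodule.eq_bot_iff]
    intro v hv
    rw [QuadraticMap.mem_radical_iff'] at hv
    refine g.nondegenerate y v fun w ↦ ?_
    have h1 := hv.1
    have h2 := hv.2 w
    simp only [LinearMap.BilinMap.toQuadraticMap_apply, map_add, LinearMap.add_apply,
      form_apply, g.symm y w v] at h1 h2
    linarith
  rw [hrad, finrank_bot, (hsig y).1, (hsig y).2] at h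
  omega

lemma exists_isNilpotentCurvatureRoot (hp : 5 ≤ p) (hsig : g.HasSignature p p)
    (hg : g.IsSpacelikeRankTwoNilpotentJordanIP) (y : M) :
    ∃ ε : ℝ, (ε = 1 ∨ ε = -1) ∧ ∃ φ, g.IsNilpotentCurvatureRoot ε y φ := by
  obtain ⟨S, hS, hpos⟩ := exists_finrank_eq_sigPos_and_posDef (g.form y).toQuadraticMap
  rw [(hsig y).2] at hS
  obtain ⟨ε, hε, φ, h1, h2, h3⟩ := exists_nilpotent_curvature_root (g.form_comm y)
    (g.form_nondegenerate y) (g.curvatureHom y) (g.curvature_swap y) (g.curvature_skew y)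
    (fun u v w ↦ g.curvature_bianchi y u v w) (S := S)
    (fun v hv hne ↦ hpos ⟨v, hv⟩ (by simpa using hne)) (by omega)
    (by rw [hsig.finrank_eq, hS]) (hg y).1 (hg y).2.1 (hg y).2.2
  exact ⟨ε, hε, LinearMap.toContinuousLinearMap φ, h1, h2, h3⟩

namespace IsNilpotentCurvatureRoot

lemma finrank_range (h : g.IsNilpotentCurvatureRoot ε y φ) (hsig : g.HasSignature p p) :
    finrank ℝ (LinearMap.range φ.toLinearMap) = p := by
  have h1 := φ.toLinearMap.finrank_range_add_finrank_ker
  rw [h.2.1, hsig.finrank_eq] at h1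
  omega

/-- The kernel of a root of the curvature tensor is the nullity space of the curvature tensor. -/
lemma mem_range_iff (h : g.IsNilpotentCurvatureRoot ε y φ) (hε : ε ≠ 0) (hp : 2 ≤ p)
    (hsig : g.HasSignature p p) (v : TangentSpace 𝓘(ℝ, E) y) :
    v ∈ LinearMap.range φ.toLinearMap ↔ ∀ w, g.curvature y v w = 0 := by
  rw [← h.2.1, LinearMap.mem_ker]
  constructor
  · intro hv w
    rw [h.2.2]
    ext z
    simp [curvatureOfEnd_apply, hv]
  · intro hv
    refine mem_ker_of_curvatureOfEnd_eq_zero (g.form_nondegenerate y)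
      (by rw [h.finrank_range hsig]; exact hp) fun w ↦ ?_
    have := hv w
    rw [h.2.2] at this
    exact (smul_eq_zero.1 this).resolve_left hε

/-- The curvature in terms of the bilinear form `h(v, w) = g(φ v, w)`. -/
lemma val_curvature (h : g.IsNilpotentCurvatureRoot ε y φ) (u v w z : TangentSpace 𝓘(ℝ, E) y) :
    g.val y (g.curvature y u v w) z =
      ε * (g.val y (φ v) w * g.val y (φ u) z - g.val y (φ u) w * g.val y (φ v) z) := by
  rw [h.2.2]
  simp [curvatureOfEnd_apply]

lemma val_comm (h : g.IsNilpotentCurvatureRoot ε y φ) (v w : TangentSpace 𝓘(ℝ, E) y) :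
    g.val y (φ v) w = g.val y (φ w) v := by
  rw [h.1, g.symm]

/-- `R_φ` is quadratic in `φ`. This sign freedom is what `exists_smooth_root` has to fix. -/
lemma neg (h : g.IsNilpotentCurvatureRoot ε y φ) : g.IsNilpotentCurvatureRoot ε y (-φ) := by
  refine ⟨fun v w ↦ by simp [h.1], ?_, fun v w ↦ ?_⟩
  · have hk : LinearMap.ker (-φ).toLinearMap = LinearMap.ker φ.toLinearMap := by
      ext v; simp
    have hr : LinearMap.range (-φ).toLinearMap = LinearMap.range φ.toLinearMap := by
      ext v
      constructor
      · rintro ⟨w, rfl⟩; exact ⟨-w, by simp⟩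
      · rintro ⟨w, rfl⟩; exact ⟨-w, by simp⟩
    rw [hk, hr, h.2.1]
  · rw [h.2.2]
    ext z
    simp [curvatureOfEnd_apply]

end IsNilpotentCurvatureRoot

end PseudoRiemannianMetric

/-! ### Smooth nilpotent roots of the curvature tensor -/

noncomputable section SmoothRoot

namespace PseudoRiemannianMetric

variable {E : Type*} [NormedAddCommGroup E] [NormedSpace ℝ E] [FiniteDimensional ℝ E]
  {M : Type*} [TopologicalSpace M] [ChartedSpace E M] [IsManifold 𝓘(ℝ, E) ∞ M]
  {g : PseudoRiemannianMetric E M} {p : ℕ} {ε : ℝ} {y : M}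

/-- A field of endomorphisms is smooth if it maps a local frame to smooth vector fields. -/
lemma contMDiffAt_endField {φ : Π x : M, TangentSpace 𝓘(ℝ, E) x →L[ℝ] TangentSpace 𝓘(ℝ, E) x}
    (h : ∀ v : E, CMDiffAt ∞ (T% (fun z ↦ φ z (tangentCoordSymm E y z v))) y) :
    ContMDiffAt 𝓘(ℝ, E) (𝓘(ℝ, E).prod 𝓘(ℝ, E →L[ℝ] E)) ∞
      (fun x ↦ TotalSpace.mk' (E →L[ℝ] E) x (φ x)) y := by
  rw [contMDiffAt_hom_bundle]
  refine ⟨contMDiffAt_id, ?_⟩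
  set b := Module.finBasis ℝ E
  have hy := mem_chart_source E y
  have h1 (i) := (contMDiffAt_iff_tangentCoord le_rfl hy).1 (h (b i))
  have h2 : CMDiffAt ∞ (fun z ↦ ∑ i, ContinuousLinearMap.smulRightL ℝ E E
      (LinearMap.toContinuousLinearMap (b.coord i))
      (tangentCoord E y z (φ z (tangentCoordSymm E y z (b i))))) y :=
    contMDiffAt_finsetSum fun i _ ↦
      (ContinuousLinearMap.contDiff _).contMDiff.contMDiffAt.comp y (h1 i)
  refine h2.congr_of_eventuallyEq (Filter.Eventually.of_forall fun z ↦ ?_)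
  refine ContinuousLinearMap.ext fun v ↦ ?_
  change tangentCoord E y z (φ z (tangentCoordSymm E y z v)) = _
  have hv := congrArg (fun v ↦ tangentCoord E y z (φ z (tangentCoordSymm E y z v))) (b.sum_repr v)
  simp only [map_sum, map_smul] at hv
  refine hv.symm.trans ?_
  simp

/-- The matrix of the curvature tensor on pairs of vector fields out of three. -/
def curvatureMatrix (g : PseudoRiemannianMetric E M) (e : Fin 3 → Π x : M, TangentSpace 𝓘(ℝ, E) x)
    (y : M) : Matrix (Fin 3) (Fin 3) ℝ :=
  .of fun i j ↦ g.val y (g.curvature y (e (i + 1) y) (e (i + 2) y) (e (j + 1) y)) (e (j + 2) y)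

/-- The matrix of the bilinear form `g(φ v, w)`. -/
def gramMatrix (g : PseudoRiemannianMetric E M) {y : M}
    (φ : TangentSpace 𝓘(ℝ, E) y →L[ℝ] TangentSpace 𝓘(ℝ, E) y)
    (e : Fin 3 → TangentSpace 𝓘(ℝ, E) y) : Matrix (Fin 3) (Fin 3) ℝ :=
  .of fun i j ↦ g.val y (φ (e i)) (e j)

lemma gramMatrix_apply (φ : TangentSpace 𝓘(ℝ, E) y →L[ℝ] TangentSpace 𝓘(ℝ, E) y)
    (e : Fin 3 → TangentSpace 𝓘(ℝ, E) y) (i j : Fin 3) :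
    g.gramMatrix φ e i j = g.val y (φ (e i)) (e j) := rfl

variable {φ : TangentSpace 𝓘(ℝ, E) y →L[ℝ] TangentSpace 𝓘(ℝ, E) y}
  {e : Fin 3 → Π x : M, TangentSpace 𝓘(ℝ, E) x}

/-- Each entry is, up to `-ε`, a `2 × 2` minor of the symmetric Gram matrix. The cyclic indices `i +
1`, `i + 2` in `Fin 3` supply the cofactor signs. -/
lemma IsNilpotentCurvatureRoot.curvatureMatrix_eq (h : g.IsNilpotentCurvatureRoot ε y φ) :
    g.curvatureMatrix e y = -ε • (g.gramMatrix φ fun i ↦ e i y).adjugate := by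
  have hc (i j : Fin 3) : g.val y (φ (e i y)) (e j y) = g.val y (φ (e j y)) (e i y) :=
    h.val_comm _ _
  ext i j
  rw [Matrix.adjugate_fin_three]
  fin_cases i <;> fin_cases j <;>
    simp [curvatureMatrix, gramMatrix_apply, h.val_curvature] <;>
    (try simp only [hc 1 0, hc 2 0, hc 2 1]) <;> ring

/-- The size three is odd, so the factor `-ε` survives in the determinant while the adjugate
contributes a square. The curvature alone thus detects `ε`. -/
lemma IsNilpotentCurvatureRoot.det_curvatureMatrix (h : g.IsNilpotentCurvatureRoot ε y φ)
    (hε : ε = 1 ∨ ε = -1) :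
    ε * (g.curvatureMatrix e y).det = -(g.gramMatrix φ fun i ↦ e i y).det ^ 2 := by
  rw [h.curvatureMatrix_eq, Matrix.det_smul, Matrix.det_adjugate]
  rcases hε with rfl | rfl <;> norm_num

lemma contMDiffAt_curvatureMatrix (he : ∀ i, IsSmoothNear (e i) y) (i j : Fin 3) :
    CMDiffAt ∞ (fun z ↦ g.curvatureMatrix e z i j) y :=
  g.contMDiffAt_curvature (he _) (he _) (he _) (he _).contMDiffAt

/-- Near a point with a nilpotent root of the curvature tensor there are fields `e₀, e₁, e₂` which
are orthogonal and non-isotropic for `g(φ v, w)` at that point. -/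
lemma IsNilpotentCurvatureRoot.exists_fields (h : g.IsNilpotentCurvatureRoot ε y φ)
    (hp : 3 ≤ p) (hsig : g.HasSignature p p) :
    ∃ e : Fin 3 → Π x : M, TangentSpace 𝓘(ℝ, E) x,
      (∀ z ∈ (chartAt E y).source, ∀ i, IsSmoothNear (e i) z) ∧
      (∀ i, g.gramMatrix φ (fun i ↦ e i y) i i ≠ 0) ∧
      ∀ i j, i ≠ j → g.gramMatrix φ (fun i ↦ e i y) i j = 0 := by
  obtain ⟨e, h1, h2⟩ := exists_orthogonal_triple (g.form_comm y) (g.form_nondegenerate y)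
    (φ := φ.toLinearMap) h.1 (by rw [h.finrank_range hsig]; exact hp)
  refine ⟨fun i ↦ coordField y (e i), fun z hz i ↦ isSmoothNear_coordField hz _, ?_, ?_⟩
  · intro i
    simpa [gramMatrix_apply, coordField_self] using h1 i
  · intro i j hij
    simpa [gramMatrix_apply, coordField_self] using h2 i j hij

/-- The sign of a nilpotent root of the curvature tensor is locally constant. -/
lemma eventually_sign_eq (hp : 3 ≤ p) (hsig : g.HasSignature p p)
    (h : g.IsNilpotentCurvatureRoot ε y φ) (hε : ε = 1 ∨ ε = -1) :
    ∀ᶠ z in 𝓝 y, ∀ ε' : ℝ, (ε' = 1 ∨ ε' = -1) →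
      (∃ φ', g.IsNilpotentCurvatureRoot ε' z φ') → ε' = ε := by
  obtain ⟨e, he, h1, h2⟩ := h.exists_fields hp hsig
  have hc : ContinuousAt (fun z ↦ ε * (g.curvatureMatrix e z).det) y :=
    ((contMDiffAt_det fun i j ↦ contMDiffAt_curvatureMatrix
      (he y (mem_chart_source E y)) i j).continuousAt).const_mul ε
  -- Strictly negative at `y`, hence nearby. A root of sign `ε'` has `ε' * det ≤ 0`, so `ε' = -ε` is
  -- impossible there.
  have hneg : ε * (g.curvatureMatrix e y).det < 0 := by
    rw [h.det_curvatureMatrix hε, Matrix.det_fin_three, h2 0 1, h2 0 2, h2 1 2, h2 1 0, h2 2 0,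
      h2 2 1] <;> try decide
    have := sq_pos_of_ne_zero (mul_ne_zero (mul_ne_zero (h1 0) (h1 1)) (h1 2))
    simpa using this
  filter_upwards [hc.eventually (Iio_mem_nhds hneg)] with z hz ε' hε' ⟨φ', hφ'⟩
  have h3 := hφ'.det_curvatureMatrix (e := e) hε'
  have h4 := sq_nonneg (g.gramMatrix φ' fun i ↦ e i z).det
  have hz' : ε * (g.curvatureMatrix e z).det < 0 := hz
  rcases hε with rfl | rfl <;> rcases hε' with rfl | rfl <;> first | rfl | (exfalso; linarith)

/-- The sign of the nilpotent roots of the curvature tensor is constant on a connected manifold. -/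
lemma exists_sign [ConnectedSpace M] (hp : 5 ≤ p) (hsig : g.HasSignature p p)
    (hg : g.IsSpacelikeRankTwoNilpotentJordanIP) :
    ∃ ε : ℝ, (ε = 1 ∨ ε = -1) ∧ ∀ y, ∃ φ, g.IsNilpotentCurvatureRoot ε y φ := by
  choose s hs φ hφ using exists_isNilpotentCurvatureRoot hp hsig hg
  have hloc : IsLocallyConstant s := by
    rw [IsLocallyConstant.iff_eventually_eq]
    intro y
    filter_upwards [eventually_sign_eq (by omega) hsig (hφ y) (hs y)] with z hz
    exact hz _ (hs z) ⟨_, hφ z⟩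
  obtain ⟨c, hc⟩ := hloc.exists_eq_const
  obtain ⟨y₀⟩ : Nonempty M := inferInstance
  refine ⟨s y₀, hs y₀, fun y ↦ ⟨φ y, ?_⟩⟩
  have : s y = s y₀ := by rw [hc]; rfl
  rw [← this]
  exact hφ y

/-- The curvature tensor has smooth nilpotent roots locally. -/
lemma exists_smooth_root (hp : 5 ≤ p) (hsig : g.HasSignature p p) (hε : ε = 1 ∨ ε = -1)
    (hroot : ∀ y, ∃ φ, g.IsNilpotentCurvatureRoot ε y φ) (x₀ : M) :
    ∃ U : Set M, IsOpen U ∧ x₀ ∈ U ∧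
      ∃ φ : Π x : M, TangentSpace 𝓘(ℝ, E) x →L[ℝ] TangentSpace 𝓘(ℝ, E) x,
        ContMDiffOn 𝓘(ℝ, E) (𝓘(ℝ, E).prod 𝓘(ℝ, E →L[ℝ] E)) ∞
          (fun x ↦ TotalSpace.mk' (E →L[ℝ] E) x (φ x)) U ∧
        ∀ x ∈ U, g.IsNilpotentCurvatureRoot ε x (φ x) := by
  classical
  choose ψ hψ using hroot
  have hε2 : -ε * -ε = 1 := by rcases hε with rfl | rfl <;> norm_num
  obtain ⟨e, he, hd, ho⟩ := (hψ x₀).exists_fields (by omega) hsig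
  set A : M → Matrix (Fin 3) (Fin 3) ℝ := fun y ↦ -ε • g.curvatureMatrix e y with hA
  have hAs {y : M} (hy : y ∈ (chartAt E x₀).source) (i j) : CMDiffAt ∞ (fun z ↦ A z i j) y :=
    contMDiffAt_const.mul (contMDiffAt_curvatureMatrix (he y hy) i j)
  have hAdet {y : M} (hy : y ∈ (chartAt E x₀).source) : CMDiffAt ∞ (fun z ↦ (A z).det) y :=
    contMDiffAt_det (hAs hy)
  have hAadj {y : M} (hy : y ∈ (chartAt E x₀).source) (i j) :
      CMDiffAt ∞ (fun z ↦ (A z).adjugate i j) y := by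
    simp only [Matrix.adjugate_apply]
    refine contMDiffAt_det fun k l ↦ ?_
    by_cases hk : k = j
    · subst hk; simpa using contMDiffAt_const
    · simpa [Matrix.updateRow_ne hk] using hAs hy k l
  have hAeq {y : M} {φ} (h : g.IsNilpotentCurvatureRoot ε y φ) :
      A y = (g.gramMatrix φ fun i ↦ e i y).adjugate := by
    rw [hA]
    simp only
    rw [h.curvatureMatrix_eq, smul_smul, hε2, one_smul]
  -- A `3 × 3` determinant changes sign with `φ`, so `det H ≥ 0` can be arranged at each point. Then
  -- `det H = √(det A)` and `H = adj A / √(det A)`, where `A = adj H` comes from the curvature and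
  -- is smooth.
  set φ : Π x : M, TangentSpace 𝓘(ℝ, E) x →L[ℝ] TangentSpace 𝓘(ℝ, E) x := fun y ↦
    if 0 < (g.gramMatrix (ψ y) fun i ↦ e i y).det then ψ y else -ψ y with hφdef
  have hφ (y) : g.IsNilpotentCurvatureRoot ε y (φ y) := by
    rw [hφdef]
    simp only
    split_ifs
    · exact hψ y
    · exact (hψ y).neg
  set H : M → Matrix (Fin 3) (Fin 3) ℝ := fun y ↦ g.gramMatrix (φ y) fun i ↦ e i y with hH
  have hHA (y) : A y = (H y).adjugate := hAeq (hφ y)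
  have hdet (y) : (A y).det = (H y).det ^ 2 := by
    rw [hHA, Matrix.det_adjugate]; rfl
  have hadj (y) (i j) : (A y).adjugate i j = (H y).det * H y i j := by
    rw [hHA, Matrix.adjugate_adjugate']; simp
  have hHpos (y) : 0 ≤ (H y).det := by
    by_cases h : 0 < (g.gramMatrix (ψ y) fun i ↦ e i y).det
    · simp only [hH, hφdef, h, if_true]; exact h.le
    · have hneg : H y = -(g.gramMatrix (ψ y) fun i ↦ e i y) := by
        ext i j
        simp [hH, hφdef, h, gramMatrix_apply]
      rw [hneg, Matrix.det_neg]
      simp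
      linarith
  have hsqrt (y) : (H y).det = √(A y).det := by rw [hdet, Real.sqrt_sq (hHpos y)]
  have hx₀ := mem_chart_source E x₀
  -- The three denominators used below. At `x₀` the Gram matrix is diagonal with nonzero entries, so
  -- none vanishes.
  have h1 : 0 < (A x₀).det ∧ A x₀ 2 2 ≠ 0 ∧ (A x₀).adjugate 0 0 ≠ 0 := by
    have h3 := hAeq (hψ x₀)
    set G := g.gramMatrix (ψ x₀) fun i ↦ e i x₀
    have hG : G.det = G 0 0 * G 1 1 * G 2 2 := by
      rw [Matrix.det_fin_three, ho 0 1, ho 0 2, ho 1 2, ho 1 0, ho 2 0, ho 2 1] <;>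
        first | decide | ring
    have hne : G.det ≠ 0 := by
      rw [hG]; exact mul_ne_zero (mul_ne_zero (hd 0) (hd 1)) (hd 2)
    refine ⟨?_, ?_, ?_⟩
    · rw [h3, Matrix.det_adjugate]; exact sq_pos_of_ne_zero hne
    · rw [h3, Matrix.adjugate_fin_three]
      have h4 := mul_ne_zero (hd 0) (hd 1)
      have h5 := ho 0 1 (by decide)
      simpa [h5] using h4
    · rw [h3, Matrix.adjugate_adjugate']
      simpa using ⟨hne, hd 0⟩
  have h2 : ∀ᶠ y in 𝓝 x₀, y ∈ (chartAt E x₀).source ∧ 0 < (A y).det ∧ A y 2 2 ≠ 0 ∧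
      (A y).adjugate 0 0 ≠ 0 := by
    filter_upwards [eventually_mem_chart_source hx₀,
      (hAdet hx₀).continuousAt.eventually (Ioi_mem_nhds h1.1),
      (hAs hx₀ 2 2).continuousAt.eventually_ne h1.2.1,
      (hAadj hx₀ 0 0).continuousAt.eventually_ne h1.2.2] with y a b c d
    exact ⟨a, b, c, d⟩
  obtain ⟨U, hUs, hUo, hxU⟩ := mem_nhds_iff.1 h2
  refine ⟨U, hUo, hxU, φ, fun y hy ↦ ?_, fun y _ ↦ hφ y⟩
  obtain ⟨hys, hpos, -, -⟩ := hUs hy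
  have hδ : CMDiffAt ∞ (fun z ↦ √(A z).det) y :=
    (Real.contDiffAt_sqrt hpos.ne').contMDiffAt.comp y (hAdet hys)
  have hδ0 : √(A y).det ≠ 0 := (Real.sqrt_pos.2 hpos).ne'
  have hHs (i j) : CMDiffAt ∞ (fun z ↦ H z i j) y := by
    refine ((hAadj hys i j).div₀ hδ hδ0).congr_of_eventuallyEq ?_
    filter_upwards [hUo.mem_nhds hy] with z hz
    have : √(A z).det ≠ 0 := (Real.sqrt_pos.2 (hUs hz).2.1).ne'
    simp only [Pi.div_apply]
    rw [hadj, hsqrt, mul_div_cancel_left₀ _ this]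
  have hD {X Y Z W : Π x : M, TangentSpace 𝓘(ℝ, E) x} (hX : IsSmoothNear X y)
      (hY : IsSmoothNear Y y) (hZ : IsSmoothNear Z y) (hW : CMDiffAt ∞ (T% W) y) :
      CMDiffAt ∞ (fun z ↦ -ε * g.val z (g.curvature z (X z) (Y z) (Z z)) (W z)) y :=
    contMDiffAt_const.mul (g.contMDiffAt_curvature hX hY hZ hW)
  have hDval (z) (a b c d : TangentSpace 𝓘(ℝ, E) z) : -ε * g.val z (g.curvature z a b c) d =
      g.val z (φ z a) c * g.val z (φ z b) d - g.val z (φ z b) c * g.val z (φ z a) d := by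
    rw [(hφ z).val_curvature]
    linear_combination (g.val z (φ z a) c * g.val z (φ z b) d -
      g.val z (φ z b) c * g.val z (φ z a) d) * hε2
  -- Write `h` for `g(φ·,·)`. Two curvature components are linear in `h(e₀,Z)` and `h(e₁,Z)`;
  -- Cramer's rule with determinant `A 2 2` isolates `h(e₀,Z)`.
  have hZ0 {Z : Π x : M, TangentSpace 𝓘(ℝ, E) x} (hZ : CMDiffAt ∞ (T% Z) y) :
      CMDiffAt ∞ (fun z ↦ g.val z (φ z (e 0 z)) (Z z)) y := by
    have hP := hD (he y hys 0) (he y hys 1) (he y hys 0) hZ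
    have hQ := hD (he y hys 0) (he y hys 1) (he y hys 1) hZ
    refine ((((hHs 0 1).mul hP).sub ((hHs 0 0).mul hQ)).div₀ (hAs hys 2 2)
      (hUs hy).2.2.1).congr_of_eventuallyEq ?_
    filter_upwards [hUo.mem_nhds hy] with z hz
    have hK : A z 2 2 = H z 0 0 * H z 1 1 - H z 0 1 * H z 0 1 := by
      rw [hHA, Matrix.adjugate_fin_three]
      simp [hH, gramMatrix_apply, (hφ z).val_comm (e 1 z) (e 0 z)]
    simp only [Pi.div_apply, Pi.mul_apply]
    rw [eq_div_iff (hUs hz).2.2.1, hK, hDval, hDval]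
    simp only [hH, gramMatrix_apply, (hφ z).val_comm (e 1 z) (e 0 z)]
    ring
  -- The component on `e₀, X, e₀, Z` equals `h(e₀,e₀) h(X,Z) - h(X,e₀) h(e₀,Z)`, and everything
  -- except `h(X,Z)` is already smooth.
  have hXZ {X Z : Π x : M, TangentSpace 𝓘(ℝ, E) x} (hX : IsSmoothNear X y)
      (hZ : CMDiffAt ∞ (T% Z) y) : CMDiffAt ∞ (fun z ↦ g.val z (φ z (X z)) (Z z)) y := by
    have hH0 : H y 0 0 ≠ 0 := fun h ↦ (hUs hy).2.2.2 (by rw [hadj, h, mul_zero])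
    refine (((hD (he y hys 0) hX (he y hys 0) hZ).add
      ((hZ0 hZ).mul (hZ0 hX.contMDiffAt))).div₀ (hHs 0 0) hH0).congr_of_eventuallyEq ?_
    filter_upwards [hUo.mem_nhds hy] with z hz
    have hH0 : H z 0 0 ≠ 0 := fun h ↦ (hUs hz).2.2.2 (by rw [hadj, h, mul_zero])
    simp only [Pi.div_apply, Pi.add_apply, Pi.mul_apply]
    rw [eq_div_iff hH0, hDval]
    simp only [hH, gramMatrix_apply, (hφ z).val_comm (X z) (e 0 z)]
    ring
  refine (contMDiffAt_endField fun v ↦ g.contMDiffAt_of_pairing fun Z hZ ↦ ?_).contMDiffWithinAt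
  exact hXZ (isSmoothNear_tangentCoordSymm (mem_chart_source E y)
    (Filter.Eventually.of_forall fun _ ↦ contMDiffAt_const)) hZ

end PseudoRiemannianMetric

end SmoothRoot

/-! ### Involutive distributions -/

noncomputable section Involutive

namespace PseudoRiemannianMetric

variable {E : Type*} [NormedAddCommGroup E] [NormedSpace ℝ E] [FiniteDimensional ℝ E]
  {M : Type*} [TopologicalSpace M] [ChartedSpace E M] [IsManifold 𝓘(ℝ, E) ∞ M]
  {g : PseudoRiemannianMetric E M} {y : M} {ξ η : Π x : M, TangentSpace 𝓘(ℝ, E) x}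

/-- The nullity spaces of the curvature tensor are closed under the Lie bracket. -/
lemma curvature_mlieBracket_eq_zero (hξ : IsSmoothNear ξ y) (hη : IsSmoothNear η y)
    (hξ0 : ∀ᶠ z in 𝓝 y, ∀ w, g.curvature z (ξ z) w = 0)
    (hη0 : ∀ᶠ z in 𝓝 y, ∀ w, g.curvature z (η z) w = 0) (w : TangentSpace 𝓘(ℝ, E) y) :
    g.curvature y (mlieBracket 𝓘(ℝ, E) ξ η y) w = 0 := by
  -- For a nullity field, `[∇_ξ, ∇_X] = ∇_[ξ,X]`. The rest is the Jacobi identity, for these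
  -- operators and for the fields; the second Bianchi identity is not used.
  have hcomm {ξ : Π x : M, TangentSpace 𝓘(ℝ, E) x} (hξ : IsSmoothNear ξ y)
      (hξ0 : ∀ᶠ z in 𝓝 y, ∀ w, g.curvature z (ξ z) w = 0)
      {X Z : Π x : M, TangentSpace 𝓘(ℝ, E) x} (hX : IsSmoothNear X y) (hZ : IsSmoothNear Z y) :
      g.nabla ξ (g.nabla X Z) =ᶠ[𝓝 y]
        g.nabla X (g.nabla ξ Z) + g.nabla (mlieBracket 𝓘(ℝ, E) ξ X) Z := by
    filter_upwards [hξ.eventually, hξ0, hX.eventually, hZ.eventually] with z h1 h2 h3 h4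
    have h := g.curvature_apply h1 h3 h4
    rw [h2, curvatureField_eq, LinearMap.zero_apply, sub_sub, eq_comm, sub_eq_zero] at h
    exact h
  have hX := isSmoothNear_coordField (mem_chart_source E y) w
  set X := coordField y w with hXdef
  refine LinearMap.ext fun v ↦ ?_
  have hZ := isSmoothNear_coordField (mem_chart_source E y) v
  set Z := coordField y v with hZdef
  have hT := hξ.mlieBracket hη
  have hXy : X y = w := coordField_self y w
  have hZy : Z y = v := coordField_self y v
  rw [← hXy, ← hZy, g.curvature_apply hT hX hZ, curvatureField_eq, LinearMap.zero_apply]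
  have hn {A B : Π x : M, TangentSpace 𝓘(ℝ, E) x} (hA : IsSmoothNear A y)
      (hB : IsSmoothNear B y) := g.isSmoothNear_nabla hA hB
  have hstep {ξ η : Π x : M, TangentSpace 𝓘(ℝ, E) x} (hξ : IsSmoothNear ξ y)
      (hη : IsSmoothNear η y) (hξ0 : ∀ᶠ z in 𝓝 y, ∀ w, g.curvature z (ξ z) w = 0)
      (hη0 : ∀ᶠ z in 𝓝 y, ∀ w, g.curvature z (η z) w = 0) :
      g.nabla ξ (g.nabla η (g.nabla X Z)) y = g.nabla X (g.nabla ξ (g.nabla η Z)) y +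
        g.nabla (mlieBracket 𝓘(ℝ, E) ξ X) (g.nabla η Z) y +
        (g.nabla (mlieBracket 𝓘(ℝ, E) η X) (g.nabla ξ Z) y +
          g.nabla (mlieBracket 𝓘(ℝ, E) ξ (mlieBracket 𝓘(ℝ, E) η X)) Z y) := by
    have hb := hη.mlieBracket hX
    rw [g.nabla_congr_right (hn hη (hn hX hZ)).mdifferentiableAt
      ((hn hX (hn hη hZ)).add (hn hb hZ)).mdifferentiableAt (hcomm hη hη0 hX hZ),
      g.nabla_add_right (hn hX (hn hη hZ)).mdifferentiableAt (hn hb hZ).mdifferentiableAt,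
      (hcomm hξ hξ0 hX (hn hη hZ)).self_of_nhds, (hcomm hξ hξ0 hb hZ).self_of_nhds]
    rfl
  -- `R(ξ, η) = 0` expresses `∇_[ξ,η]` as the commutator of `∇_ξ` and `∇_η`.
  have hTW {W : Π x : M, TangentSpace 𝓘(ℝ, E) x} (hW : IsSmoothNear W y) :
      g.nabla (mlieBracket 𝓘(ℝ, E) ξ η) W =ᶠ[𝓝 y]
        g.nabla ξ (g.nabla η W) - g.nabla η (g.nabla ξ W) := by
    filter_upwards [hcomm hξ hξ0 hη hW] with z hz
    simp only [Pi.sub_apply, hz, Pi.add_apply]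
    abel
  have h2 : g.nabla X (g.nabla (mlieBracket 𝓘(ℝ, E) ξ η) Z) y =
      g.nabla X (g.nabla ξ (g.nabla η Z)) y - g.nabla X (g.nabla η (g.nabla ξ Z)) y := by
    have h3 := (hn hξ (hn hη hZ)).mdifferentiableAt
    have h4 := (hn hη (hn hξ hZ)).mdifferentiableAt
    rw [g.nabla_congr_right (hn hT hZ).mdifferentiableAt (mdifferentiableAt_sub_section h3 h4)
      (hTW hZ), g.nabla_sub_right h3 h4]
  have : IsManifold 𝓘(ℝ, E) (minSmoothness ℝ 3) M := by
    rw [minSmoothness_of_isRCLikeNormedField]; exact .of_le (n := ∞) ENat.LEInfty.out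
  have hj {X : Π x : M, TangentSpace 𝓘(ℝ, E) x} (hX : IsSmoothNear X y) :
      CMDiffAt (minSmoothness ℝ 2) (T% X) y := hX.contMDiffAt.of_le (by
    rw [minSmoothness_of_isRCLikeNormedField]; exact ENat.LEInfty.out)
  have h5 := leibniz_identity_mlieBracket_apply (hj hξ) (hj hη) (hj hX)
  have h6 : g.nabla (mlieBracket 𝓘(ℝ, E) ξ (mlieBracket 𝓘(ℝ, E) η X)) Z y =
      g.nabla (mlieBracket 𝓘(ℝ, E) (mlieBracket 𝓘(ℝ, E) ξ η) X) Z y +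
        g.nabla (mlieBracket 𝓘(ℝ, E) η (mlieBracket 𝓘(ℝ, E) ξ X)) Z y := by
    simp only [nabla, h5, map_add]
  rw [(hTW (hn hX hZ)).self_of_nhds, Pi.sub_apply, hstep hξ hη hξ0 hη0, hstep hη hξ hη0 hξ0, h2, h6]
  abel

end PseudoRiemannianMetric

variable {E : Type*} [NormedAddCommGroup E] [NormedSpace ℝ E] [FiniteDimensional ℝ E]
  {M : Type*} [TopologicalSpace M] [ChartedSpace E M] [IsManifold 𝓘(ℝ, E) ∞ M] {k : ℕ}
  {K : Π x : M, Submodule ℝ (TangentSpace 𝓘(ℝ, E) x)}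

/-- A smooth distribution has a smooth frame in a chart which is normalized by a linear map. -/
lemma IsSmoothDistribution.exists_normalized_frame (hK : IsSmoothDistribution k K) (x₀ : M) :
    ∃ (Ω : Set E) (F : E → EuclideanSpace ℝ (Fin k) →L[ℝ] E)
      (q : E →L[ℝ] EuclideanSpace ℝ (Fin k)),
      IsOpen Ω ∧ extChartAt 𝓘(ℝ, E) x₀ x₀ ∈ Ω ∧ Ω ⊆ (extChartAt 𝓘(ℝ, E) x₀).target ∧
      ContDiffOn ℝ ∞ F Ω ∧ ∀ z ∈ Ω, (∀ u, q (F z u) = u) ∧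
        ∀ v, v ∈ K ((extChartAt 𝓘(ℝ, E) x₀).symm z) ↔
          tangentCoord E x₀ ((extChartAt 𝓘(ℝ, E) x₀).symm z) v ∈ LinearMap.range (F z).toLinearMap := by
  obtain ⟨U, hU, hxU, X, hX, hXK⟩ := hK x₀
  set c := extChartAt 𝓘(ℝ, E) x₀ with hc
  set Ω₀ := c.target ∩ c.symm ⁻¹' U with hΩ₀
  have hΩ₀o : IsOpen Ω₀ :=
    (continuousOn_extChartAt_symm x₀).isOpen_inter_preimage (isOpen_extChartAt_target x₀) hU
  have hx₀ : c x₀ ∈ Ω₀ := ⟨mem_extChartAt_target x₀, by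
    change c.symm (c x₀) ∈ U
    rwa [hc, extChartAt_to_inv]⟩
  have hs {z : E} (hz : z ∈ c.target) : c.symm z ∈ (chartAt E x₀).source := by
    rw [← extChartAt_source 𝓘(ℝ, E)]; exact c.map_target hz
  let P (z : E) : EuclideanSpace ℝ (Fin k) →L[ℝ] E :=
    ∑ i, (EuclideanSpace.proj i : EuclideanSpace ℝ (Fin k) →L[ℝ] ℝ).smulRight (chartRep E x₀ (X i) z)
  have hPu (z : E) (u : EuclideanSpace ℝ (Fin k)) :
      P z u = tangentCoord E x₀ (c.symm z) (∑ i, u i • X i (c.symm z)) := by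
    simp [P, chartRep]
    rfl
  have hP {z : E} (hz : z ∈ Ω₀) : ContDiffAt ℝ ∞ P z := by
    refine ContDiffAt.sum fun i _ ↦ contDiffAt_const.smulRight ?_
    have h1 := contDiffAt_chartRep le_rfl (hs hz.1) ((hX i).contMDiffAt (hU.mem_nhds hz.2))
    rwa [← hc, c.right_inv hz.1] at h1
  have hPinj : Function.Injective (P (c x₀)) := by
    rw [injective_iff_map_eq_zero]
    intro u hu
    have h1 := congrArg (tangentCoordSymm E x₀ (c.symm (c x₀))) hu
    rw [hPu, tangentCoordSymm_tangentCoord (hs hx₀.1), map_zero] at h1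
    have h2 := Fintype.linearIndependent_iff.1 (hXK _ hx₀.2).1 _ h1
    ext i
    exact h2 i
  -- `q ∘ P z` is the identity at the base point, hence invertible nearby. Composing `P z` with its
  -- inverse gives a frame `F z` of the same span with `q ∘ F z = id`.
  obtain ⟨q₀, hq₀⟩ := (P (c x₀)).toLinearMap.exists_leftInverse_of_injective
    (LinearMap.ker_eq_bot.2 hPinj)
  set q : E →L[ℝ] EuclideanSpace ℝ (Fin k) := LinearMap.toContinuousLinearMap q₀
  have hG {z : E} (hz : z ∈ Ω₀) : ContDiffAt ℝ ∞ (fun z ↦ q.comp (P z)) z :=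
    contDiffAt_const.clm_comp (hP hz)
  set Ω := Ω₀ ∩ (fun z ↦ q.comp (P z)) ⁻¹' {A | IsUnit A} with hΩ
  have hΩo : IsOpen Ω := ContinuousOn.isOpen_inter_preimage
    (fun z hz ↦ (hG hz).continuousAt.continuousWithinAt) hΩ₀o Units.isOpen
  have hxΩ : c x₀ ∈ Ω := by
    refine ⟨hx₀, ?_⟩
    have : q.comp (P (c x₀)) = 1 := by
      ext1 u
      exact LinearMap.congr_fun hq₀ u
    change IsUnit (q.comp (P (c x₀)))
    rw [this]
    exact isUnit_one
  refine ⟨Ω, fun z ↦ (P z).comp (Ring.inverse (q.comp (P z))), q, hΩo, hxΩ,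
    fun z hz ↦ hz.1.1, fun z hz ↦ ?_, fun z hz ↦ ⟨fun u ↦ ?_, fun v ↦ ?_⟩⟩
  · obtain ⟨A, hA⟩ : IsUnit (q.comp (P z)) := hz.2
    have h1 := contDiffAt_ringInverse (n := ∞) ℝ A
    rw [hA] at h1
    exact ((hP hz.1).clm_comp (h1.comp z (hG hz.1))).contDiffWithinAt
  · exact DFunLike.congr_fun (Ring.mul_inverse_cancel _ hz.2) u
  · rw [← (hXK _ hz.1.2).2, Submodule.mem_span_range_iff_exists_fun]
    constructor
    · rintro ⟨a, rfl⟩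
      refine ⟨q.comp (P z) (WithLp.toLp 2 a), ?_⟩
      have h1 : Ring.inverse (q.comp (P z)) (q.comp (P z) (WithLp.toLp 2 a)) = WithLp.toLp 2 a :=
        DFunLike.congr_fun (Ring.inverse_mul_cancel _ hz.2) _
      change P z (Ring.inverse (q.comp (P z)) (q.comp (P z) (WithLp.toLp 2 a))) = _
      rw [h1, hPu]
    · rintro ⟨u, hu⟩
      refine ⟨fun i ↦ Ring.inverse (q.comp (P z)) u i, ?_⟩
      have h1 : tangentCoord E x₀ (c.symm z)
          (∑ i, Ring.inverse (q.comp (P z)) u i • X i (c.symm z)) = tangentCoord E x₀ (c.symm z) v :=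
        (hPu z _).symm.trans hu
      have h2 := congrArg (tangentCoordSymm E x₀ (c.symm z)) h1
      rwa [tangentCoordSymm_tangentCoord (hs hz.1.1),
        tangentCoordSymm_tangentCoord (hs hz.1.1)] at h2

/-- **Frobenius theorem**: involutive smooth distributions are integrable. -/
theorem IsSmoothDistribution.isIntegrableDistribution (hK : IsSmoothDistribution k K)
    (hinv : ∀ (y : M) (ξ η : Π x : M, TangentSpace 𝓘(ℝ, E) x), IsSmoothNear ξ y →
      IsSmoothNear η y → (∀ᶠ z in 𝓝 y, ξ z ∈ K z) → (∀ᶠ z in 𝓝 y, η z ∈ K z) →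
      mlieBracket 𝓘(ℝ, E) ξ η y ∈ K y) : IsIntegrableDistribution k K := by
  have : CompleteSpace E := FiniteDimensional.complete ℝ E
  refine ⟨hK, fun x₀ ↦ ?_⟩
  obtain ⟨Ω, F, q, hΩ, hx₀, hΩt, hF, hqF⟩ := hK.exists_normalized_frame x₀
  set c := extChartAt 𝓘(ℝ, E) x₀ with hc
  have hs {z : E} (hz : z ∈ Ω) : c.symm z ∈ (chartAt E x₀).source := by
    rw [← extChartAt_source 𝓘(ℝ, E)]; exact c.map_target (hΩt hz)
  -- The normalized fields commute: involutivity puts their bracket in the form `F z a`, and `q`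
  -- kills it because `q (F z u) = u` is constant in `z`. Hence `a = 0`.
  have hsymm : ∀ z ∈ Ω, ∀ u v, fderiv ℝ F z (F z u) v = fderiv ℝ F z (F z v) u := by
    intro z hz u v
    have hcz : c (c.symm z) = z := c.right_inv (hΩt hz)
    have hΩz : ∀ᶠ y in 𝓝 (c.symm z), y ∈ (chartAt E x₀).source ∧ c y ∈ Ω := by
      have h1 : ContinuousAt c (c.symm z) :=
        continuousAt_extChartAt' (by rw [extChartAt_source]; exact hs hz)
      exact (eventually_mem_chart_source (hs hz)).and
        (h1.eventually (hΩ.mem_nhds (by rw [hcz]; exact hz)))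
    let ξ (u : EuclideanSpace ℝ (Fin k)) : Π x : M, TangentSpace 𝓘(ℝ, E) x :=
      fun y ↦ tangentCoordSymm E x₀ y (F (c y) u)
    have hξ (u) : IsSmoothNear (ξ u) (c.symm z) := by
      refine isSmoothNear_tangentCoordSymm (hs hz) ?_
      filter_upwards [hΩz] with y hy
      have h1 : ContDiffAt ℝ ∞ (fun z ↦ F z u) (c y) :=
        (hF.contDiffAt (hΩ.mem_nhds hy.2)).clm_apply contDiffAt_const
      exact h1.contMDiffAt.comp y (contMDiffAt_extChartAt' hy.1)
    have hξK (u) : ∀ᶠ y in 𝓝 (c.symm z), ξ u y ∈ K y := by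
      filter_upwards [hΩz] with y hy
      have hy' : c.symm (c y) = y := c.left_inv (by rw [extChartAt_source]; exact hy.1)
      have h1 := (hqF (c y) hy.2).2
      rw [hy'] at h1
      rw [h1, tangentCoord_tangentCoordSymm hy.1]
      exact ⟨u, rfl⟩
    have hrep (u) : chartRep E x₀ (ξ u) =ᶠ[𝓝 z] fun z ↦ F z u := by
      filter_upwards [hΩ.mem_nhds hz] with w hw
      simp only [chartRep, ξ]
      rw [tangentCoord_tangentCoordSymm (hs hw), c.right_inv (hΩt hw)]
    have hFd (w) (hw : w ∈ Ω) : DifferentiableAt ℝ F w :=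
      (hF.contDiffAt (hΩ.mem_nhds hw)).differentiableAt (by simp)
    have hFu (u w) : fderiv ℝ (fun z ↦ F z u) z w = fderiv ℝ F z w u := by
      rw [fderiv_clm_apply (hFd z hz) (by fun_prop)]
      simp
    have hbr := tangentCoord_mlieBracket (hs hz) ((hξ u).contMDiffAt.of_le (by simp))
      ((hξ v).contMDiffAt.of_le (by simp))
    rw [hcz, (hrep u).lieBracket_vectorField_eq (hrep v), lieBracket_eq] at hbr
    simp only [hFu] at hbr
    have hmem := ((hqF z hz).2 _).1 (hinv _ _ _ (hξ u) (hξ v) (hξK u) (hξK v))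
    rw [hbr] at hmem
    obtain ⟨a, ha⟩ := hmem
    have hq0 (w : E) (u : EuclideanSpace ℝ (Fin k)) : q (fderiv ℝ F z w u) = 0 := by
      have h1 : (fun z ↦ q (F z u)) =ᶠ[𝓝 z] fun _ ↦ u := by
        filter_upwards [hΩ.mem_nhds hz] with w hw using (hqF w hw).1 u
      have hd : DifferentiableAt ℝ (fun z ↦ F z u) z :=
        (hFd z hz).clm_apply (differentiableAt_const u)
      have h2 : HasFDerivAt (fun z ↦ q (F z u)) (q.comp (fderiv ℝ (fun z ↦ F z u) z)) z :=
        q.hasFDerivAt.comp z hd.hasFDerivAt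
      have h3 := h1.fderiv_eq (𝕜 := ℝ)
      rw [h2.fderiv, fderiv_fun_const] at h3
      rw [← hFu]
      exact DFunLike.congr_fun h3 w
    have ha0 : a = 0 := by
      have h1 := (hqF z hz).1 a
      rw [show F z a = _ from ha, map_sub, hq0, hq0, sub_zero] at h1
      exact h1.symm
    replace ha : F z 0 = _ := ha0 ▸ ha
    rw [map_zero] at ha
    rw [sub_eq_zero.1 ha.symm]
  obtain ⟨r, hr, f, hf0, hfΩ, hfd, hfs⟩ :=
    exists_contDiffOn_hasFDerivAt_comp hΩ hx₀ hF hsymm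
  refine ⟨Metric.ball 0 r, c.symm ∘ f, Metric.isOpen_ball, Metric.mem_ball_self hr, ?_, ?_, ?_⟩
  · simp only [Function.comp, hf0]
    exact extChartAt_to_inv x₀
  · exact (contMDiffOn_extChartAt_symm x₀).comp hfs.contMDiffOn fun u hu ↦ hΩt (hfΩ u hu)
  · intro u hu
    have hd := (hasMFDerivAt_extChartAt_symm (hΩt (hfΩ u hu))).comp u (hfd u hu).hasMFDerivAt
    have hFu := hqF _ (hfΩ u hu)
    rw [hd.mfderiv]
    refine ⟨fun a b hab ↦ ?_, ?_⟩
    · have hab' : tangentCoordSymm E x₀ (c.symm (f u)) (F (f u) a) =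
        tangentCoordSymm E x₀ (c.symm (f u)) (F (f u) b) := hab
      have h1 := congrArg (tangentCoord E x₀ (c.symm (f u))) hab'
      rw [tangentCoord_tangentCoordSymm (hs (hfΩ u hu)),
        tangentCoord_tangentCoordSymm (hs (hfΩ u hu))] at h1
      have h2 := congrArg q h1
      exact (hFu.1 a).symm.trans (h2.trans (hFu.1 b))
    · ext v
      refine Iff.trans ?_ (hFu.2 v).symm
      constructor
      · rintro ⟨a, rfl⟩
        exact ⟨a, (tangentCoord_tangentCoordSymm (hs (hfΩ u hu)) _).symm⟩
      · rintro ⟨a, ha⟩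
        refine ⟨a, ?_⟩
        have h1 := congrArg (tangentCoordSymm E x₀ (c.symm (f u))) ha
        rw [tangentCoordSymm_tangentCoord (hs (hfΩ u hu))] at h1
        exact h1

end Involutive

/-! ### The range distribution and the main theorem -/

namespace PseudoRiemannianMetric

variable {E : Type*} [NormedAddCommGroup E] [NormedSpace ℝ E] [FiniteDimensional ℝ E]
  {M : Type*} [TopologicalSpace M] [ChartedSpace E M] [IsManifold 𝓘(ℝ, E) ∞ M]
  {g : PseudoRiemannianMetric E M} {p : ℕ} {ε : ℝ}

/-- The ranges of nilpotent roots of the curvature tensor form a smooth distribution. -/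
lemma isSmoothDistribution_range (hp : 5 ≤ p) (hsig : g.HasSignature p p) (hε : ε = 1 ∨ ε = -1)
    {φ : Π x : M, TangentSpace 𝓘(ℝ, E) x →L[ℝ] TangentSpace 𝓘(ℝ, E) x}
    (hφ : ∀ x, g.IsNilpotentCurvatureRoot ε x (φ x)) :
    IsSmoothDistribution p (fun x ↦ LinearMap.range (φ x).toLinearMap) := by
  intro x₀
  have hε0 : ε ≠ 0 := by rcases hε with rfl | rfl <;> norm_num
  -- The given `φ` need not be continuous. A smooth root `ψ` has the same range, since both ranges
  -- are the nullity space of the curvature.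
  obtain ⟨U, hU, hxU, ψ, hψs, hψ⟩ := exists_smooth_root hp hsig hε (fun y ↦ ⟨φ y, hφ y⟩) x₀
  have hrange {x : M} (hx : x ∈ U) :
      LinearMap.range (ψ x).toLinearMap = LinearMap.range (φ x).toLinearMap := by
    ext v
    rw [(hψ x hx).mem_range_iff hε0 (by omega) hsig, (hφ x).mem_range_iff hε0 (by omega) hsig]
  have hb := finBasisOfFinrankEq ℝ (LinearMap.range (ψ x₀).toLinearMap)
    ((hψ x₀ hxU).finrank_range hsig)
  have hw (i : Fin p) : ∃ w, ψ x₀ w = (hb i : TangentSpace 𝓘(ℝ, E) x₀) := (hb i).2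
  choose w hw using hw
  let X (i : Fin p) : Π x : M, TangentSpace 𝓘(ℝ, E) x := fun x ↦ ψ x (coordField x₀ (w i) x)
  have hx₀ := mem_chart_source E x₀
  have hX {y : M} (hyU : y ∈ U) (hy : y ∈ (chartAt E x₀).source) (i) : CMDiffAt ∞ (T% (X i)) y :=
    ContMDiffAt.clm_bundle_apply (hψs.contMDiffAt (hU.mem_nhds hyU))
      (isSmoothNear_coordField hy (w i)).contMDiffAt
  have hli : LinearIndependent ℝ fun i ↦ tangentCoord E x₀ x₀ (X i x₀) := by
    have h1 : LinearIndependent ℝ fun i ↦ X i x₀ := by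
      have h2 : (fun i ↦ X i x₀) = fun i ↦ (hb i : TangentSpace 𝓘(ℝ, E) x₀) := by
        funext i
        simp only [X, coordField_self, hw]
      rw [h2]
      exact hb.linearIndependent.map' (Submodule.subtype _) (Submodule.ker_subtype _)
    refine h1.map' (tangentCoord E x₀ x₀).toLinearMap (LinearMap.ker_eq_bot.2 fun a b hab ↦ ?_)
    have := congrArg (tangentCoordSymm E x₀ x₀) hab
    exact (tangentCoordSymm_tangentCoord hx₀ a).symm.trans
      (this.trans (tangentCoordSymm_tangentCoord hx₀ b))
  have hcont : ContinuousAt (fun y i ↦ tangentCoord E x₀ y (X i y)) x₀ :=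
    continuousAt_pi.2 fun i ↦ ((contMDiffAt_iff_tangentCoord le_rfl hx₀).1 (hX hxU hx₀ i)).continuousAt
  -- Linear independence is open in the fixed space `E`. Together with the constant rank `p` of the
  -- range, it makes the `X i` a frame nearby.
  have hev := hcont.eventually (isOpen_setOfPred_linearIndependent.mem_nhds hli)
  obtain ⟨W, hW, hWo, hxW⟩ := mem_nhds_iff.1
    ((hev.and (eventually_mem_chart_source hx₀)).and (hU.mem_nhds hxU))
  refine ⟨W, hWo, hxW, X, fun i y hy ↦ (hX (hW hy).2 (hW hy).1.2 i).contMDiffWithinAt,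
    fun y hy ↦ ?_⟩
  have h1 : LinearIndependent ℝ fun i ↦ X i y :=
    LinearIndependent.of_comp (tangentCoord E x₀ y).toLinearMap (hW hy).1.1
  refine ⟨h1, ?_⟩
  change Submodule.span ℝ _ = LinearMap.range (φ y).toLinearMap
  refine Submodule.eq_of_le_of_finrank_eq ?_ ?_
  · rw [Submodule.span_le, ← hrange (hW hy).2]
    rintro _ ⟨i, rfl⟩
    exact ⟨_, rfl⟩
  · rw [finrank_span_eq_card h1, (hφ y).finrank_range hsig, Fintype.card_fin]

end PseudoRiemannianMetric

theorem lemma5p1 {E : Type*} [NormedAddCommGroup E] [NormedSpace ℝ E] [FiniteDimensional ℝ E]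
    {M : Type*} [TopologicalSpace M] [T2Space M] [SecondCountableTopology M] [ConnectedSpace M]
    [ChartedSpace E M] [IsManifold 𝓘(ℝ, E) ∞ M]
    (g : PseudoRiemannianMetric E M) (p : ℕ) (hp : 5 ≤ p) (hsig : g.HasSignature p p)
    (hg : g.IsSpacelikeRankTwoNilpotentJordanIP) :
    ∃ ε : ℝ, (ε = 1 ∨ ε = -1) ∧
      (∀ x₀ : M, ∃ U : Set M, IsOpen U ∧ x₀ ∈ U ∧
        ∃ φ : Π x : M, TangentSpace 𝓘(ℝ, E) x →L[ℝ] TangentSpace 𝓘(ℝ, E) x,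
          ContMDiffOn 𝓘(ℝ, E) (𝓘(ℝ, E).prod 𝓘(ℝ, E →L[ℝ] E)) ∞
            (fun x ↦ TotalSpace.mk' (E →L[ℝ] E) x (φ x)) U ∧
          ∀ x ∈ U, g.IsNilpotentCurvatureRoot ε x (φ x)) ∧
      ∀ φ : Π x : M, TangentSpace 𝓘(ℝ, E) x →L[ℝ] TangentSpace 𝓘(ℝ, E) x,
        (∀ x, g.IsNilpotentCurvatureRoot ε x (φ x)) →
          IsIntegrableDistribution p (fun x ↦ LinearMap.range (φ x).toLinearMap) := by
  obtain ⟨ε, hε, hroot⟩ := PseudoRiemannianMetric.exists_sign hp hsig hg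
  refine ⟨ε, hε, PseudoRiemannianMetric.exists_smooth_root hp hsig hε hroot, fun φ hφ ↦ ?_⟩
  have hε0 : ε ≠ 0 := by rcases hε with rfl | rfl <;> norm_num
  -- Membership in the range becomes a condition on the curvature alone, so involutivity follows
  -- from the bracket property of nullity fields.
  have hmem (y : M) (v : TangentSpace 𝓘(ℝ, E) y) := (hφ y).mem_range_iff hε0 (by omega) hsig v
  refine (PseudoRiemannianMetric.isSmoothDistribution_range hp hsig hε hφ).isIntegrableDistribution
    fun y ξ η hξ hη hξK hηK ↦ (hmem y _).2 ?_
  exact PseudoRiemannianMetric.curvature_mlieBracket_eq_zero hξ hη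
    (hξK.mono fun z hz ↦ (hmem z _).1 hz) (hηK.mono fun z hz ↦ (hmem z _).1 hz)
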